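/- **Setting.** Colour the sites of $\mathbb{Z}^2$ black and the faces of $\mathbb{Z}^2$ (sites of the dual lattice) white, and replace each of them by a diamond; the diamonds are the faces of the medial lattice, whose vertices are the midpoints of the edges of $\mathbb{Z}^2$, and each medial edge separates a black diamond from a white one. Medial edges are oriented counterclockwise around black diamonds. A Dobrushin domain $(\mathcal{D},a,b)$ is the finite graph $\mathcal D$ of all sites and edges of $\mathbb{Z}^2$ on or inside a self-avoiding polygon of $\mathbb{Z}^2$, with two sites $a,b$ of the polygon. The free arc $(ab)$ and the wired arc $(ba)$ are the counterclockwise arcs of the polygon from $a$ to $b$ and from $b$ to $a$; the free arc is assumed to contain at least one edge (if $a=b$, it is the whole polygon and the wired arc is $\{a\}$). The sites of the wired arc include $a$ and $b$. Let $\mathbb{P}=\mathbb{P}_{\mathcal{D},a,b}$ be the random-cluster measure on $\mathcal{D}$ with $q=2$, $p=\sqrt2/(1+\sqrt2)$, wired on $(ba)$ and free on $(ab)$: $\mathbb{P}(\omega)\propto p^{o(\omega)}(1-p)^{c(\omega)}2^{k(\omega)}$, where $o$, $c$, $k$ are the numbers of open edges, of closed edges, and of clusters after all sites of the wired arc have been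 joined together. Let $e_a$ (resp. $e_b$) be the medial edge between the black diamond of $a$ (resp. $b$) and the white diamond outside $\mathcal D$ that is adjacent to the first (resp. last) edge of $(ab)$. The exploration path $\gamma$ runs along medial edges from $e_a$ to $e_b$, turning right at open edges and at the edges of the wired arc, and left at all other edges. With $W_\gamma(e_a,e)$ the total rotation of $\gamma$ from the centre of $e_a$ to the centre of $e$, set $$F(e)=\mathbb{E}\big[e^{-\frac{i}{2}W_\gamma(e_a,e)}\mathbf 1_{e\in\gamma}\big].$$ Put $\rho=\frac{2}{\sqrt2+1}$. Black walk: from a site of $\mathcal{D}$, the continuous-time walk jumps at rate $1$ along each incident edge of $\mathcal{D}$; from a site of the free arc (other than $a,b$) it also jumps, at rate $\rho$ for each of them, along the incident edges of $\mathbb{Z}^2$ not in $\mathcal{D}$, onto an extra layer of black faces (regarded as distinct from the faces of the domain). $\mathbf{HM}_\bullet(B)$ is the probability that this walk started at $B$ hits the wired arc before the extra layer. White walk: from a face inside the polygon, the continuous-time walk jumps at rate $1$ across each side that is not an edge of the wired arc, to the neighbouring face inside the polygon or to the white face of the free arc beyond that side, and at rate $\rho$ across each side that is an edge of the wired arc,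 onto an extra layer of white faces. $\mathbf{HM}_\circ(W)$ is the probability that this walk started at $W$ hits the extra layer before the free arc. **Proposition (uniform comparability).** Let $(\mathcal{D},a,b)$ be a Dobrushin domain, and let $e$ be a medial edge along the free arc, that is, $e=e_a$, or $e=e_b$, or $e$ separates the black face of a site of the free arc other than $a,b$ from a white face outside the polygon. Let $B$ be the black face that $e$ borders, and let $W$ be any white face inside the polygon adjacent to $B$. Then $$\sqrt{\mathbf{HM}_\circ(W)}\le |F(e)|\le\sqrt{\mathbf{HM}_\bullet(B)}.$$ -/

import Mathlib

open scoped NNReal ENNReal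

noncomputable section

namespace FKIsing

/-! ### Continuous-time random walks with four possible jumps -/

/-- A continuous-time random walk on `S` that, from the state `s`, makes for each of four directions
`d` the jump to `target s d` at rate `rate s d`. A state all of whose rates vanish is absorbing. -/
structure FourWayWalk (S : Type) where
  target : S → Fin 4 → S
  rate : S → Fin 4 → ℝ≥0

namespace FourWayWalk

variable {S : Type} (w : FourWayWalk S)

/-- The total jump rate out of a state. -/
def totalRate (s : S) : ℝ≥0 := ∑ d, w.rate s d

/-- The rate of the exponential holding time at a state. At an absorbing state, where the next
state of the jump chain is the same state, the value `1` has no influence on the process. -/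
def holdingRate (s : S) : ℝ≥0 := if w.totalRate s = 0 then 1 else w.totalRate s

/-- The law of the state to which the walk jumps from `s`. -/
def jumpLaw [MeasurableSpace S] (s : S) : MeasureTheory.Measure S :=
  if w.totalRate s = 0 then MeasureTheory.Measure.dirac s
  else ∑ d, ((w.rate s d / w.totalRate s : ℝ≥0) : ℝ≥0∞) • MeasureTheory.Measure.dirac (w.target s d)

instance [MeasurableSpace S] (s : S) : MeasureTheory.IsProbabilityMeasure (w.jumpLaw s) := by
  unfold jumpLaw
  split_ifs with h
  · infer_instance
  · constructor
    simp only [MeasureTheory.Measure.coe_finsetSum, Finset.sum_apply,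
      MeasureTheory.Measure.smul_apply, MeasureTheory.measure_univ, smul_eq_mul, mul_one]
    rw [← ENNReal.ofNNReal_finsetSum, ← Finset.sum_div]
    exact_mod_cast div_self h

/-- The transition kernel of the jump chain. -/
def jumpKernel [MeasurableSpace S] [DiscreteMeasurableSpace S] : ProbabilityTheory.Kernel S S where
  toFun := w.jumpLaw
  measurable' := Measurable.of_discrete

instance [MeasurableSpace S] [DiscreteMeasurableSpace S] :
    ProbabilityTheory.IsMarkovKernel w.jumpKernel :=
  ⟨fun s => inferInstanceAs (MeasureTheory.IsProbabilityMeasure (w.jumpLaw s))⟩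

/-- The law of the jump chain started at `s`: a discrete-time Markov chain. -/
def chainLaw [MeasurableSpace S] [DiscreteMeasurableSpace S] (s : S) :
    MeasureTheory.Measure (ℕ → S) :=
  ProbabilityTheory.Kernel.trajMeasure (X := fun _ => S) (MeasureTheory.Measure.dirac s)
    (fun n => w.jumpKernel.comap (fun h : (i : Finset.Iic n) → S => h ⟨n, Finset.mem_Iic.2 le_rfl⟩)
      (measurable_pi_apply _))

/-- The underlying probability measure of the walk started at `s`: the jump chain, and an
independent sequence of independent exponential variables of parameter `1`. -/
def law [MeasurableSpace S] [DiscreteMeasurableSpace S] (s : S) :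
    MeasureTheory.Measure ((ℕ → S) × (ℕ → ℝ)) :=
  (w.chainLaw s).prod (MeasureTheory.Measure.infinitePi fun _ => ProbabilityTheory.expMeasure 1)

/-- The time at which the walk makes its `n`-th jump; the holding time at a state is exponential
with parameter the total jump rate. -/
def jumpTime (ω : (ℕ → S) × (ℕ → ℝ)) (n : ℕ) : ℝ :=
  ∑ k ∈ Finset.range n, ω.2 k / (w.holdingRate (ω.1 k) : ℝ)

/-- The walk is at the state `s` at time `t`. -/
def IsAt (ω : (ℕ → S) × (ℕ → ℝ)) (t : ℝ) (s : S) : Prop :=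
  ∃ n, w.jumpTime ω n ≤ t ∧ t < w.jumpTime ω (n + 1) ∧ ω.1 n = s

/-- The event that the walk hits `A` before hitting `B`. -/
def hitsBefore (A B : Set S) : Set ((ℕ → S) × (ℕ → ℝ)) :=
  {ω | ∃ t, 0 ≤ t ∧ (∃ s ∈ A, w.IsAt ω t s) ∧ ∀ r, 0 ≤ r → r < t → ∀ s ∈ B, ¬ w.IsAt ω r s}

/-- The probability that the walk started at `s` hits `A` before hitting `B`. -/
def hittingProb [MeasurableSpace S] [DiscreteMeasurableSpace S] (s : S) (A B : Set S) : ℝ :=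
  (w.law s (w.hitsBefore A B)).toReal

end FourWayWalk

instance {α β : Type} [MeasurableSpace α] [MeasurableSpace β] [DiscreteMeasurableSpace α]
    [DiscreteMeasurableSpace β] : DiscreteMeasurableSpace (α ⊕ β) :=
  ⟨fun _ => measurableSet_sum_iff.2 ⟨.of_discrete, .of_discrete⟩⟩

/-! ### The square lattice, its faces and the edges of the medial lattice -/

/-- A site of the square lattice, that is, a black face of the medial lattice. -/
abbrev Site := ℤ × ℤ

/-- A face of the square lattice, named by its lower left corner, so that `(i, j)` is the unit
square `[i, i+1] × [j, j+1]`; that is, a white face of the medial lattice. -/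
abbrev Face := ℤ × ℤ

/-- The four directions east, north, west, south, in counterclockwise order. -/
def dir : Fin 4 → ℤ × ℤ := ![(1, 0), (0, 1), (-1, 0), (0, -1)]

/-- The lattice edge that leaves `x` in the direction `d`. -/
def edgeAt (x : Site) (d : Fin 4) : Sym2 Site := s(x, x + dir d)

/-- The face that touches `x` between the directions `d` and `d + 1`, in the north-east,
north-west, south-west, south-east for `d = 0, 1, 2, 3`. For a step from `x` in the direction `d`
the face on its left is `faceAt x d` and the face on its right is `faceAt x (d - 1)`. -/
def faceAt (x : Site) (d : Fin 4) : Face :=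
  x + (![(0, 0), (-1, 0), (-1, -1), (0, -1)] : Fin 4 → ℤ × ℤ) d

/-- An edge of the medial lattice. The medial edge `(x, d)` separates the black diamond of the site
`x` from the white diamond of the face `faceAt x d`. The vertices of the medial lattice are the
midpoints of the lattice edges; with the orientation that is counterclockwise around black diamonds,
`(x, d)` goes from the midpoint of `edgeAt x d` to the midpoint of `edgeAt x (d + 1)`. -/
abbrev MedialEdge := Site × Fin 4

/-! ### Dobrushin domains -/

/-- A Dobrushin domain. `faces` is the finite set of lattice faces that make up the inside of the
domain. Its boundary is a self-avoiding polygon, run through counterclockwise (inside on the left)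
by the sites `vertex 0, …, vertex len = vertex 0`, the step from `vertex k` to `vertex (k + 1)`
having direction `step k`; the field `covers` says that the polygon is the whole boundary of the set
of faces, so that `faces` is exactly the set of faces inside the polygon. The marked sites are
`a = vertex 0` and `b = vertex mid`. The free arc `(ab)` consists of the steps `k < mid` and the
wired arc `(ba)` of the steps `mid ≤ k < len`. If `mid = len`, then `a = b`, the free arc is the whole
polygon and the wired arc is the single site `a`. -/
structure DobrushinDomain where
  faces : Finset Face
  len : ℕ
  mid : ℕ
  vertex : ℕ → Site
  step : ℕ → Fin 4
  mid_pos : 0 < mid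
  mid_le : mid ≤ len
  vertex_succ : ∀ k < len, vertex (k + 1) = vertex k + dir (step k)
  closed : vertex len = vertex 0
  selfAvoiding : ∀ j < len, ∀ k < len, vertex j = vertex k → j = k
  left_mem : ∀ k < len, faceAt (vertex k) (step k) ∈ faces
  right_notMem : ∀ k < len, faceAt (vertex k) (step k - 1) ∉ faces
  covers : ∀ x d, faceAt x d ∈ faces → faceAt x (d - 1) ∉ faces →
    ∃ k < len, vertex k = x ∧ step k = d

namespace DobrushinDomain

variable (D : DobrushinDomain)

/-- The sites of the domain: the corners of its faces. -/
def sites : Finset Site :=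
  D.faces.biUnion fun f => {f, f + (1, 0), f + (0, 1), f + (1, 1)}

/-- The edges of the domain: the sides of its faces. -/
def edges : Finset (Sym2 Site) :=
  D.faces.biUnion fun f =>
    {s(f, f + (1, 0)), s(f, f + (0, 1)), s(f + (0, 1), f + (1, 1)), s(f + (1, 0), f + (1, 1))}

/-- The sites of the wired arc, from `b` to `a`, both included. -/
def wiredSites : Finset Site := (Finset.Icc D.mid D.len).image D.vertex

/-- The polygon edges of the wired arc. -/
def wiredEdges : Finset (Sym2 Site) :=
  (Finset.Ico D.mid D.len).image fun k => edgeAt (D.vertex k) (D.step k)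

/-! ### The critical FK Ising measure with Dobrushin boundary conditions -/

/-- The graph `ω ∪ ξ` on the sites of the domain: the open edges, and an extra edge between any two
sites of the wired arc. -/
def clusterGraph (ω : Finset (Sym2 Site)) : SimpleGraph {x : Site // x ∈ D.sites} :=
  SimpleGraph.fromRel fun x y =>
    s(x.1, y.1) ∈ ω ∨ (x.1 ∈ D.wiredSites ∧ y.1 ∈ D.wiredSites)

/-- The number of clusters, the sites of the wired arc being wired together. -/
def clusterCount (ω : Finset (Sym2 Site)) : ℕ := Nat.card (D.clusterGraph ω).ConnectedComponent

/-- The self-dual parameter for `q = 2`. -/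
def pCritical : ℝ := √2 / (1 + √2)

/-- The weight `p ^ o(ω) * (1 - p) ^ c(ω) * q ^ k(ω, ξ)` with `q = 2`; `ω` is the set of open
edges. -/
def weight (ω : Finset (Sym2 Site)) : ℝ :=
  pCritical ^ ω.card * (1 - pCritical) ^ (D.edges \ ω).card * 2 ^ D.clusterCount ω

/-- The partition function. -/
def partitionFunction : ℝ := ∑ ω ∈ D.edges.powerset, D.weight ω

/-- The probability of the configuration `ω`. -/
def prob (ω : Finset (Sym2 Site)) : ℝ := D.weight ω / D.partitionFunction

/-! ### The exploration path and the fermionic observable -/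

/-- The medial edge `e_a`, between the black diamond of `a` and the white diamond to the right of
the first step of the free arc. -/
def startEdge : MedialEdge := (D.vertex 0, D.step 0 - 1)

/-- The medial edge `e_b`, between the black diamond of `b` and the white diamond to the right of
the last step of the free arc. -/
def endEdge : MedialEdge := (D.vertex D.mid, D.step (D.mid - 1) + 2)

/-- Whether an interface that arrives along the medial edge `e` meets an open edge at the end of `e`.
The interfaces do not cross the edges of the wired arc, which count as open. -/
def MeetsOpen (ω : Finset (Sym2 Site)) (e : MedialEdge) : Prop :=
  edgeAt e.1 (e.2 + 1) ∈ ω ∪ D.wiredEdges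

instance (ω : Finset (Sym2 Site)) (e : MedialEdge) : Decidable (D.MeetsOpen ω e) :=
  inferInstanceAs (Decidable (_ ∈ _))

/-- The medial edge that follows `e` on an interface between primal and dual clusters: at an open
edge the interface turns right and continues along the diamond of the other end of that edge; at a
closed edge it turns left and continues around the same black diamond. -/
def next (ω : Finset (Sym2 Site)) (e : MedialEdge) : MedialEdge :=
  if D.MeetsOpen ω e then (e.1 + dir (e.2 + 1), e.2 - 1) else (e.1, e.2 + 1)

/-- The medial edge reached after `k` steps of the interface that starts from `e_a`. -/
def interface (ω : Finset (Sym2 Site)) (k : ℕ) : MedialEdge := (D.next ω)^[k] D.startEdge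

/-- The exploration path, which is the interface from `e_a` up to the arrival at `e_b`, is at the
medial edge `e` after `k` steps. -/
def PassesAt (ω : Finset (Sym2 Site)) (e : MedialEdge) (k : ℕ) : Prop :=
  D.interface ω k = e ∧ ∀ j, 0 < j → j < k → D.interface ω j ≠ D.endEdge

/-- The winding of the interface in its first `k` steps, from the centre of `e_a` to the centre of the
edge reached: each left turn contributes `π / 2` and each right turn `-π / 2`. -/
def winding (ω : Finset (Sym2 Site)) (k : ℕ) : ℝ :=
  ∑ j ∈ Finset.range k, if D.MeetsOpen ω (D.interface ω j) then -(Real.pi / 2) else Real.pi / 2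

open Classical in
/-- The random variable `exp (-(i/2) W(e_a, e)) 1_{e ∈ γ}`. -/
def windingPhase (ω : Finset (Sym2 Site)) (e : MedialEdge) : ℂ :=
  if h : ∃ k, D.PassesAt ω e k then
    Complex.exp (-(1 / 2) * Complex.I * (D.winding ω (Nat.find h) : ℂ))
  else 0

/-- The fermionic observable: the expectation of `windingPhase`. -/
def F (e : MedialEdge) : ℂ := ∑ ω ∈ D.edges.powerset, (D.prob ω : ℂ) * D.windingPhase ω e

/-- The medial edges of the domain that lie along the free arc, between a black diamond of the arc
and a white diamond outside: `e_a`, `e_b`, and the medial edges between the diamond of a site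
strictly inside the free arc and the diamond of a face outside the domain. -/
def IsFreeArcMedialEdge (e : MedialEdge) : Prop :=
  e = D.startEdge ∨ e = D.endEdge ∨
    ((∃ k, 0 < k ∧ k < D.mid ∧ D.vertex k = e.1) ∧ faceAt e.1 e.2 ∉ D.faces)

/-! ### The random walks on the black and on the white faces, and the harmonic measures -/

/-- The jump rate onto the extra layers. -/
def rho : ℝ≥0 := 2 / (NNReal.sqrt 2 + 1)

/-- The walk on the black faces of the extended domain. A state `Sum.inl x` is the diamond of a site
of the domain, a state `Sum.inr x` a diamond of the extra layer, even if `x` is also a site of the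
domain. The diamonds of the extra layer that are adjacent to a site of the free arc are reached
through the lattice edges at that site that do not belong to the domain. The walk is stopped on the
wired arc and on the extra layer. -/
def blackWalk : FourWayWalk (Site ⊕ Site) where
  target
    | .inl x, d => if edgeAt x d ∈ D.edges then .inl (x + dir d) else .inr (x + dir d)
    | .inr x, _ => .inr x
  rate
    | .inl x, d => if x ∈ D.wiredSites then 0 else if edgeAt x d ∈ D.edges then 1 else rho
    | .inr _, _ => 0

/-- The harmonic measure of the wired arc from the black face `B`: the probability to hit the wired
arc before the extra layer along the free arc. -/
def HMBlack (B : Site) : ℝ :=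
  D.blackWalk.hittingProb (.inl B) {s | ∃ x ∈ D.wiredSites, s = .inl x} {s | ∃ x, s = .inr x}

/-- The side shared by the face `f` and its neighbour `f + dir d`. -/
def sideAt (f : Face) (d : Fin 4) : Sym2 Site :=
  (![s(f + (1, 0), f + (1, 1)), s(f + (0, 1), f + (1, 1)), s(f, f + (0, 1)), s(f, f + (1, 0))] :
    Fin 4 → Sym2 Site) d

/-- The white faces of the free arc: the faces outside that touch an edge of the free arc. -/
def freeWhiteFaces : Finset Face :=
  (Finset.range D.mid).image fun k => faceAt (D.vertex k) (D.step k - 1)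

/-- The walk on the white faces of the extended domain. A state `Sum.inl f` is the diamond of a face
inside the domain or on the free arc, a state `Sum.inr f` a diamond of the extra layer, which is
reached through an edge of the wired arc. The walk is stopped on the free arc and on the extra
layer. -/
def whiteWalk : FourWayWalk (Face ⊕ Face) where
  target
    | .inl f, d => if sideAt f d ∈ D.wiredEdges then .inr (f + dir d) else .inl (f + dir d)
    | .inr f, _ => .inr f
  rate
    | .inl f, d => if f ∈ D.faces then (if sideAt f d ∈ D.wiredEdges then rho else 1) else 0
    | .inr _, _ => 0

/-- The harmonic measure of the wired arc from the white face `W`: the probability to hit the extra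
layer along the wired arc before the free arc. -/
def HMWhite (W : Face) : ℝ :=
  D.whiteWalk.hittingProb (.inl W) {s | ∃ f, s = .inr f} {s | ∃ f ∈ D.freeWhiteFaces, s = .inl f}

end DobrushinDomain

end FKIsing

end

namespace FKIsing

/-! ### Lattice identities -/

/-! The squared modulus of the observable is the increment of a potential whose boundary values are
explicit. Pairing the configurations that differ at one edge gives `F_relation`: at a medial vertex
inside the domain, the two incoming values of F determine the outgoing ones. By the parallelogram
identity |F|^2 is then closed (`normSq_F_closed`). With the value 1 on the outer side of the wired
arc it is closed everywhere (`increment_closed`), so there are functions H on black and H' on white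
faces with H(B) - H'(W) = |F(e)|^2 whenever the regular medial edge e separates B from W. They can
be normalised to H = 1 on the wired arc and H' = 0 on the white faces of the free arc
(`exists_isPotential`). For e along the free arc this gives |F(e)|^2 = H(B), and H'(W) ≤ H(B) for
every inner W adjacent to B.

The direction of e determines the argument of F(e) modulo π (`exists_F_eq_real_mul`). Hence the
Laplacian of H at a site, written with the four values of F around it, is a sum of two squares
(`sum_turnForm_nonneg`); around a white face the same form appears with the opposite sign. The rate
rho is the one for which a forced turn at the boundary contributes the same expression as an inner
edge. So H is subharmonic for the black walk and H' superharmonic for the white walk, and the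
maximum principle `nonpos_of_subharmonic` compares them with the hitting probabilities: H ≤ HMBlack
and HMWhite ≤ H'.

The only winding fact needed is `prod_turn_orbit`: the turns of a closed interface have total phase
-1. Its proof is algebraic and uses no Jordan curve theorem. Opening an edge multiplies the
successor permutation by a transposition and two turn phases by i each, so sign times total phase is
invariant (`balanced_insert_iff`). Toggling finitely many edges reduces a loop to a configuration
made of loops around single faces. Connectivity is likewise read off from height functions of
interfaces (`exists_height`), which are constant on clusters.

On the probabilistic side, holding times do not influence which absorbing set is hit:
`law_hitsBefore` reduces the continuous-time event to the jump chain, and monotone convergence then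
gives harmonicity (`sum_rate_mul_sub_hittingProb`). -/

theorem dir_add_two (d : Fin 4) : dir (d + 2) = -dir d := by
  fin_cases d <;> simp [dir]

theorem add_dir_add_dir (x : Site) (d : Fin 4) : x + dir d + dir (d + 2) = x := by
  rw [dir_add_two]; abel

theorem edgeAt_flip (x : Site) (d : Fin 4) : edgeAt (x + dir d) (d + 2) = edgeAt x d := by
  rw [edgeAt, add_dir_add_dir, edgeAt, Sym2.eq_swap]

theorem dir_injective : Function.Injective dir := by
  intro c d h
  fin_cases c <;> fin_cases d <;> simp [dir] at h ⊢

theorem dir_ne_zero (d : Fin 4) : dir d ≠ 0 := by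
  fin_cases d <;> simp [dir]

theorem edgeAt_eq_iff {x x' : Site} {d d' : Fin 4} :
    edgeAt x' d' = edgeAt x d ↔ (x' = x ∧ d' = d) ∨ (x' = x + dir d ∧ d' = d + 2) := by
  constructor
  · intro h
    rw [edgeAt, edgeAt, Sym2.eq_iff] at h
    rcases h with ⟨h, h'⟩ | ⟨h, h'⟩
    · subst h; exact .inl ⟨rfl, dir_injective (add_left_cancel h')⟩
    · refine .inr ⟨h, dir_injective ?_⟩
      rw [dir_add_two, eq_neg_iff_add_eq_zero]
      rw [h, add_assoc, add_eq_left] at h'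
      rw [add_comm, h']
  · rintro (⟨rfl, rfl⟩ | ⟨rfl, rfl⟩)
    · rfl
    · exact edgeAt_flip _ _

/-- This and the next lemma name the two faces beside an edge from its other end; heights and
potentials at the two ends are compared through them. -/
theorem faceAt_left (x : Site) (d : Fin 4) : faceAt (x + dir d) (d + 1) = faceAt x d := by
  fin_cases d <;> simp [faceAt, dir, add_assoc]

theorem faceAt_right (x : Site) (d : Fin 4) : faceAt (x + dir d) (d + 2) = faceAt x (d - 1) := by
  fin_cases d <;> simp [faceAt, dir, add_assoc]

/-- The corner of the face `f` at which `f` lies between the directions `d` and `d + 1`. -/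
def corner (f : Face) (d : Fin 4) : Site :=
  f + (![(0, 0), (1, 0), (1, 1), (0, 1)] : Fin 4 → ℤ × ℤ) d

theorem faceAt_corner (f : Face) (d : Fin 4) : faceAt (corner f d) d = f := by
  fin_cases d <;> simp [faceAt, corner, add_assoc]

theorem corner_faceAt (x : Site) (d : Fin 4) : corner (faceAt x d) d = x := by
  fin_cases d <;> simp [faceAt, corner, add_assoc]

theorem faceAt_eq_iff {x : Site} {d : Fin 4} {f : Face} : faceAt x d = f ↔ x = corner f d :=
  ⟨fun h => by rw [← h, corner_faceAt], fun h => by rw [h, faceAt_corner]⟩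

theorem corner_add_dir (f : Face) (d : Fin 4) : corner f d + dir d = corner f (d + 1) := by
  rw [← faceAt_eq_iff, faceAt_left, faceAt_corner]

/-! ### Potentials of closed forms on the square lattice -/

section Potential

variable {R : Type*} [CommRing R]

theorem exists_int_primitive (g : ℤ → R) : ∃ G : ℤ → R, ∀ n, G (n + 1) - G n = g n := by
  -- Truncation by `toNat` leaves at most one of the two sums nonempty, so a single formula
  -- telescopes in both directions.
  refine ⟨fun n => ∑ k ∈ Finset.range n.toNat, g k -
    ∑ k ∈ Finset.range (-n).toNat, g (-1 - k), fun n => ?_⟩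
  obtain ⟨m, rfl | rfl⟩ := Int.eq_nat_or_neg n
  · have h1 : ((m : ℤ) + 1).toNat = m + 1 := by omega
    have h2 : (-((m : ℤ) + 1)).toNat = 0 := by omega
    have h3 : (-(m : ℤ)).toNat = 0 := by omega
    simp only [h1, h2, h3, Int.toNat_natCast, Finset.sum_range_succ, Finset.sum_range_zero]
    ring
  · cases m with
    | zero => simp
    | succ m =>
      have h1 : (-((m + 1 : ℕ) : ℤ) + 1).toNat = 0 := by omega
      have h2 : (-(-((m + 1 : ℕ) : ℤ) + 1)).toNat = m := by omega
      have h3 : (-((m + 1 : ℕ) : ℤ)).toNat = 0 := by omega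
      have h4 : (- -((m + 1 : ℕ) : ℤ)).toNat = m + 1 := by omega
      have h5 : (-1 - (m : ℤ)) = -((m + 1 : ℕ) : ℤ) := by push_cast; ring
      simp only [h1, h2, h3, h4, Finset.sum_range_succ, h5]
      ring

/-- A form on the edges of the square lattice whose circulation around every face vanishes is the
difference of a function on the sites. -/
theorem exists_primitive (g₁ g₂ : ℤ → ℤ → R)
    (h : ∀ i j, g₁ i j + g₂ (i + 1) j = g₂ i j + g₁ i (j + 1)) :
    ∃ H : ℤ → ℤ → R, (∀ i j, H (i + 1) j - H i j = g₁ i j) ∧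
      ∀ i j, H i (j + 1) - H i j = g₂ i j := by
  obtain ⟨G, hG⟩ := exists_int_primitive fun i => g₁ i 0
  choose K hK using fun i => exists_int_primitive (g₂ i)
  refine ⟨fun i j => G i + (K i j - K i 0), fun i j => ?_, fun i j => ?_⟩
  -- By closedness the error in the horizontal increment is the same in all rows, and in row 0 it is
  -- corrected by G.
  · have step : ∀ j, K (i + 1) (j + 1) - K i (j + 1) - g₁ i (j + 1) =
        K (i + 1) j - K i j - g₁ i j := fun j => by
      linear_combination hK (i + 1) j - hK i j + h i j
    have key : ∀ j, K (i + 1) j - K i j - g₁ i j = K (i + 1) 0 - K i 0 - g₁ i 0 := by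
      intro j
      induction j using Int.induction_on with
      | zero => rfl
      | succ n ih => rw [step, ih]
      | pred n ih =>
        have := step (-(n : ℤ) - 1)
        rw [sub_add_cancel, ih] at this
        exact this.symm
    linear_combination key j + hG i
  · linear_combination hK i j

/-- A function on the medial edges whose alternating sum around every medial vertex vanishes is the
difference of a function on the black faces and a function on the white faces. -/
theorem exists_potential (w : MedialEdge → R)
    (h : ∀ x d, w (x, d - 1) - w (x, d) = w (x + dir d, d + 2) - w (x + dir d, d + 1)) :
    ∃ (Hb : Site → R) (Hw : Face → R), ∀ x d, Hb x - Hw (faceAt x d) = w (x, d) := by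
  have east : ∀ i j, w ((i, j), 3) - w ((i, j), 0) = w ((i + 1, j), 2) - w ((i + 1, j), 1) :=
    fun i j => by
      have := h (i, j) 0
      rw [show (0 : Fin 4) - 1 = 3 from rfl] at this
      simpa [dir] using this
  have north : ∀ i j, w ((i, j), 0) - w ((i, j), 1) = w ((i, j + 1), 3) - w ((i, j + 1), 2) :=
    fun i j => by simpa [dir] using h (i, j) 1
  -- The increment of H between neighbouring sites is routed through the white face north-east of
  -- the left, respectively lower, site.
  obtain ⟨H, h1, h2⟩ := exists_primitive
    (fun i j => w ((i + 1, j), 1) - w ((i, j), 0)) (fun i j => w ((i, j + 1), 3) - w ((i, j), 0))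
    (fun i j => by linear_combination - north (i + 1) j - east i (j + 1))
  refine ⟨fun x => H x.1 x.2, fun f => H f.1 f.2 - w (f, 0), ?_⟩
  rintro ⟨i, j⟩ d
  have a1 := h1 (i - 1) j
  have a2 := h2 i (j - 1)
  have a3 := h1 (i - 1) (j - 1)
  have a4 := north i (j - 1)
  simp only [sub_add_cancel] at a1 a2 a3 a4
  fin_cases d
  · simp [faceAt]
  · simp only [faceAt, Fin.mk_one, Matrix.cons_val_one, Matrix.cons_val_zero, Prod.mk_add_mk,
      add_zero, ← sub_eq_add_neg]
    linear_combination a1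
  · simp [faceAt, ← sub_eq_add_neg]
    linear_combination a3 + a2 - a4
  · simp [faceAt, ← sub_eq_add_neg]
    linear_combination a2

end Potential

end FKIsing

namespace FKIsing

open Equiv Equiv.Perm Function

/-! ### Cycles of permutations -/

section Cycles

variable {X : Type*} [Fintype X] [DecidableEq X]

/-- Both factors are multiplicative over disjoint permutations. -/
theorem sign_mul_prod_support (σ : Perm X) (t : X → ℂ) :
    ((sign σ : ℤ) : ℂ) * ∏ x ∈ σ.support, t x =
      ∏ c ∈ σ.cycleFactorsFinset, ((sign c : ℤ) : ℂ) * ∏ x ∈ c.support, t x := by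
  induction σ using cycle_induction_on with
  | base_one => simp
  | base_cycles σ hσ => simp [hσ.cycleFactorsFinset_eq_singleton]
  | induction_disjoint σ τ hd _ hσ hτ =>
    rw [hd.cycleFactorsFinset_mul_eq_union, Finset.prod_union hd.disjoint_cycleFactorsFinset,
      ← hσ, ← hτ, hd.support_mul, Finset.prod_union hd.disjoint_support, Perm.sign_mul]
    push_cast
    ring

theorem mem_periodicPts_of_finite {X : Type*} [Finite X] (σ : Perm X) (x : X) : x ∈ periodicPts σ :=
  ⟨orderOf σ, orderOf_pos σ, by
    rw [IsPeriodicPt, IsFixedPt, ← Perm.coe_pow, pow_orderOf_eq_one, Perm.coe_one, id]⟩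

theorem support_cycleOf_eq_image (σ : Perm X) {x : X} (hx : σ x ≠ x) :
    (cycleOf σ x).support = (Finset.range (minimalPeriod σ x)).image fun j => σ^[j] x := by
  ext y
  rw [mem_support_cycleOf_iff' hx, Finset.mem_image]
  constructor
  · intro h
    obtain ⟨i, rfl⟩ := h.exists_nat_pow_eq
    refine ⟨i % minimalPeriod σ x, Finset.mem_range.2 (Nat.mod_lt _ ?_), ?_⟩
    · exact minimalPeriod_pos_of_mem_periodicPts (mem_periodicPts_of_finite σ x)
    · rw [iterate_mod_minimalPeriod_eq, Perm.coe_pow]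
  · rintro ⟨j, -, rfl⟩
    exact ⟨j, by rw [zpow_natCast, Perm.coe_pow]⟩

theorem prod_support_cycleOf (σ : Perm X) (t : X → ℂ) {x : X} (hx : σ x ≠ x) :
    ∏ y ∈ (cycleOf σ x).support, t y = ∏ j ∈ Finset.range (minimalPeriod σ x), t (σ^[j] x) := by
  rw [support_cycleOf_eq_image σ hx, Finset.prod_image]
  exact fun i hi j hj h => iterate_injOn_Iio_minimalPeriod (Finset.mem_range.1 hi)
    (Finset.mem_range.1 hj) h

theorem sign_cycleOf (σ : Perm X) {x : X} (hx : σ x ≠ x) :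
    sign (cycleOf σ x) = -(-1) ^ minimalPeriod σ x := by
  rw [(isCycle_cycleOf σ hx).sign, support_cycleOf_eq_image σ hx, Finset.card_image_of_injOn,
    Finset.card_range]
  exact fun i hi j hj h => iterate_injOn_Iio_minimalPeriod (Finset.mem_range.1 hi)
    (Finset.mem_range.1 hj) h

/-- The sign of a permutation times the product of weights, when every cycle, except possibly the one
of `x₀`, is a cycle of length four whose total weight is `-1`. -/
theorem sign_mul_prod_of_fourCycles (σ : Perm X) (t : X → ℂ) (x₀ : X) (hfix : ∀ x, σ x ≠ x)
    (h : ∀ x, SameCycle σ x₀ x ∨ minimalPeriod σ x = 4 ∧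
      ∏ j ∈ Finset.range 4, t (σ^[j] x) = -1) :
    ((sign σ : ℤ) : ℂ) * ∏ x, t x = -(-1) ^ minimalPeriod σ x₀ *
      ∏ j ∈ Finset.range (minimalPeriod σ x₀), t (σ^[j] x₀) := by
  have hsupp : σ.support = Finset.univ := by ext x; simp [hfix x]
  -- A cycle of length four has sign -1 and, by hypothesis, weight -1, so only the cycle of `x₀`
  -- survives in the product.
  rw [← hsupp, sign_mul_prod_support, Finset.prod_eq_single (cycleOf σ x₀)]
  · rw [prod_support_cycleOf σ t (hfix x₀), sign_cycleOf σ (hfix x₀)]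
    push_cast
    rfl
  · intro c hc hne
    obtain ⟨x, hx⟩ := (mem_cycleFactorsFinset_iff.1 hc).1.nonempty_support
    obtain rfl := (eq_cycleOf_of_mem_cycleFactorsFinset_iff σ c hc x).2 hx
    rcases h x with h | ⟨h4, ht⟩
    · exact absurd h.cycleOf_eq.symm hne
    · rw [prod_support_cycleOf σ t (hfix x), sign_cycleOf σ (hfix x), h4, ht]
      norm_num
  · intro h
    exact absurd (cycleOf_mem_cycleFactorsFinset_iff.2 (mem_support.2 (hfix x₀))) h

theorem minimalPeriod_eq_four {Y : Type*} {f : Y → Y} {x : Y} (h4 : f^[4] x = x)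
    (h2 : f^[2] x ≠ x) : minimalPeriod f x = 4 :=
  minimalPeriod_eq_prime_pow (p := 2) (k := 1) h2 h4

end Cycles

/-! ### Interfaces -/

open Classical in
/-- The successor on the interfaces of the configuration with the set `O` of open edges. -/
noncomputable def medialPerm (O : Set (Sym2 Site)) : Perm MedialEdge where
  toFun e := if edgeAt e.1 (e.2 + 1) ∈ O then (e.1 + dir (e.2 + 1), e.2 - 1) else (e.1, e.2 + 1)
  invFun e := if edgeAt e.1 e.2 ∈ O then (e.1 + dir e.2, e.2 + 1) else (e.1, e.2 - 1)
  left_inv e := by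
    obtain ⟨x, d⟩ := e
    by_cases h : edgeAt x (d + 1) ∈ O
    · have h' : edgeAt (x + dir (d + 1)) (d - 1) ∈ O := by
        rw [← edgeAt_flip, show d + 1 + 2 = d - 1 by grind] at h
        exact h
      simp only [h, h', if_true]
      refine Prod.ext ?_ (by simp)
      have := add_dir_add_dir x (d + 1)
      rwa [show d + 1 + 2 = d - 1 by grind] at this
    · simp [h]
  right_inv e := by
    obtain ⟨x, d⟩ := e
    by_cases h : edgeAt x d ∈ O
    · have h' : edgeAt (x + dir d) (d + 1 + 1) ∈ O := by
        rw [← edgeAt_flip] at h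
        rwa [add_assoc]
      simp only [h, h', if_true]
      refine Prod.ext ?_ (by simp)
      simpa [add_assoc] using add_dir_add_dir x d
    · simp [h]

/-- At the midpoint of `edgeAt x d` the medial edges `(x, d - 1)` and `(x + dir d, d + 1)` arrive,
while `(x, d)` and `(x + dir d, d + 2)` leave. This and the next three lemmas give the two
matchings: a closed edge keeps the interface at its black face, an open one exchanges the black
faces. -/
theorem medialPerm_of_mem {O : Set (Sym2 Site)} {x : Site} {d : Fin 4} (h : edgeAt x d ∈ O) :
    medialPerm O (x, d - 1) = (x + dir d, d + 2) := by
  simp [medialPerm, h]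
  grind

theorem medialPerm_of_notMem {O : Set (Sym2 Site)} {x : Site} {d : Fin 4} (h : edgeAt x d ∉ O) :
    medialPerm O (x, d - 1) = (x, d) := by
  simp [medialPerm, h]

theorem medialPerm_flip_of_mem {O : Set (Sym2 Site)} {x : Site} {d : Fin 4} (h : edgeAt x d ∈ O) :
    medialPerm O (x + dir d, d + 1) = (x, d) := by
  rw [← edgeAt_flip] at h
  have := medialPerm_of_mem h
  rwa [add_dir_add_dir, show d + 2 - 1 = d + 1 by grind, show d + 2 + 2 = d by grind] at this

theorem medialPerm_flip_of_notMem {O : Set (Sym2 Site)} {x : Site} {d : Fin 4}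
    (h : edgeAt x d ∉ O) : medialPerm O (x + dir d, d + 1) = (x + dir d, d + 2) := by
  rw [← edgeAt_flip] at h
  have := medialPerm_of_notMem h
  rwa [show d + 2 - 1 = d + 1 by grind] at this

theorem medialPerm_ne (O : Set (Sym2 Site)) (e : MedialEdge) : medialPerm O e ≠ e := by
  intro h
  have := congrArg Prod.snd h
  simp only [medialPerm, coe_fn_mk] at this
  split_ifs at this <;> simp at this

/-- The indicator of a set of medial edges that is a union of interfaces is a closed form. -/
theorem indicator_closed {O : Set (Sym2 Site)} {T : Set MedialEdge}
    (hT : ∀ e, medialPerm O e ∈ T ↔ e ∈ T) (x : Site) (d : Fin 4) :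
    T.indicator (1 : MedialEdge → ℤ) (x, d - 1) - T.indicator (1 : MedialEdge → ℤ) (x, d) =
      T.indicator (1 : MedialEdge → ℤ) (x + dir d, d + 2) -
        T.indicator (1 : MedialEdge → ℤ) (x + dir d, d + 1) := by
  classical
  have h1 := hT (x, d - 1)
  have h2 := hT (x + dir d, d + 1)
  by_cases h : edgeAt x d ∈ O
  · rw [medialPerm_of_mem h] at h1
    rw [medialPerm_flip_of_mem h] at h2
    simp only [Set.indicator_apply, h1, h2, Pi.one_apply]
  · rw [medialPerm_of_notMem h] at h1
    rw [medialPerm_flip_of_notMem h] at h2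
    simp only [Set.indicator_apply, h1, h2, Pi.one_apply, sub_self]

/-- The height function of a union of interfaces. -/
theorem exists_height {O : Set (Sym2 Site)} {T : Set MedialEdge}
    (hT : ∀ e, medialPerm O e ∈ T ↔ e ∈ T) : ∃ (Jb : Site → ℤ) (Jw : Face → ℤ),
      ∀ x d, Jb x - Jw (faceAt x d) = T.indicator (1 : MedialEdge → ℤ) (x, d) :=
  exists_potential _ (indicator_closed hT)

end FKIsing

namespace FKIsing

open Equiv Equiv.Perm Function

/-! ### Phases of the turns of an interface -/

/-- The phase of a left turn. -/
noncomputable def leftPhase : ℂ := Complex.exp (-(Real.pi / 4) * Complex.I)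

theorem leftPhase_sq : leftPhase ^ 2 = -Complex.I := by
  rw [leftPhase, ← Complex.exp_nat_mul,
    show ((2 : ℕ) : ℂ) * (-(Real.pi / 4) * Complex.I) = -(Real.pi / 2 * Complex.I) by
      push_cast; ring, Complex.exp_neg, Complex.exp_pi_div_two_mul_I, Complex.inv_I]

theorem leftPhase_pow_four : leftPhase ^ 4 = -1 := by
  rw [show 4 = 2 * 2 from rfl, pow_mul, leftPhase_sq, neg_sq, Complex.I_sq]

theorem leftPhase_ne_zero : leftPhase ≠ 0 := Complex.exp_ne_zero _

theorem inv_leftPhase_sq : leftPhase⁻¹ ^ 2 = Complex.I := by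
  rw [inv_pow, leftPhase_sq, inv_neg, Complex.inv_I, neg_neg]

open Classical in
/-- The phase of the turn that the interface makes at the end of the medial edge `e`. -/
noncomputable def turn (O : Set (Sym2 Site)) (e : MedialEdge) : ℂ :=
  if edgeAt e.1 (e.2 + 1) ∈ O then leftPhase⁻¹ else leftPhase

theorem turn_of_mem {O : Set (Sym2 Site)} {x : Site} {d : Fin 4} (h : edgeAt x d ∈ O) :
    turn O (x, d - 1) = leftPhase⁻¹ := by
  simp [turn, h]

theorem turn_of_notMem {O : Set (Sym2 Site)} {x : Site} {d : Fin 4} (h : edgeAt x d ∉ O) :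
    turn O (x, d - 1) = leftPhase := by
  simp [turn, h]

theorem turn_flip_of_mem {O : Set (Sym2 Site)} {x : Site} {d : Fin 4} (h : edgeAt x d ∈ O) :
    turn O (x + dir d, d + 1) = leftPhase⁻¹ := by
  rw [← edgeAt_flip] at h
  simp [turn, add_assoc, h]

theorem turn_flip_of_notMem {O : Set (Sym2 Site)} {x : Site} {d : Fin 4} (h : edgeAt x d ∉ O) :
    turn O (x + dir d, d + 1) = leftPhase := by
  rw [← edgeAt_flip] at h
  simp [turn, add_assoc, h]

theorem edgeAt_end_eq_iff {e : MedialEdge} {x : Site} {d : Fin 4} :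
    edgeAt e.1 (e.2 + 1) = edgeAt x d ↔ e = (x, d - 1) ∨ e = (x + dir d, d + 1) := by
  obtain ⟨y, c⟩ := e
  rw [edgeAt_eq_iff]
  simp only [Prod.mk.injEq]
  refine or_congr (and_congr_right fun _ => ?_) (and_congr_right fun _ => ?_) <;> grind

theorem in_edges_ne (x : Site) (d : Fin 4) : ((x, d - 1) : MedialEdge) ≠ (x + dir d, d + 1) := by
  simp [Prod.ext_iff]
  grind

theorem medialPerm_congr {O O' : Set (Sym2 Site)} {e : MedialEdge}
    (h : edgeAt e.1 (e.2 + 1) ∈ O ↔ edgeAt e.1 (e.2 + 1) ∈ O') :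
    medialPerm O e = medialPerm O' e := by
  simp only [medialPerm, coe_fn_mk]
  by_cases h' : edgeAt e.1 (e.2 + 1) ∈ O
  · rw [if_pos h', if_pos (h.1 h')]
  · rw [if_neg h', if_neg (mt h.2 h')]

theorem turn_congr {O O' : Set (Sym2 Site)} {e : MedialEdge}
    (h : edgeAt e.1 (e.2 + 1) ∈ O ↔ edgeAt e.1 (e.2 + 1) ∈ O') : turn O e = turn O' e := by
  rw [turn, turn]
  by_cases h' : edgeAt e.1 (e.2 + 1) ∈ O
  · rw [if_pos h', if_pos (h.1 h')]
  · rw [if_neg h', if_neg (mt h.2 h')]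

theorem mem_insert_edge_iff {O : Set (Sym2 Site)} {x : Site} {d : Fin 4} {e : MedialEdge}
    (h₁ : e ≠ (x, d - 1)) (h₂ : e ≠ (x + dir d, d + 1)) :
    edgeAt e.1 (e.2 + 1) ∈ insert (edgeAt x d) O ↔ edgeAt e.1 (e.2 + 1) ∈ O := by
  rw [Set.mem_insert_iff, edgeAt_end_eq_iff]
  tauto

/-- Opening an edge only exchanges the successors of the two medial edges that arrive at it; the
transposition is what flips the sign of the permutation. -/
theorem medialPerm_insert {O : Set (Sym2 Site)} {x : Site} {d : Fin 4} (h : edgeAt x d ∉ O) :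
    medialPerm (insert (edgeAt x d) O) =
      medialPerm O * swap (x, d - 1) (x + dir d, d + 1) := by
  have h' := Set.mem_insert (edgeAt x d) O
  ext1 e
  rw [Perm.mul_apply]
  by_cases h₁ : e = (x, d - 1)
  · rw [h₁, swap_apply_left, medialPerm_of_mem h', medialPerm_flip_of_notMem h]
  by_cases h₂ : e = (x + dir d, d + 1)
  · rw [h₂, swap_apply_right, medialPerm_flip_of_mem h', medialPerm_of_notMem h]
  rw [swap_apply_of_ne_of_ne h₁ h₂, medialPerm_congr (mem_insert_edge_iff h₁ h₂)]

/-- Two left turns become right turns, each gaining the factor `leftPhase⁻¹ ^ 2`, that is, i. -/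
theorem turn_insert {O : Set (Sym2 Site)} {x : Site} {d : Fin 4} (h : edgeAt x d ∉ O)
    (e : MedialEdge) : turn (insert (edgeAt x d) O) e =
      turn O e * (if e = (x, d - 1) then leftPhase⁻¹ ^ 2 else 1) *
        (if e = (x + dir d, d + 1) then leftPhase⁻¹ ^ 2 else 1) := by
  have h' := Set.mem_insert (edgeAt x d) O
  have h0 := leftPhase_ne_zero
  by_cases h₁ : e = (x, d - 1)
  · rw [if_pos h₁, if_neg (h₁ ▸ in_edges_ne x d), h₁, turn_of_mem h', turn_of_notMem h]
    field_simp
  by_cases h₂ : e = (x + dir d, d + 1)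
  · rw [if_neg h₁, if_pos h₂, h₂, turn_flip_of_mem h', turn_flip_of_notMem h]
    field_simp
  rw [if_neg h₁, if_neg h₂, turn_congr (mem_insert_edge_iff h₁ h₂), mul_one, mul_one]

/-! ### Loops around a single black or white face -/

/-- The interface circles an isolated site by four left turns, and the fourth power of the left
phase is -1. -/
theorem fourLoop_closed {O : Set (Sym2 Site)} {x : Site} (h : ∀ d, edgeAt x d ∉ O) (c : Fin 4) :
    minimalPeriod (medialPerm O) (x, c) = 4 ∧
      ∏ j ∈ Finset.range 4, turn O ((medialPerm O)^[j] (x, c)) = -1 := by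
  have step : ∀ c, medialPerm O (x, c) = (x, c + 1) := fun c => by
    simpa using medialPerm_of_notMem (h (c + 1))
  have ht : ∀ c, turn O (x, c) = leftPhase := fun c => by
    simpa using turn_of_notMem (h (c + 1))
  constructor
  · refine minimalPeriod_eq_four ?_ ?_ <;>
      simp [step, Prod.ext_iff, add_assoc]
  · simp only [Finset.prod_range_succ, Finset.prod_range_zero, iterate_succ_apply', step, ht,
      iterate_zero, id]
    rw [← leftPhase_pow_four]
    ring

/-- The dual case: four right turns around an isolated white face. -/
theorem fourLoop_open {O : Set (Sym2 Site)} {f : Face} (h : ∀ d, edgeAt (corner f d) d ∈ O)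
    (c : Fin 4) : minimalPeriod (medialPerm O) (corner f c, c) = 4 ∧
      ∏ j ∈ Finset.range 4, turn O ((medialPerm O)^[j] (corner f c, c)) = -1 := by
  have step : ∀ c, medialPerm O (corner f c, c) = (corner f (c - 1), c - 1) := fun c => by
    simpa [corner_add_dir] using medialPerm_flip_of_mem (h (c - 1))
  have ht : ∀ c, turn O (corner f c, c) = leftPhase⁻¹ := fun c => by
    simpa [corner_add_dir] using turn_flip_of_mem (h (c - 1))
  constructor
  · refine minimalPeriod_eq_four ?_ ?_
    · simp only [iterate_succ_apply', step, iterate_zero, id]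
      rw [show c - 1 - 1 - 1 - 1 = c by grind]
    · simp only [iterate_succ_apply', step, iterate_zero, id]
      intro h
      have := congrArg Prod.snd h
      simp only at this
      grind
  · simp only [Finset.prod_range_succ, Finset.prod_range_zero, iterate_succ_apply', step, ht,
      iterate_zero, id]
    have := leftPhase_pow_four
    rw [show (-1 : ℂ) = (-1)⁻¹ by norm_num, ← leftPhase_pow_four]
    ring

/-! ### Toggling edges -/

/-- The set `S` of medial edges is a union of interfaces, and the product over these interfaces of
minus their total phases is `1` (for interfaces of even length). -/
def Balanced (S : Finset MedialEdge) (O : Set (Sym2 Site)) : Prop :=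
  ∃ h : ∀ e, medialPerm O e ∈ S ↔ e ∈ S,
    ((sign ((medialPerm O).subtypePerm h) : ℤ) : ℂ) * ∏ e : S, turn O e = 1

/-- The transposition changes the sign by -1 and the two altered turns change the product by i · i =
-1, so the two effects cancel. Both arriving medial edges must lie in `S` for the transposition to
preserve it. -/
theorem balanced_insert_iff {S : Finset MedialEdge} {O : Set (Sym2 Site)} {x : Site} {d : Fin 4}
    (h : edgeAt x d ∉ O) (hA : ((x, d - 1) : MedialEdge) ∈ S)
    (hC : ((x + dir d, d + 1) : MedialEdge) ∈ S) :
    Balanced S (insert (edgeAt x d) O) ↔ Balanced S O := by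
  have hsw : ∀ e, swap ((x, d - 1) : MedialEdge) (x + dir d, d + 1) e ∈ S ↔ e ∈ S := by
    intro e
    rw [swap_apply_def]
    split_ifs with h₁ h₂
    · simp only [h₁, hA, hC]
    · simp only [h₂, hA, hC]
    · rfl
  have hmul := medialPerm_insert h
  have hprod : ∏ e : S, turn (insert (edgeAt x d) O) e = -∏ e : S, turn O e := by
    simp only [turn_insert h, Finset.prod_mul_distrib]
    have : ∀ a ∈ S, ∏ e : S, (if (e : MedialEdge) = a then leftPhase⁻¹ ^ 2 else 1) =
        leftPhase⁻¹ ^ 2 := fun a ha => by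
      rw [Finset.prod_eq_single ⟨a, ha⟩]
      · simp
      · intro b _ hb
        rw [if_neg]
        exact fun h => hb (Subtype.ext h)
      · simp
    rw [this _ hA, this _ hC, inv_leftPhase_sq, mul_assoc, Complex.I_mul_I, mul_neg_one]
  have hsub : (swap ((x, d - 1) : MedialEdge) (x + dir d, d + 1)).subtypePerm hsw =
      swap (⟨_, hA⟩ : {e // e ∈ S}) ⟨_, hC⟩ := by
    ext1 e
    apply Subtype.ext
    simp only [subtypePerm_apply, swap_apply_def, Subtype.ext_iff]
    split_ifs <;> rfl
  have hsign : ∀ h' h'', sign ((medialPerm (insert (edgeAt x d) O)).subtypePerm (p := (· ∈ S)) h') =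
      -sign ((medialPerm O).subtypePerm (p := (· ∈ S)) h'') := by
    intro h' h''
    have : (medialPerm (insert (edgeAt x d) O)).subtypePerm h' =
        (medialPerm O).subtypePerm (p := (· ∈ S)) h'' * subtypePerm _ hsw := by
      rw [subtypePerm_mul]
      congr 1
    rw [this, Perm.sign_mul, hsub, sign_swap]
    · simp
    · simpa [Subtype.ext_iff] using in_edges_ne x d
  constructor
  · rintro ⟨h', e'⟩
    have h'' : ∀ e, medialPerm O e ∈ S ↔ e ∈ S := by
      intro e
      have := h' (swap (x, d - 1) (x + dir d, d + 1) e)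
      rw [hmul, Perm.mul_apply, swap_apply_self] at this
      rw [this, hsw]
    refine ⟨h'', ?_⟩
    rw [← e', hsign h' h'', hprod]
    push_cast
    ring
  · rintro ⟨h'', e'⟩
    have h' : ∀ e, medialPerm (insert (edgeAt x d) O) e ∈ S ↔ e ∈ S := by
      intro e
      rw [hmul, Perm.mul_apply, h'', hsw]
    refine ⟨h', ?_⟩
    rw [← e', hsign h' h'', hprod]
    push_cast
    ring

/-- The invariance under one toggle is iterated over the finite set where `O` and `R` may differ. -/
theorem Balanced.of_agree {S : Finset MedialEdge} {R : Set (Sym2 Site)} (hR : Balanced S R)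
    (T : Finset (Sym2 Site)) (hT : ∀ v ∈ T, ∃ x d, v = edgeAt x d ∧
      ((x, d - 1) : MedialEdge) ∈ S ∧ ((x + dir d, d + 1) : MedialEdge) ∈ S)
    (O : Set (Sym2 Site)) (hO : ∀ v, v ∉ T → (v ∈ O ↔ v ∈ R)) : Balanced S O := by
  classical
  induction T using Finset.induction_on generalizing O with
  | empty =>
    obtain rfl : O = R := Set.ext fun v => hO v (Finset.notMem_empty v)
    exact hR
  | insert v T hv ih =>
    obtain ⟨x, d, hvd, hA, hC⟩ := hT v (Finset.mem_insert_self _ _)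
    have key : Balanced S (O \ {v}) ↔ Balanced S (insert v O) := by
      rw [← Set.insert_sdiff_singleton, hvd]
      exact (balanced_insert_iff (by simp) hA hC).symm
    have hins : Balanced S (insert v O) ↔ Balanced S O := by
      by_cases hvO : v ∈ O
      · rw [Set.insert_eq_of_mem hvO]
      · rw [← key, Set.sdiff_singleton_eq_self hvO]
    have ih' := ih fun u hu => hT u (Finset.mem_insert_of_mem hu)
    -- First `O` is corrected at `v` to agree with `R`, by insertion or deletion; the corrected set
    -- may differ from `R` only on the smaller `T`.
    by_cases hvR : v ∈ R
    · refine hins.1 (ih' _ fun u hu => ?_)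
      by_cases huv : u = v
      · simp [huv, hvR]
      · rw [← hO u (by simp [huv, hu])]; simp [huv]
    · refine hins.1 (key.1 (ih' _ fun u hu => ?_))
      by_cases huv : u = v
      · simp [huv, hvR]
      · rw [← hO u (by simp [huv, hu])]; simp [huv]

theorem coe_subtypePerm_iterate {Y : Type*} {p : Y → Prop} (σ : Perm Y) (h : ∀ x, p (σ x) ↔ p x)
    (n : ℕ) (x : {y // p y}) : (((σ.subtypePerm h)^[n] x : {y // p y}) : Y) = σ^[n] x := by
  induction n with
  | zero => rfl
  | succ n ih => rw [iterate_succ_apply', iterate_succ_apply', subtypePerm_apply, ← ih]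

theorem minimalPeriod_subtypePerm {Y : Type*} {p : Y → Prop} (σ : Perm Y)
    (h : ∀ x, p (σ x) ↔ p x) (x : {y // p y}) :
    minimalPeriod (σ.subtypePerm h) x = minimalPeriod σ (x : Y) := by
  rw [minimalPeriod_eq_minimalPeriod_iff]
  intro n
  rw [IsPeriodicPt, IsFixedPt, IsPeriodicPt, IsFixedPt, ← coe_subtypePerm_iterate σ h,
    Subtype.ext_iff]

/-- The phase of an interface can be read off from a union of interfaces in which all others are
loops around single faces. -/
theorem sign_mul_prod_turn {S : Finset MedialEdge} {O : Set (Sym2 Site)} {e₀ : MedialEdge}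
    (he₀ : e₀ ∈ S) (hS : ∀ e, medialPerm O e ∈ S ↔ e ∈ S)
    (h : ∀ e ∈ S, (∃ j, (medialPerm O)^[j] e₀ = e) ∨ minimalPeriod (medialPerm O) e = 4 ∧
      ∏ j ∈ Finset.range 4, turn O ((medialPerm O)^[j] e) = -1) :
    ((sign ((medialPerm O).subtypePerm hS) : ℤ) : ℂ) * ∏ e : S, turn O e =
      -(-1) ^ minimalPeriod (medialPerm O) e₀ *
        ∏ j ∈ Finset.range (minimalPeriod (medialPerm O) e₀),
          turn O ((medialPerm O)^[j] e₀) := by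
  have := sign_mul_prod_of_fourCycles ((medialPerm O).subtypePerm hS)
    (fun e : {e // e ∈ S} => turn O e) ⟨e₀, he₀⟩
    (fun e he => medialPerm_ne O e (by simpa [Subtype.ext_iff] using he)) (fun e => by
      simp only [minimalPeriod_subtypePerm, coe_subtypePerm_iterate]
      refine (h e e.2).imp_left ?_
      rintro ⟨j, hj⟩
      refine ⟨j, ?_⟩
      rw [zpow_natCast, Perm.coe_pow]
      exact Subtype.ext (by rw [coe_subtypePerm_iterate, hj]))
  simp only [minimalPeriod_subtypePerm, coe_subtypePerm_iterate] at this
  exact this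

end FKIsing

namespace FKIsing

open Equiv Equiv.Perm Function

/-! ### The phase of an interface -/

/-- The medial edges of the interface through `e₀`, from `e₀` on. -/
def orbit (O : Set (Sym2 Site)) (e₀ : MedialEdge) : Set MedialEdge :=
  {e | ∃ j, (medialPerm O)^[j] e₀ = e}

theorem self_mem_orbit (O : Set (Sym2 Site)) (e₀ : MedialEdge) : e₀ ∈ orbit O e₀ := ⟨0, rfl⟩

theorem medialPerm_mem_orbit_iff {O : Set (Sym2 Site)} {e₀ : MedialEdge}
    (h : e₀ ∈ periodicPts (medialPerm O)) (e : MedialEdge) :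
    medialPerm O e ∈ orbit O e₀ ↔ e ∈ orbit O e₀ := by
  constructor
  · rintro ⟨j, hj⟩
    obtain ⟨n, hn, hp⟩ := h
    refine ⟨j + n - 1, (medialPerm O).injective ?_⟩
    rw [← iterate_succ_apply' (medialPerm O), ← hj, show (j + n - 1).succ = j + n by omega,
      iterate_add_apply, hp.eq]
  · rintro ⟨j, hj⟩
    exact ⟨j + 1, by rw [iterate_succ_apply', hj]⟩

theorem orbit_eq_image {O : Set (Sym2 Site)} {e₀ : MedialEdge}
    (h : e₀ ∈ periodicPts (medialPerm O)) :
    orbit O e₀ = (fun j => (medialPerm O)^[j] e₀) '' Set.Iio (minimalPeriod (medialPerm O) e₀) := by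
  ext e
  constructor
  · rintro ⟨j, rfl⟩
    exact ⟨j % _, Nat.mod_lt _ (minimalPeriod_pos_of_mem_periodicPts h),
      iterate_mod_minimalPeriod_eq⟩
  · rintro ⟨j, -, rfl⟩
    exact ⟨j, rfl⟩

theorem orbit_finite {O : Set (Sym2 Site)} {e₀ : MedialEdge}
    (h : e₀ ∈ periodicPts (medialPerm O)) : (orbit O e₀).Finite := by
  rw [orbit_eq_image h]
  exact (Set.finite_Iio _).image _

/-- Each turn changes the direction by one modulo four, so its parity alternates along the
interface. -/
theorem even_minimalPeriod (O : Set (Sym2 Site)) (e₀ : MedialEdge) :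
    (-1 : ℂ) ^ minimalPeriod (medialPerm O) e₀ = 1 := by
  have step : ∀ e, (-1 : ℂ) ^ (medialPerm O e).2.val = -(-1) ^ e.2.val := by
    rintro ⟨x, c⟩
    simp only [medialPerm, coe_fn_mk]
    split_ifs <;> fin_cases c <;> norm_num [Fin.val_sub, Fin.val_add]
  have key : ∀ n, (-1 : ℂ) ^ ((medialPerm O)^[n] e₀).2.val = (-1) ^ n * (-1) ^ e₀.2.val := by
    intro n
    induction n with
    | zero => simp
    | succ n ih => rw [iterate_succ_apply', step, ih]; ring
  have := key (minimalPeriod (medialPerm O) e₀)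
  rw [iterate_minimalPeriod] at this
  exact mul_right_cancel₀ (pow_ne_zero _ (by norm_num)) (((one_mul _).trans this).symm)

/-! ### Height functions of unions of interfaces -/

section Height

variable {O : Set (Sym2 Site)} {T : Set MedialEdge} {Jb : Site → ℤ} {Jw : Face → ℤ}

/-- The height function of a union of interfaces is constant on clusters. -/
theorem height_eq_of_open (hT : ∀ e, medialPerm O e ∈ T ↔ e ∈ T)
    (hJ : ∀ x d, Jb x - Jw (faceAt x d) = T.indicator (1 : MedialEdge → ℤ) (x, d))
    {x : Site} {d : Fin 4} (h : edgeAt x d ∈ O) : Jb x = Jb (x + dir d) := by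
  classical
  have h1 := hJ x d
  have h2 := hJ (x + dir d) (d + 1)
  have h3 := hT (x + dir d, d + 1)
  rw [medialPerm_flip_of_mem h] at h3
  rw [faceAt_left] at h2
  simp only [Set.indicator_apply, h3] at h1 h2
  simp only [Pi.one_apply] at h1 h2
  linarith

theorem height_eq_of_notMem
    (hJ : ∀ x d, Jb x - Jw (faceAt x d) = T.indicator (1 : MedialEdge → ℤ) (x, d))
    {x : Site} {d : Fin 4} (h : (x, d) ∉ T) (h' : (x + dir d, d + 1) ∉ T) :
    Jb x = Jb (x + dir d) := by
  have h1 := hJ x d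
  have h2 := hJ (x + dir d) (d + 1)
  rw [faceAt_left, Set.indicator_of_notMem h'] at h2
  rw [Set.indicator_of_notMem h] at h1
  linarith

theorem height_white (hJ : ∀ x d, Jb x - Jw (faceAt x d) = T.indicator (1 : MedialEdge → ℤ) (x, d))
    {e : MedialEdge} (h : e ∈ T) : Jw (faceAt e.1 e.2) = Jb e.1 - 1 := by
  have h1 := hJ e.1 e.2
  rw [Set.indicator_of_mem h] at h1
  simp only [Pi.one_apply] at h1
  linarith

theorem height_white_of_notMem
    (hJ : ∀ x d, Jb x - Jw (faceAt x d) = T.indicator (1 : MedialEdge → ℤ) (x, d))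
    {e : MedialEdge} (h : e ∉ T) : Jw (faceAt e.1 e.2) = Jb e.1 := by
  have h1 := hJ e.1 e.2
  rw [Set.indicator_of_notMem h] at h1
  linarith

/-- A left turn keeps the black face, and a right turn moves across an open edge, along which the
height is constant. -/
theorem height_eq_of_mem_orbit {e₀ : MedialEdge} (h₀ : e₀ ∈ periodicPts (medialPerm O))
    (hJ : ∀ x d, Jb x - Jw (faceAt x d) =
      (orbit O e₀).indicator (1 : MedialEdge → ℤ) (x, d)) {e : MedialEdge}
    (he : e ∈ orbit O e₀) : Jb e.1 = Jb e₀.1 := by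
  obtain ⟨j, rfl⟩ := he
  induction j with
  | zero => rfl
  | succ j ih =>
    rw [iterate_succ_apply', ← ih]
    set e := (medialPerm O)^[j] e₀
    by_cases h : edgeAt e.1 (e.2 + 1) ∈ O
    · rw [height_eq_of_open (medialPerm_mem_orbit_iff h₀) hJ h]
      simp [medialPerm, h]
    · simp [medialPerm, h]

theorem int_const_of_step {f : ℤ → ℤ} (h : ∀ n, f n = f (n + 1)) (m n : ℤ) : f m = f n := by
  have : ∀ n, f n = f 0 := by
    intro n
    induction n using Int.induction_on with
    | zero => rfl
    | succ n ih => rw [← h, ih]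
    | pred n ih => rw [h, sub_add_cancel, ih]
  rw [this, this n]

/-- A height function is constant away from a finite set of sites. -/
theorem exists_height_at_infinity (hfin : T.Finite)
    (hJ : ∀ x d, Jb x - Jw (faceAt x d) = T.indicator (1 : MedialEdge → ℤ) (x, d)) :
    ∃ J : ℤ, {x | Jb x ≠ J}.Finite := by
  obtain ⟨M, hM⟩ : ∃ M : ℤ, ∀ e ∈ T, |e.1.1| < M ∧ |e.1.2| < M := by
    obtain ⟨M, hM⟩ := (hfin.image fun e : MedialEdge => max |e.1.1| |e.1.2|).bddAbove
    refine ⟨M + 1, fun e he => ?_⟩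
    have := hM (Set.mem_image_of_mem _ he)
    simp only [sup_le_iff] at this
    omega
  have step : ∀ x d, (∀ c, (x, c) ∉ T) → (∀ c, (x + dir d, c) ∉ T) → Jb x = Jb (x + dir d) :=
    fun x d h h' => height_eq_of_notMem hJ (h _) (h' _)
  have out : ∀ x : Site, M ≤ |x.1| ∨ M ≤ |x.2| → ∀ c, (x, c) ∉ T := by
    intro x hx c hc
    have := hM _ hc
    simp only at this
    omega
  have col : ∀ i : ℤ, M ≤ |i| → ∀ j k, Jb (i, j) = Jb (i, k) := fun i hi j k =>
    int_const_of_step (f := fun j => Jb (i, j)) (fun n => by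
      simpa [dir] using step (i, n) 1 (out _ (.inl hi))
        (out _ (.inl (by simpa [dir] using hi)))) j k
  have row : ∀ i : ℤ, M ≤ |i| → ∀ j k, Jb (j, i) = Jb (k, i) := fun i hi j k =>
    int_const_of_step (f := fun j => Jb (j, i)) (fun n => by
      simpa [dir] using step (n, i) 0 (out _ (.inr hi))
        (out _ (.inr (by simpa [dir] using hi)))) j k
  -- Outside the square every site lies on a row or a column that avoids `T`; these all meet the
  -- column or the row through `(M, M)`.
  refine ⟨Jb (M, M), (Set.finite_Icc ((-M, -M) : Site) (M, M)).subset ?_⟩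
  intro x hx
  by_contra hnot
  refine hx ?_
  have hMM : M ≤ |M| := le_abs_self M
  have : M ≤ |x.1| ∨ M ≤ |x.2| := by
    by_contra! h
    obtain ⟨h1, h2⟩ := h
    rw [abs_lt] at h1 h2
    exact hnot ⟨⟨h1.1.le, h2.1.le⟩, ⟨h1.2.le, h2.2.le⟩⟩
  obtain ⟨i, j⟩ := x
  rcases this with h | h
  · rw [col i h j M, row M hMM i M]
  · rw [row j h i M, col M hMM j M]

end Height

/-- The phases of the turns of a closed interface multiply to `-1`: its total winding is `2π`
modulo `4π`. -/
theorem prod_turn_orbit (O : Set (Sym2 Site)) (e₀ : MedialEdge)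
    (h₀ : e₀ ∈ periodicPts (medialPerm O)) :
    ∏ j ∈ Finset.range (minimalPeriod (medialPerm O) e₀), turn O ((medialPerm O)^[j] e₀) = -1 := by
  classical
  set c := orbit O e₀ with hc
  have hinv : ∀ e, medialPerm O e ∈ c ↔ e ∈ c := medialPerm_mem_orbit_iff h₀
  obtain ⟨Jb, Jw, hJ⟩ := exists_height hinv
  have hb : ∀ {e}, e ∈ c → Jb e.1 = Jb e₀.1 := fun he => height_eq_of_mem_orbit h₀ hJ he
  obtain ⟨J, hJfin⟩ := exists_height_at_infinity (orbit_finite h₀) hJ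
  set m := Jb e₀.1 with hm
  let touched : Site → Fin 4 → Prop := fun x d => (x, d - 1) ∈ c ∨ (x + dir d, d + 1) ∈ c
  have touched_flip : ∀ x d, touched (x + dir d) (d + 2) ↔ touched x d := by
    intro x d
    simp only [touched, add_dir_add_dir, show d + 2 - 1 = d + 1 by grind,
      show d + 2 + 1 = d - 1 by grind]
    exact or_comm
  have untouched : ∀ x d, ¬touched x d → (x, d) ∉ c ∧ (x + dir d, d + 2) ∉ c := by
    intro x d h
    obtain ⟨hA, hC⟩ := not_or.1 h
    rw [← hinv] at hA hC
    by_cases hv : edgeAt x d ∈ O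
    · rw [medialPerm_of_mem hv] at hA
      rw [medialPerm_flip_of_mem hv] at hC
      exact ⟨hC, hA⟩
    · rw [medialPerm_of_notMem hv] at hA
      rw [medialPerm_flip_of_notMem hv] at hC
      exact ⟨hA, hC⟩
  have untouched_height : ∀ x d, ¬touched x d → Jb x = Jb (x + dir d) := fun x d h =>
    height_eq_of_notMem hJ (untouched x d h).1 fun h' => h (.inr h')
  -- `O'` keeps the state of every edge at which `c` turns and opens another lattice edge exactly
  -- when its ends have the height `m` of the black side of `c`. Thus `c` remains an interface, and
  -- all others shrink to loops around single faces.
  let O' : Set (Sym2 Site) := {v | ∃ x d, v = edgeAt x d ∧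
    (touched x d ∧ v ∈ O ∨ ¬touched x d ∧ Jb x = m)}
  have mem_O' : ∀ x d, edgeAt x d ∈ O' ↔
      (touched x d ∧ edgeAt x d ∈ O ∨ ¬touched x d ∧ Jb x = m) := by
    intro x d
    refine ⟨?_, fun h => ⟨x, d, rfl, h⟩⟩
    rintro ⟨x', d', hv, h⟩
    rcases edgeAt_eq_iff.1 hv.symm with ⟨rfl, rfl⟩ | ⟨rfl, rfl⟩
    · exact h
    · rw [touched_flip] at h
      refine h.imp_right fun h' => ⟨h'.1, ?_⟩
      rw [untouched_height x d h'.1, h'.2]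
  have agree : ∀ e ∈ c, (edgeAt e.1 (e.2 + 1) ∈ O' ↔ edgeAt e.1 (e.2 + 1) ∈ O) := by
    intro e he
    have : touched e.1 (e.2 + 1) := .inl (by simpa using he)
    rw [mem_O']
    tauto
  have iter : ∀ j, (medialPerm O')^[j] e₀ = (medialPerm O)^[j] e₀ := by
    intro j
    induction j with
    | zero => rfl
    | succ j ih =>
      rw [iterate_succ_apply', iterate_succ_apply', ih]
      exact medialPerm_congr (agree _ ⟨j, rfl⟩)
  have loops : ∀ e, e ∉ c → minimalPeriod (medialPerm O') e = 4 ∧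
      ∏ j ∈ Finset.range 4, turn O' ((medialPerm O')^[j] e) = -1 := by
    rintro ⟨x, b⟩ he
    have hw := height_white_of_notMem hJ he
    simp only at hw
    -- At height `m` the white face next to `(x, b)` has height `m` too, hence does not border `c`
    -- and is surrounded by open edges. At any other height `x` does not border `c` and is isolated.
    by_cases hx : Jb x = m
    · rw [← corner_faceAt x b]
      refine fourLoop_open (fun d => ?_) b
      have key : ∀ d, (corner (faceAt x b) d, d) ∉ c := by
        intro d hd
        have h1 := height_white hJ hd
        have h2 := hb hd
        simp only [faceAt_corner] at h1 h2
        omega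
      rw [mem_O']
      set y := corner (faceAt x b) d with hy
      by_cases ht : touched y d
      · refine .inl ⟨ht, ?_⟩
        have hC : (y + dir d, d + 1) ∉ c := by rw [hy, corner_add_dir]; exact key _
        by_contra hv
        have hA := ht.resolve_right hC
        rw [← hinv, medialPerm_of_notMem hv] at hA
        exact key d hA
      · refine .inr ⟨ht, ?_⟩
        have h1 : Jw (faceAt x b) = Jb y := by
          simpa only [faceAt_corner] using height_white_of_notMem hJ (key d)
        omega
    · refine fourLoop_closed (fun d => ?_) b
      have key : ∀ d, (x, d) ∉ c := fun d hd => hx (hb hd)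
      rw [mem_O']
      rintro (⟨ht, hv⟩ | ⟨-, hx'⟩)
      · have hC := ht.resolve_left (key _)
        rw [← hinv, medialPerm_flip_of_mem hv] at hC
        exact key d hC
      · exact hx hx'
  -- The reference configuration continues the behaviour of `O'` at infinity: all lattice edges are
  -- open if the height there is `m`, and none otherwise.
  let R : Set (Sym2 Site) := {v | (∃ x d, v = edgeAt x d) ∧ J = m}
  have hRloops : ∀ e, minimalPeriod (medialPerm R) e = 4 ∧
      ∏ j ∈ Finset.range 4, turn R ((medialPerm R)^[j] e) = -1 := by
    rintro ⟨x, b⟩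
    by_cases hJm : J = m
    · rw [← corner_faceAt x b]
      exact fourLoop_open (O := R) (fun d => ⟨⟨corner (faceAt x b) d, d, rfl⟩, hJm⟩) b
    · exact fourLoop_closed (O := R) (fun d h => hJm h.2) b
  let V : Set Site := (Prod.fst '' c) ∪ {x | Jb x ≠ J}
  have hV : V.Finite := ((orbit_finite h₀).image _).union hJfin
  let T : Set (Sym2 Site) := (fun e : MedialEdge => edgeAt e.1 e.2) '' (V ×ˢ Set.univ)
  have hTfin : T.Finite := (hV.prod Set.finite_univ).image _
  have hT : ∀ v, v ∉ T → (v ∈ O' ↔ v ∈ R) := by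
    intro v hv
    by_cases hl : ∃ x d, v = edgeAt x d
    · obtain ⟨x, d, rfl⟩ := hl
      have hx : x ∉ V := fun h => hv ⟨(x, d), ⟨h, trivial⟩, rfl⟩
      have hy : x + dir d ∉ V := fun h => hv ⟨(x + dir d, d + 2), ⟨h, trivial⟩, edgeAt_flip x d⟩
      have ht : ¬touched x d := by
        rintro (h | h)
        · exact hx (.inl ⟨_, h, rfl⟩)
        · exact hy (.inl ⟨_, h, rfl⟩)
      have hJx : Jb x = J := by
        by_contra h
        exact hx (.inr h)
      rw [mem_O', hJx]
      have : (∃ x' d', edgeAt x d = edgeAt x' d') := ⟨x, d, rfl⟩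
      simp only [R, Set.mem_ofPred_eq]
      tauto
    · refine iff_of_false ?_ fun h => hl h.1
      rintro ⟨x, d, rfl, -⟩
      exact hl ⟨x, d, rfl⟩
  -- `E` contains all medial edges that end at an edge where `O'` and `R` may differ. Its saturation
  -- `S` under the four-loops of `R` is finite and can be followed through all toggles.
  let E : Set MedialEdge := {e | edgeAt e.1 (e.2 + 1) ∈ T} ∪ c
  have hE : E.Finite := by
    refine Set.Finite.union ?_ (orbit_finite h₀)
    refine Set.Finite.subset ((hV.prod (Set.finite_univ (α := Fin 4))).image
      (fun e : MedialEdge => ((e.1, e.2 - 1) : MedialEdge)) |>.union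
      ((hV.prod (Set.finite_univ (α := Fin 4))).image
      (fun e : MedialEdge => ((e.1 + dir e.2, e.2 + 1) : MedialEdge)))) ?_
    rintro e ⟨⟨x, d⟩, hx, hv⟩
    rcases edgeAt_end_eq_iff.1 hv.symm with h | h
    · exact .inl ⟨(x, d), hx, h.symm⟩
    · exact .inr ⟨(x, d), hx, h.symm⟩
  have hSfin : (⋃ j ∈ Set.Iio 4, (medialPerm R)^[j] '' E).Finite :=
    (Set.finite_Iio 4).biUnion fun j _ => hE.image _
  obtain ⟨S, hS⟩ := hSfin.exists_finset_coe
  have mem_S : ∀ e, e ∈ S ↔ ∃ j < 4, ∃ e' ∈ E, (medialPerm R)^[j] e' = e := by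
    intro e
    rw [← Finset.mem_coe, hS]
    simp
  have hES : ∀ e ∈ E, e ∈ S := fun e he => (mem_S e).2 ⟨0, by norm_num, e, he, rfl⟩
  have hper : ∀ e, (medialPerm R)^[4] e = e := fun e => by
    have := iterate_minimalPeriod (f := medialPerm R) (x := e)
    rwa [(hRloops e).1] at this
  have hSR : ∀ e, medialPerm R e ∈ S ↔ e ∈ S := by
    have h1 : ∀ e, e ∈ S → medialPerm R e ∈ S := by
      intro e he
      obtain ⟨j, hj, e', he', rfl⟩ := (mem_S e).1 he
      rw [← iterate_succ_apply' (medialPerm R)]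
      rcases Nat.lt_or_ge (j + 1) 4 with h | h
      · exact (mem_S _).2 ⟨j + 1, h, e', he', rfl⟩
      · obtain rfl : j = 3 := by omega
        rw [hper]
        exact hES _ he'
    refine fun e => ⟨fun he => ?_, h1 e⟩
    have := h1 _ (h1 _ (h1 _ he))
    rwa [show medialPerm R (medialPerm R (medialPerm R (medialPerm R e))) = e from hper e] at this
  have he₀ : e₀ ∈ S := hES _ (.inr (self_mem_orbit O e₀))
  have hbalR : Balanced S R := by
    refine ⟨hSR, ?_⟩
    rw [sign_mul_prod_turn he₀ hSR fun e _ => .inr (hRloops e), even_minimalPeriod,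
      (hRloops e₀).1, (hRloops e₀).2]
    norm_num
  have hbal : Balanced S O' := by
    refine hbalR.of_agree hTfin.toFinset (fun v hv => ?_) O' (fun v hv => hT v (by simpa using hv))
    rw [Set.Finite.mem_toFinset] at hv
    obtain ⟨⟨x, d⟩, -, rfl⟩ := id hv
    refine ⟨x, d, rfl, hES _ (.inl ?_), hES _ (.inl ?_)⟩
    · rwa [Set.mem_ofPred_eq, edgeAt_end_eq_iff.2 (.inl rfl)]
    · rwa [Set.mem_ofPred_eq, edgeAt_end_eq_iff.2 (.inr rfl)]
  obtain ⟨hSO, hbal⟩ := hbal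
  -- In `O'` every interface in `S` other than `c` contributes 1, so the balance identity becomes
  -- the statement about `c` alone; its even length removes the power of -1.
  rw [sign_mul_prod_turn he₀ hSO, even_minimalPeriod] at hbal
  · have hN : minimalPeriod (medialPerm O') e₀ = minimalPeriod (medialPerm O) e₀ := by
      rw [minimalPeriod_eq_minimalPeriod_iff]
      intro n
      rw [IsPeriodicPt, IsFixedPt, IsPeriodicPt, IsFixedPt, iter]
    rw [hN] at hbal
    rw [← neg_eq_iff_eq_neg, ← hbal, neg_one_mul]
    congr 1
    refine Finset.prod_congr rfl fun j _ => ?_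
    rw [iter, turn_congr (agree _ ⟨j, rfl⟩)]
  · intro e _
    by_cases he : e ∈ c
    · obtain ⟨j, hj⟩ := he
      exact .inl ⟨j, by rw [iter, hj]⟩
    · exact .inr (loops e he)

end FKIsing

namespace FKIsing

open Equiv Equiv.Perm Function

/-! ### The phase at the first visit -/

theorem mem_orbit_iterate_iff {O : Set (Sym2 Site)} {s : MedialEdge}
    (h : s ∈ periodicPts (medialPerm O)) (j : ℕ) (e : MedialEdge) :
    (medialPerm O)^[j] e ∈ orbit O s ↔ e ∈ orbit O s := by
  induction j with
  | zero => rfl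
  | succ j ih => rw [iterate_succ_apply', medialPerm_mem_orbit_iff h, ih]

open Classical in
/-- The phase of the interface that starts at `s` at its first visit of `e`. -/
noncomputable def firstPhase (O : Set (Sym2 Site)) (s e : MedialEdge) : ℂ :=
  if h : ∃ k, (medialPerm O)^[k] s = e then
    ∏ j ∈ Finset.range (Nat.find h), turn O ((medialPerm O)^[j] s)
  else 0

section FirstPhase

variable {O : Set (Sym2 Site)} {s e : MedialEdge}

theorem firstPhase_eq {k : ℕ} (hk : (medialPerm O)^[k] s = e)
    (hmin : ∀ j < k, (medialPerm O)^[j] s ≠ e) :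
    firstPhase O s e = ∏ j ∈ Finset.range k, turn O ((medialPerm O)^[j] s) := by
  classical
  have h : ∃ k, (medialPerm O)^[k] s = e := ⟨k, hk⟩
  have : Nat.find h = k := (Nat.find_eq_iff h).2 ⟨hk, hmin⟩
  rw [firstPhase, dif_pos h, this]

theorem firstPhase_eq_zero (h : e ∉ orbit O s) : firstPhase O s e = 0 := by
  exact dif_neg h

theorem firstPhase_self (O : Set (Sym2 Site)) (s : MedialEdge) : firstPhase O s s = 1 := by
  rw [firstPhase_eq (k := 0) (e := s) rfl (by simp)]
  simp

theorem exists_first (h : e ∈ orbit O s) :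
    ∃ k, (medialPerm O)^[k] s = e ∧ ∀ j < k, (medialPerm O)^[j] s ≠ e := by
  classical
  exact ⟨Nat.find h, Nat.find_spec h, fun j hj => Nat.find_min h hj⟩

theorem first_lt_minimalPeriod (hs : s ∈ periodicPts (medialPerm O)) {k : ℕ}
    (hmin : ∀ j < k, (medialPerm O)^[j] s ≠ (medialPerm O)^[k] s) :
    k < minimalPeriod (medialPerm O) s := by
  by_contra! h
  have hpos := minimalPeriod_pos_of_mem_periodicPts hs
  exact hmin (k % minimalPeriod (medialPerm O) s) ((Nat.mod_lt _ hpos).trans_le h)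
    iterate_mod_minimalPeriod_eq

/-- The successor is first visited one step after `e`, unless it is the starting point, which is
already visited at time 0. -/
theorem firstPhase_step (hs : s ∈ periodicPts (medialPerm O)) (he : medialPerm O e ≠ s) :
    firstPhase O s (medialPerm O e) = firstPhase O s e * turn O e := by
  by_cases h : e ∈ orbit O s
  · obtain ⟨k, rfl, hmin⟩ := exists_first h
    rw [firstPhase_eq rfl hmin, ← Finset.prod_range_succ]
    refine firstPhase_eq (iterate_succ_apply' _ _ _) fun j hj hj' => ?_
    cases j with
    | zero => exact he hj'.symm
    | succ j =>
      rw [iterate_succ_apply'] at hj'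
      exact hmin j (by omega) ((medialPerm O).injective hj')
  · rw [firstPhase_eq_zero h, firstPhase_eq_zero (mt (medialPerm_mem_orbit_iff hs e).1 h), zero_mul]

/-- The last turn closes the loop, whose total phase is -1, whereas the phase recorded at the start
is 1. `startSign` accounts for this discrepancy. -/
theorem firstPhase_step_start (hs : s ∈ periodicPts (medialPerm O)) (he : medialPerm O e = s) :
    firstPhase O s e * turn O e = -1 := by
  have hpos := minimalPeriod_pos_of_mem_periodicPts hs
  obtain ⟨n, hn⟩ : ∃ n, minimalPeriod (medialPerm O) s = n + 1 := ⟨_, (Nat.sub_add_cancel hpos).symm⟩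
  have hne : (medialPerm O)^[n] s = e := by
    apply (medialPerm O).injective
    rw [← iterate_succ_apply' (medialPerm O), he, Nat.succ_eq_add_one, ← hn, iterate_minimalPeriod]
  rw [← prod_turn_orbit O s hs, hn, Finset.prod_range_succ, hne, firstPhase_eq hne]
  intro j hj h
  rw [← hne] at h
  have := iterate_injOn_Iio_minimalPeriod (f := medialPerm O) (x := s)
    (show j ∈ Set.Iio _ by rw [Set.mem_Iio]; omega) (show n ∈ Set.Iio _ by rw [Set.mem_Iio]; omega) h
  omega

end FirstPhase

/-! ### The effect of opening an edge -/

/-- The configuration `O'` arises from `O` by opening an edge at which the medial edges `A` and `C`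
end. -/
structure Opening (O O' : Set (Sym2 Site)) (A C : MedialEdge) : Prop where
  ne : A ≠ C
  perm_left : medialPerm O' A = medialPerm O C
  perm_right : medialPerm O' C = medialPerm O A
  perm_other : ∀ e, e ≠ A → e ≠ C → medialPerm O' e = medialPerm O e
  turn_left : turn O A = leftPhase
  turn_right : turn O C = leftPhase
  turn_left' : turn O' A = leftPhase⁻¹
  turn_right' : turn O' C = leftPhase⁻¹
  turn_other : ∀ e, e ≠ A → e ≠ C → turn O' e = turn O e

theorem opening_insert {O : Set (Sym2 Site)} {x : Site} {d : Fin 4} (h : edgeAt x d ∉ O) :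
    Opening O (insert (edgeAt x d) O) (x, d - 1) (x + dir d, d + 1) where
  ne := in_edges_ne x d
  perm_left := by rw [medialPerm_insert h, Perm.mul_apply, swap_apply_left]
  perm_right := by rw [medialPerm_insert h, Perm.mul_apply, swap_apply_right]
  perm_other e h₁ h₂ := medialPerm_congr (mem_insert_edge_iff h₁ h₂)
  turn_left := turn_of_notMem h
  turn_right := turn_flip_of_notMem h
  turn_left' := turn_of_mem (Set.mem_insert _ _)
  turn_right' := turn_flip_of_mem (Set.mem_insert _ _)
  turn_other e h₁ h₂ := turn_congr (mem_insert_edge_iff h₁ h₂)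

namespace Opening

variable {O O' : Set (Sym2 Site)} {A C s : MedialEdge}

theorem symm (h : Opening O O' A C) : Opening O O' C A where
  ne := h.ne.symm
  perm_left := h.perm_right
  perm_right := h.perm_left
  perm_other e h₁ h₂ := h.perm_other e h₂ h₁
  turn_left := h.turn_right
  turn_right := h.turn_left
  turn_left' := h.turn_right'
  turn_right' := h.turn_left'
  turn_other e h₁ h₂ := h.turn_other e h₂ h₁

theorem iterate_eq (h : Opening O O' A C) {u : MedialEdge} {n : ℕ}
    (hn : ∀ i < n, (medialPerm O)^[i] u ≠ A ∧ (medialPerm O)^[i] u ≠ C) :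
    ∀ i ≤ n, (medialPerm O')^[i] u = (medialPerm O)^[i] u := by
  intro i hi
  induction i with
  | zero => rfl
  | succ i ih =>
    rw [iterate_succ_apply', iterate_succ_apply', ih (by omega),
      h.perm_other _ (hn i hi).1 (hn i hi).2]

theorem prod_eq (h : Opening O O' A C) {u : MedialEdge} {n : ℕ}
    (hn : ∀ i < n, (medialPerm O)^[i] u ≠ A ∧ (medialPerm O)^[i] u ≠ C) :
    ∏ i ∈ Finset.range n, turn O' ((medialPerm O')^[i] u) =
      ∏ i ∈ Finset.range n, turn O ((medialPerm O)^[i] u) := by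
  refine Finset.prod_congr rfl fun i hi => ?_
  have hi := Finset.mem_range.1 hi
  rw [h.iterate_eq hn i hi.le, h.turn_other _ (hn i hi).1 (hn i hi).2]

theorem firstPhase_eq_of_first (h : Opening O O' A C) {k : ℕ} (hk : (medialPerm O)^[k] s = A)
    (hn : ∀ i < k, (medialPerm O)^[i] s ≠ A ∧ (medialPerm O)^[i] s ≠ C) :
    firstPhase O' s A = firstPhase O s A := by
  have hit := h.iterate_eq hn
  rw [firstPhase_eq hk fun i hi => (hn i hi).1, ← h.prod_eq hn]
  exact firstPhase_eq ((hit k le_rfl).trans hk) fun i hi => (hit i hi.le) ▸ (hn i hi).1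

/-- Opening the edge inserts the loop of `C` into the interface after `A`, so `C` is reached after a
right turn at `A` and the whole loop except its turn at `C`. Since the loop has total phase -1, this
part has phase `-leftPhase⁻¹`, and the factor is `-leftPhase⁻¹ ^ 2 = -i`. -/
theorem firstPhase_of_separate (h : Opening O O' A C) (hs : s ∈ periodicPts (medialPerm O))
    (hC : C ∈ periodicPts (medialPerm O)) (hAs : A ∈ orbit O s) (hCs : C ∉ orbit O s) :
    firstPhase O' s A = firstPhase O s A ∧
      firstPhase O' s C = -Complex.I * firstPhase O s A := by
  obtain ⟨k, hk, hmin⟩ := exists_first hAs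
  have hn : ∀ i < k, (medialPerm O)^[i] s ≠ A ∧ (medialPerm O)^[i] s ≠ C :=
    fun i hi => ⟨hmin i hi, fun h' => hCs ⟨i, h'⟩⟩
  have hfirst := h.firstPhase_eq_of_first hk hn
  have hit := h.iterate_eq hn
  refine ⟨hfirst, ?_⟩
  have hpos := minimalPeriod_pos_of_mem_periodicPts hC
  obtain ⟨m, hm⟩ : ∃ m, minimalPeriod (medialPerm O) C = m + 1 := ⟨_, (Nat.sub_add_cancel hpos).symm⟩
  set u := medialPerm O C with hu
  have hu' : ∀ i, (medialPerm O)^[i] u = (medialPerm O)^[i + 1] C := fun i => by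
    rw [hu, ← iterate_succ_apply]
  have hloop : ∀ i < m, (medialPerm O)^[i] u ≠ A ∧ (medialPerm O)^[i] u ≠ C := by
    intro i hi
    rw [hu']
    refine ⟨fun h' => hCs ((mem_orbit_iterate_iff hs (i + 1) C).1 (h' ▸ hAs)), fun h' => ?_⟩
    have : IsPeriodicPt (medialPerm O) (i + 1) C := h'
    have := this.minimalPeriod_le (by omega)
    omega
  have hit' := h.iterate_eq hloop
  have hk' : (medialPerm O')^[k] s = A := (hit k le_rfl).trans hk
  have hA' : (medialPerm O')^[k + 1] s = u := by
    rw [iterate_succ_apply', hk', h.perm_left]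
  have hshift : ∀ i, (medialPerm O')^[k + 1 + i] s = (medialPerm O')^[i] u := fun i => by
    rw [add_comm, iterate_add_apply, hA']
  have hend : (medialPerm O')^[k + 1 + m] s = C := by
    rw [hshift, hit' m le_rfl, hu', ← hm, iterate_minimalPeriod]
  have hP := prod_turn_orbit O C hC
  rw [hm, Finset.prod_range_succ', iterate_zero, id, h.turn_right] at hP
  simp only [← hu'] at hP
  rw [firstPhase_eq hend, Finset.prod_range_add, Finset.prod_range_succ, h.prod_eq hn, hk',
    h.turn_left', firstPhase_eq hk hmin]
  · simp only [hshift]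
    rw [h.prod_eq hloop]
    have hl := leftPhase_ne_zero
    have : ∏ i ∈ Finset.range m, turn O ((medialPerm O)^[i] u) = -leftPhase⁻¹ := by
      rw [eq_neg_iff_add_eq_zero]
      field_simp
      rw [hP]; ring
    rw [this, ← inv_leftPhase_sq]
    ring
  · intro j hj
    rcases Nat.lt_or_ge k j with hkj | hkj
    · obtain ⟨i, rfl⟩ := Nat.exists_eq_add_of_le hkj
      rw [show k.succ = k + 1 from rfl, hshift, hit' i (by omega)]
      exact (hloop i (by omega)).2
    · rw [hit j hkj]
      exact fun h' => hCs ⟨j, h'⟩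

/-- If `A` comes before `C`, opening the edge cuts off the stretch after `A` up to `C` as a separate
loop. Its total phase -1 after the opening determines the phase of the stretch before it, which
yields the factor i. -/
theorem firstPhase_of_joint (h : Opening O O' A C) (hs : s ∈ periodicPts (medialPerm O))
    {k k' : ℕ} (hkk' : k < k') (hk : (medialPerm O)^[k] s = A)
    (hmin : ∀ j < k, (medialPerm O)^[j] s ≠ A) (hk' : (medialPerm O)^[k'] s = C)
    (hmin' : ∀ j < k', (medialPerm O)^[j] s ≠ C) :
    firstPhase O' s A = firstPhase O s A ∧ firstPhase O' s C = 0 ∧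
      firstPhase O s C = Complex.I * firstPhase O s A := by
  have hlt : k' < minimalPeriod (medialPerm O) s :=
    first_lt_minimalPeriod hs (by rwa [hk'])
  have hinj : ∀ i j, i ≤ k' → j ≤ k' → (medialPerm O)^[i] s = (medialPerm O)^[j] s → i = j :=
    fun i j hi hj hij => iterate_injOn_Iio_minimalPeriod (f := medialPerm O) (x := s)
      (show i < _ by omega) (show j < _ by omega) hij
  obtain ⟨n, rfl⟩ := Nat.exists_eq_add_of_lt hkk'
  set u := medialPerm O A with hu
  have hu' : ∀ i, (medialPerm O)^[i] u = (medialPerm O)^[k + i + 1] s := fun i => by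
    rw [hu, ← hk, ← iterate_succ_apply' (medialPerm O), ← iterate_add_apply]
    congr 1
    omega
  have hloop : ∀ i < n, (medialPerm O)^[i] u ≠ A ∧ (medialPerm O)^[i] u ≠ C := by
    intro i hi
    rw [hu']
    refine ⟨fun h' => ?_, hmin' _ (by omega)⟩
    have := hinj _ _ (by omega) (by omega) (h'.trans hk.symm)
    omega
  have hit' := h.iterate_eq hloop
  have hC1 : ∀ i, (medialPerm O')^[i + 1] C = (medialPerm O')^[i] u := fun i => by
    rw [iterate_succ_apply, h.perm_right]
  have hCper : IsPeriodicPt (medialPerm O') (n + 1) C := by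
    rw [IsPeriodicPt, IsFixedPt, hC1, hit' n le_rfl, hu', hk']
  have hC : C ∈ periodicPts (medialPerm O') := ⟨n + 1, by omega, hCper⟩
  have hM : minimalPeriod (medialPerm O') C = n + 1 := by
    refine le_antisymm (hCper.minimalPeriod_le (by omega)) ?_
    by_contra! hlt'
    obtain ⟨i, hi⟩ : ∃ i, minimalPeriod (medialPerm O') C = i + 1 :=
      ⟨_, (Nat.sub_add_cancel (minimalPeriod_pos_of_mem_periodicPts hC)).symm⟩
    have := iterate_minimalPeriod (f := medialPerm O') (x := C)
    rw [hi, hC1, hit' i (by omega)] at this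
    exact (hloop i (by omega)).2 this
  have hP := prod_turn_orbit O' C hC
  rw [hM, Finset.prod_range_succ', iterate_zero, id, h.turn_right'] at hP
  simp only [hC1] at hP
  rw [h.prod_eq hloop] at hP
  refine ⟨h.firstPhase_eq_of_first hk fun i hi => ⟨hmin i hi, hmin' i (by omega)⟩,
    firstPhase_eq_zero ?_, ?_⟩
  · rintro ⟨j, hj⟩
    have hsC : s ∈ orbit O' C :=
      (mem_orbit_iterate_iff hC j s).1 (hj ▸ self_mem_orbit O' C)
    rw [orbit_eq_image hC] at hsC
    obtain ⟨i, hi, his⟩ := hsC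
    rw [hM, Set.mem_Iio] at hi
    simp only at his
    cases i with
    | zero => exact hmin' 0 (by omega) his.symm
    | succ i =>
      rw [hC1, hit' i (by omega), hu'] at his
      have := hinj (k + i + 1) 0 (by omega) (by omega) his
      omega
  · rw [firstPhase_eq hk' hmin', firstPhase_eq hk hmin, show k + n + 1 = k + 1 + n by omega,
      Finset.prod_range_add, Finset.prod_range_succ, hk, h.turn_left]
    have : ∀ i, (medialPerm O)^[k + 1 + i] s = (medialPerm O)^[i] u := fun i => by
      rw [hu']
      congr 1
      omega
    simp only [this]
    have hl := leftPhase_ne_zero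
    have hQ : ∏ i ∈ Finset.range n, turn O ((medialPerm O)^[i] u) = -leftPhase := by
      field_simp at hP
      exact hP
    have hsq := leftPhase_sq
    rw [hQ]
    linear_combination (-∏ i ∈ Finset.range k, turn O ((medialPerm O)^[i] s)) * hsq

/-- The relation between the phases at the two incoming medial edges and an outgoing medial edge,
summed over a pair of configurations with the weights of the critical FK Ising model. -/
theorem phase_relation (h : Opening O O' A C) (hs : s ∈ periodicPts (medialPerm O))
    (hA : A ∈ periodicPts (medialPerm O)) (hC : C ∈ periodicPts (medialPerm O)) {w w' : ℝ}
    (hjoint : A ∈ orbit O s → C ∈ orbit O s → w' = √2 * w)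
    (hleft : A ∈ orbit O s → C ∉ orbit O s → w = √2 * w')
    (hright : A ∉ orbit O s → C ∈ orbit O s → w = √2 * w') :
    √2 * (w * (firstPhase O s A * leftPhase) + w' * (firstPhase O' s C * leftPhase⁻¹)) =
      leftPhase * ((w * firstPhase O s A + w' * firstPhase O' s A) +
        Complex.I * (w * firstPhase O s C + w' * firstPhase O' s C)) := by
  have hl : leftPhase⁻¹ = leftPhase * Complex.I := by
    rw [← inv_leftPhase_sq]
    have := leftPhase_ne_zero
    field_simp
  have h2 : (√2 : ℂ) * √2 = 2 := by
    rw [← Complex.ofReal_mul, Real.mul_self_sqrt (by norm_num)]; norm_num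
  have hI := Complex.I_mul_I
  rw [hl]
  -- If both strands belong to the interface, opening the edge splits it; if only one does, a loop
  -- is absorbed; if neither does, all four phases vanish.
  by_cases hAs : A ∈ orbit O s <;> by_cases hCs : C ∈ orbit O s
  · rw [hjoint hAs hCs]
    obtain ⟨k, hk, hmin⟩ := exists_first hAs
    obtain ⟨k', hk', hmin'⟩ := exists_first hCs
    rcases lt_trichotomy k k' with hlt | heq | hlt
    · obtain ⟨h1, h2, h3⟩ := h.firstPhase_of_joint hs hlt hk hmin hk' hmin'
      rw [h1, h2, h3]
      push_cast
      linear_combination (- leftPhase * w * firstPhase O s A) * hI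
    · exact absurd (hk.symm.trans (heq ▸ hk')) h.ne
    · obtain ⟨h1, h3, h4⟩ := h.symm.firstPhase_of_joint hs hlt hk' hmin' hk hmin
      rw [h1, h3, h4]
      push_cast
      linear_combination (leftPhase * w * firstPhase O s C * Complex.I) * h2
  · rw [hleft hAs hCs]
    obtain ⟨h1, h3⟩ := h.firstPhase_of_separate hs hC hAs hCs
    rw [h1, h3, firstPhase_eq_zero hCs]
    push_cast
    linear_combination (leftPhase * w' * firstPhase O s A) * h2 +
      (-√2 * leftPhase * w' * firstPhase O s A + leftPhase * w' * firstPhase O s A) * hI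
  · rw [hright hAs hCs]
    obtain ⟨h1, h3⟩ := h.symm.firstPhase_of_separate hs hA hCs hAs
    rw [h1, h3, firstPhase_eq_zero hAs]
    push_cast
    ring
  · rw [firstPhase_eq_zero hAs, firstPhase_eq_zero hCs]
    have aux : ∀ e, e ∈ orbit O' s → e ∈ orbit O s := by
      rintro e ⟨j, rfl⟩
      refine ⟨j, (h.iterate_eq (n := j) (fun i _ => ⟨fun h' => hAs ⟨i, h'⟩,
        fun h' => hCs ⟨i, h'⟩⟩) j le_rfl).symm⟩
    rw [firstPhase_eq_zero (mt (aux A) hAs), firstPhase_eq_zero (mt (aux C) hCs)]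
    ring

end Opening

end FKIsing

namespace FKIsing

open Equiv Equiv.Perm Function

namespace DobrushinDomain

variable (D : DobrushinDomain)

/-! ### Geometry of Dobrushin domains -/

theorem mem_edges_iff_exists {v : Sym2 Site} :
    v ∈ D.edges ↔ ∃ f ∈ D.faces, ∃ c, v = edgeAt (corner f c) c := by
  have h3 : ∀ f : Face, f + (0, 1) + dir 3 = f := fun f => by simp [dir, add_assoc]
  have h2 : ∀ f : Face, f + (1, 1) + dir 2 = f + (0, 1) := fun f => by simp [dir, add_assoc]
  have h1 : ∀ f : Face, f + (1, 0) + dir 1 = f + (1, 1) := fun f => by simp [dir, add_assoc]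
  have h0 : ∀ f : Face, f + dir 0 = f + (1, 0) := fun f => by simp [dir]
  have hz : ∀ f : Face, f + (0, 0) = f := fun f => add_zero f
  simp only [edges, Finset.mem_biUnion, Finset.mem_insert, Finset.mem_singleton]
  refine exists_congr fun f => and_congr_right fun _ => ?_
  rw [Fin.exists_fin_succ, Fin.exists_fin_succ, Fin.exists_fin_succ, Fin.exists_fin_succ]
  simp [edgeAt, corner, hz, h0, h1, h2, h3, Sym2.eq_swap (a := f + (1, 1)),
    Sym2.eq_swap (a := f + (0, 1)) (b := f)]
  tauto

theorem mem_edges_iff {x : Site} {d : Fin 4} :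
    edgeAt x d ∈ D.edges ↔ faceAt x d ∈ D.faces ∨ faceAt x (d - 1) ∈ D.faces := by
  rw [mem_edges_iff_exists]
  constructor
  · rintro ⟨f, hf, c, h⟩
    rcases edgeAt_eq_iff.1 h.symm with ⟨h', rfl⟩ | ⟨h', rfl⟩
    · left; rwa [← h', faceAt_corner]
    · right; rwa [← faceAt_right, ← h', faceAt_corner]
  · rintro (h | h)
    · exact ⟨_, h, d, by rw [corner_faceAt]⟩
    · refine ⟨_, h, d + 2, ?_⟩
      rw [← faceAt_right, corner_faceAt, edgeAt_flip]

theorem exists_edgeAt {v : Sym2 Site} (h : v ∈ D.edges) : ∃ x d, v = edgeAt x d := by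
  obtain ⟨f, -, c, h⟩ := D.mem_edges_iff_exists.1 h
  exact ⟨_, _, h⟩

theorem mem_sites_iff {x : Site} : x ∈ D.sites ↔ ∃ d, faceAt x d ∈ D.faces := by
  have hz : ∀ f : Face, f + (0, 0) = f := fun f => add_zero f
  simp only [sites, Finset.mem_biUnion, Finset.mem_insert, Finset.mem_singleton]
  constructor
  · rintro ⟨f, hf, h | h | h | h⟩
    · exact ⟨0, by simpa [faceAt, h, hz] using hf⟩
    · exact ⟨1, by simpa [faceAt, h, add_assoc, hz] using hf⟩
    · exact ⟨3, by simpa [faceAt, h, add_assoc, hz] using hf⟩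
    · exact ⟨2, by simpa [faceAt, h, add_assoc, hz] using hf⟩
  · rintro ⟨d, hd⟩
    refine ⟨_, hd, ?_⟩
    fin_cases d <;> simp [faceAt, add_assoc]

theorem mem_sites_of_edge {x : Site} {d : Fin 4} (h : edgeAt x d ∈ D.edges) : x ∈ D.sites :=
  D.mem_sites_iff.2 (D.mem_edges_iff.1 h |>.elim (⟨_, ·⟩) (⟨_, ·⟩))

theorem mem_sites_of_edge' {x : Site} {d : Fin 4} (h : edgeAt x d ∈ D.edges) :
    x + dir d ∈ D.sites :=
  D.mem_sites_of_edge (d := d + 2) (by rwa [edgeAt_flip])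

theorem vertex_mem_sites {k : ℕ} (hk : k < D.len) : D.vertex k ∈ D.sites :=
  D.mem_sites_iff.2 ⟨_, D.left_mem k hk⟩

theorem len_pos : 0 < D.len := D.mid_pos.trans_le D.mid_le

theorem mem_wiredSites {x : Site} :
    x ∈ D.wiredSites ↔ ∃ k, D.mid ≤ k ∧ k ≤ D.len ∧ D.vertex k = x := by
  simp [wiredSites, and_assoc]

theorem vertex_mem_wiredSites {k : ℕ} (h : D.mid ≤ k) (h' : k ≤ D.len) :
    D.vertex k ∈ D.wiredSites := D.mem_wiredSites.2 ⟨k, h, h', rfl⟩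

theorem vertex_zero_mem_wiredSites : D.vertex 0 ∈ D.wiredSites := by
  rw [← D.closed]
  exact D.vertex_mem_wiredSites D.mid_le le_rfl

theorem exists_index_of_wiredSites {x : Site} (h : x ∈ D.wiredSites) :
    ∃ k < D.len, (k = 0 ∨ D.mid ≤ k) ∧ D.vertex k = x := by
  obtain ⟨k, h1, h2, rfl⟩ := D.mem_wiredSites.1 h
  rcases h2.lt_or_eq with h2 | rfl
  · exact ⟨k, h2, .inr h1, rfl⟩
  · exact ⟨0, D.len_pos, .inl rfl, D.closed.symm⟩

theorem wiredSites_subset : D.wiredSites ⊆ D.sites := by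
  intro x hx
  obtain ⟨k, hk, -, rfl⟩ := D.exists_index_of_wiredSites hx
  exact D.vertex_mem_sites hk

theorem vertex_notMem_wiredSites {k : ℕ} (h0 : 0 < k) (hk : k < D.mid) :
    D.vertex k ∉ D.wiredSites := by
  intro h
  obtain ⟨j, hj, hj', e⟩ := D.exists_index_of_wiredSites h
  have := D.selfAvoiding j hj k (hk.trans_le D.mid_le) e
  omega

/-- A side of the polygon, the domain being on its left, is a step of the polygon. -/
theorem exists_step {x : Site} {d : Fin 4} (h : faceAt x d ∈ D.faces)
    (h' : faceAt x (d - 1) ∉ D.faces) :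
    ∃ k < D.len, D.vertex k = x ∧ D.step k = d := D.covers x d h h'

theorem step_edge_mem_wiredEdges {k : ℕ} (h : D.mid ≤ k) (h' : k < D.len) :
    edgeAt (D.vertex k) (D.step k) ∈ D.wiredEdges :=
  Finset.mem_image.2 ⟨k, Finset.mem_Ico.2 ⟨h, h'⟩, rfl⟩

theorem exists_of_mem_wiredEdges {v : Sym2 Site} (h : v ∈ D.wiredEdges) :
    ∃ k, D.mid ≤ k ∧ k < D.len ∧ v = edgeAt (D.vertex k) (D.step k) := by
  obtain ⟨k, hk, e⟩ := Finset.mem_image.1 h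
  rw [Finset.mem_Ico] at hk
  exact ⟨k, hk.1, hk.2, e.symm⟩

theorem wiredEdges_subset : D.wiredEdges ⊆ D.edges := by
  intro v hv
  obtain ⟨k, -, hk, rfl⟩ := D.exists_of_mem_wiredEdges hv
  exact D.mem_edges_iff.2 (.inl (D.left_mem k hk))

/-- The position of the inside face selects one of the two orientations of the edge, namely that of
the polygon. -/
theorem vertex_index_of_wiredEdge {x : Site} {d : Fin 4} (h : edgeAt x d ∈ D.wiredEdges)
    (hf : faceAt x d ∈ D.faces) :
    ∃ k, D.mid ≤ k ∧ k < D.len ∧ D.vertex k = x ∧ D.step k = d := by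
  obtain ⟨k, h1, h2, e⟩ := D.exists_of_mem_wiredEdges h
  refine ⟨k, h1, h2, ?_⟩
  rcases edgeAt_eq_iff.1 e.symm with h | ⟨h, h'⟩
  · exact h
  · have := D.right_notMem k h2
    rw [h, h', show d + 2 - 1 = d + 1 by grind, faceAt_left] at this
    exact absurd hf this

theorem wiredEdge_right_notMem {x : Site} {d : Fin 4} (h : edgeAt x d ∈ D.wiredEdges)
    (hf : faceAt x d ∈ D.faces) : faceAt x (d - 1) ∉ D.faces := by
  obtain ⟨k, h1, h2, rfl, rfl⟩ := D.vertex_index_of_wiredEdge h hf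
  exact D.right_notMem k h2

theorem wiredEdge_ends {x : Site} {d : Fin 4} (h : edgeAt x d ∈ D.wiredEdges) :
    x ∈ D.wiredSites ∧ x + dir d ∈ D.wiredSites := by
  obtain ⟨k, h1, h2, e⟩ := D.exists_of_mem_wiredEdges h
  have hk := D.vertex_mem_wiredSites h1 h2.le
  have hk' := D.vertex_mem_wiredSites (h1.trans k.le_succ) h2
  rw [D.vertex_succ k h2] at hk'
  rcases edgeAt_eq_iff.1 e with ⟨rfl, rfl⟩ | ⟨rfl, rfl⟩
  · exact ⟨hk, hk'⟩
  · rw [add_dir_add_dir]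
    exact ⟨hk', hk⟩

/-- The medial edges at the sites of the wired arc that lie outside the domain. -/
def Outer : Set MedialEdge := {e | e.1 ∈ D.wiredSites ∧ faceAt e.1 e.2 ∉ D.faces}

theorem startEdge_mem_Outer : D.startEdge ∈ D.Outer :=
  ⟨D.vertex_zero_mem_wiredSites, D.right_notMem 0 D.len_pos⟩

theorem vertex_mid : D.vertex D.mid = D.vertex (D.mid - 1) + dir (D.step (D.mid - 1)) := by
  have h1 := D.mid_pos
  have h2 := D.mid_le
  have := D.vertex_succ (D.mid - 1) (by omega)
  rwa [Nat.sub_add_cancel h1] at this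

theorem endEdge_mem_Outer : D.endEdge ∈ D.Outer := by
  have h1 := D.mid_pos
  have h2 := D.mid_le
  refine ⟨D.vertex_mem_wiredSites le_rfl D.mid_le, ?_⟩
  rw [endEdge, D.vertex_mid, faceAt_right]
  exact D.right_notMem _ (by omega)

/-- The medial edges on which the exploration path is determined by the interface through `e_a`. -/
def Regular (e : MedialEdge) : Prop := e ∉ D.Outer ∨ e = D.startEdge ∨ e = D.endEdge

theorem regular_of_mem_faces {e : MedialEdge} (h : faceAt e.1 e.2 ∈ D.faces) : D.Regular e :=
  .inl fun h' => h'.2 h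

theorem regular_of_notMem_wiredSites {e : MedialEdge} (h : e.1 ∉ D.wiredSites) : D.Regular e :=
  .inl fun h' => h h'.1

/-- The four medial edges around an edge of the domain that is not on the wired arc are regular. -/
theorem regular_of_edge {x : Site} {d : Fin 4} (h : edgeAt x d ∈ D.edges)
    (hw : edgeAt x d ∉ D.wiredEdges) :
    D.Regular (x, d - 1) ∧ D.Regular (x, d) ∧ D.Regular (x + dir d, d + 1) ∧
      D.Regular (x + dir d, d + 2) := by
  have main : ∀ {x : Site} {d : Fin 4}, edgeAt x d ∉ D.wiredEdges → faceAt x d ∈ D.faces →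
      D.Regular (x, d - 1) ∧ D.Regular (x, d) ∧ D.Regular (x + dir d, d + 1) ∧
        D.Regular (x + dir d, d + 2) := by
    intro x d hw hf
    have hC : D.Regular (x + dir d, d + 1) := D.regular_of_mem_faces (by rwa [faceAt_left])
    refine ⟨?_, D.regular_of_mem_faces hf, hC, ?_⟩
    · by_cases hf' : faceAt x (d - 1) ∈ D.faces
      · exact D.regular_of_mem_faces hf'
      -- With an outside face on its right the edge is a step of the free arc. Its initial site is
      -- either strictly inside the arc or equal to `a`, and in the latter case the medial edge is
      -- `e_a`; the terminal site leads to `e_b` in the same way.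
      obtain ⟨k, hk, rfl, rfl⟩ := D.exists_step hf hf'
      have hmid : k < D.mid := by
        by_contra! h
        exact hw (D.step_edge_mem_wiredEdges h hk)
      rcases Nat.eq_zero_or_pos k with rfl | h0
      · exact .inr (.inl rfl)
      · exact D.regular_of_notMem_wiredSites (D.vertex_notMem_wiredSites h0 hmid)
    · by_cases hf' : faceAt x (d - 1) ∈ D.faces
      · exact D.regular_of_mem_faces (by rwa [faceAt_right])
      obtain ⟨k, hk, rfl, rfl⟩ := D.exists_step hf hf'
      have hmid : k < D.mid := by
        by_contra! h
        exact hw (D.step_edge_mem_wiredEdges h hk)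
      rw [← D.vertex_succ k hk]
      rcases Nat.lt_or_ge (k + 1) D.mid with h | h
      · exact D.regular_of_notMem_wiredSites (D.vertex_notMem_wiredSites (by omega) h)
      · obtain rfl : k = D.mid - 1 := by omega
        refine .inr (.inr ?_)
        rw [endEdge, Nat.sub_add_cancel D.mid_pos]
  rcases D.mem_edges_iff.1 h with hf | hf
  · exact main hw hf
  · rw [← edgeAt_flip] at hw
    rw [← faceAt_right] at hf
    have := main hw hf
    rw [add_dir_add_dir, show d + 2 - 1 = d + 1 by grind, show d + 2 + 1 = d - 1 by grind,
      show d + 2 + 2 = d by grind] at this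
    tauto

/-! ### The exploration path as a part of an interface -/

/-- The edges that the interfaces do not cross. -/
def barrier (ω : Finset (Sym2 Site)) : Set (Sym2 Site) := ↑(ω ∪ D.wiredEdges)

variable {D} {ω : Finset (Sym2 Site)}

theorem barrier_subset (hω : ω ⊆ D.edges) {v : Sym2 Site} (h : v ∈ D.barrier ω) : v ∈ D.edges :=
  Finset.union_subset hω D.wiredEdges_subset (Finset.mem_coe.1 h)

theorem next_eq (ω : Finset (Sym2 Site)) : D.next ω = medialPerm (D.barrier ω) := by
  funext e
  by_cases h : D.MeetsOpen ω e
  · have h' : edgeAt e.1 (e.2 + 1) ∈ D.barrier ω := Finset.mem_coe.2 h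
    simp only [next, if_pos h, medialPerm, coe_fn_mk, if_pos h']
  · have h' : edgeAt e.1 (e.2 + 1) ∉ D.barrier ω := mt Finset.mem_coe.1 h
    simp only [next, if_neg h, medialPerm, coe_fn_mk, if_neg h']

theorem interface_eq (ω : Finset (Sym2 Site)) (k : ℕ) :
    D.interface ω k = (medialPerm (D.barrier ω))^[k] D.startEdge := by
  rw [interface, next_eq]

theorem exp_winding (ω : Finset (Sym2 Site)) (k : ℕ) :
    Complex.exp (-(1 / 2) * Complex.I * (D.winding ω k : ℂ)) =
      ∏ j ∈ Finset.range k, turn (D.barrier ω) ((medialPerm (D.barrier ω))^[j] D.startEdge) := by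
  rw [winding, Complex.ofReal_sum, Finset.mul_sum, Complex.exp_sum]
  refine Finset.prod_congr rfl fun j _ => ?_
  rw [← interface_eq]
  by_cases h : D.MeetsOpen ω (D.interface ω j)
  · have h' : edgeAt _ _ ∈ D.barrier ω := Finset.mem_coe.2 h
    rw [if_pos h, turn, if_pos h', leftPhase, ← Complex.exp_neg]
    congr 1
    push_cast
    ring
  · have h' : edgeAt _ _ ∉ D.barrier ω := mt Finset.mem_coe.1 h
    rw [if_neg h, turn, if_neg h', leftPhase]
    congr 1
    push_cast
    ring

/-- On the outer side of the wired arc an interface follows wired edges, which count as open, and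
turns left at edges outside the domain. It can leave this side only at `e_a`, where the first free
edge is met. -/
theorem medialPerm_mem_Outer (hω : ω ⊆ D.edges) {e : MedialEdge} (h : e ∈ D.Outer)
    (hne : e ≠ D.startEdge) : medialPerm (D.barrier ω) e ∈ D.Outer := by
  obtain ⟨x, c⟩ := e
  obtain ⟨hx, hc⟩ := h
  simp only at hx hc
  have hcc : c = c + 1 - 1 := by simp
  by_cases hf : faceAt x (c + 1) ∈ D.faces
  · obtain ⟨k, hk, rfl, hs⟩ := D.exists_step hf (by rwa [← hcc])
    rcases Nat.lt_or_ge k D.mid with hm | hm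
    · rcases Nat.eq_zero_or_pos k with rfl | h0
      · exact absurd (by rw [startEdge, hs, ← hcc]) hne
      · exact absurd hx (D.vertex_notMem_wiredSites h0 hm)
    · have hv : edgeAt (D.vertex k) (c + 1) ∈ D.barrier ω :=
        Finset.mem_coe.2 (Finset.mem_union_right _ (hs ▸ D.step_edge_mem_wiredEdges hm hk))
      rw [hcc, medialPerm_of_mem hv]
      refine ⟨?_, ?_⟩
      · rw [← hs, ← D.vertex_succ k hk]
        exact D.vertex_mem_wiredSites (by omega) hk
      · rw [faceAt_right, ← hcc]
        exact hc
  · have hv : edgeAt x (c + 1) ∉ D.barrier ω := fun h' => by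
      rcases D.mem_edges_iff.1 (barrier_subset hω h') with h' | h'
      · exact hf h'
      · rw [← hcc] at h'
        exact hc h'
    rw [hcc, medialPerm_of_notMem hv]
    exact ⟨hx, hf⟩

/-- The path stops at `e_b` while the interface runs on, but this continuation returns to `e_a`
along outer medial edges only. It cannot make the first visit to a regular edge. -/
theorem windingPhase_eq (hω : ω ⊆ D.edges) {e : MedialEdge} (he : D.Regular e) :
    D.windingPhase ω e = firstPhase (D.barrier ω) D.startEdge e := by
  classical
  set σ := medialPerm (D.barrier ω) with hσ
  by_cases h : e ∈ orbit (D.barrier ω) D.startEdge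
  · obtain ⟨k, hk, hmin⟩ := exists_first h
    have hpass : D.PassesAt ω e k := by
      refine ⟨by rw [interface_eq, hk], fun j h0 hj hje => ?_⟩
      rw [interface_eq] at hje
      rcases he with he | rfl | rfl
      -- After a visit to `e_b` the interface stays outer up to time `k`: a return to `e_a` in
      -- between would give an earlier visit to `e`.
      · have key : ∀ i, j + i ≤ k → σ^[j + i] D.startEdge ∈ D.Outer := by
          intro i hi
          induction i with
          | zero => rw [add_zero, hje]; exact D.endEdge_mem_Outer
          | succ i ih =>
            rw [← add_assoc, iterate_succ_apply']
            refine medialPerm_mem_Outer hω (ih (by omega)) fun hst => ?_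
            refine hmin (k - (j + i)) (by omega) ?_
            rw [← hk]
            conv_rhs => rw [show k = k - (j + i) + (j + i) by omega, iterate_add_apply, ← hσ, hst]
        have := key (k - j) (by omega)
        rw [Nat.add_sub_cancel' hj.le, hk] at this
        exact he this
      · exact hmin 0 (by omega) rfl
      · exact hmin j hj hje
    have hex : ∃ k, D.PassesAt ω e k := ⟨k, hpass⟩
    have hfind : Nat.find hex = k := by
      rw [Nat.find_eq_iff]
      refine ⟨hpass, fun j hj hj' => hmin j hj ?_⟩
      rw [← interface_eq]
      exact hj'.1
    rw [windingPhase, dif_pos hex, firstPhase_eq hk hmin, hfind, exp_winding]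
  · rw [firstPhase_eq_zero h, windingPhase, dif_neg]
    rintro ⟨k, hk, -⟩
    exact h ⟨k, by rw [← interface_eq, hk]⟩

theorem medialPerm_mem_sites (hω : ω ⊆ D.edges) {e : MedialEdge} (h : e.1 ∈ D.sites) :
    (medialPerm (D.barrier ω) e).1 ∈ D.sites := by
  obtain ⟨x, d⟩ := e
  rw [show d = d + 1 - 1 by simp]
  by_cases hv : edgeAt x (d + 1) ∈ D.barrier ω
  · rw [medialPerm_of_mem hv]
    exact D.mem_sites_of_edge' (barrier_subset hω hv)
  · rw [medialPerm_of_notMem hv]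
    exact h

theorem iterate_mem_sites (hω : ω ⊆ D.edges) {e : MedialEdge} (h : e.1 ∈ D.sites) (j : ℕ) :
    ((medialPerm (D.barrier ω))^[j] e).1 ∈ D.sites := by
  induction j with
  | zero => exact h
  | succ j ih => rw [iterate_succ_apply']; exact medialPerm_mem_sites hω ih

/-- An orbit of an injective map within a finite set is periodic. -/
theorem mem_periodicPts_of_mem_sites (hω : ω ⊆ D.edges) {e : MedialEdge} (h : e.1 ∈ D.sites) :
    e ∈ periodicPts (medialPerm (D.barrier ω)) := by
  obtain ⟨i, j, hij, hj⟩ := ((D.sites ×ˢ (Finset.univ : Finset (Fin 4))).finite_toSet).exists_lt_map_eq_of_forall_mem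
    (f := fun j => (medialPerm (D.barrier ω))^[j] e)
    (fun j => by simpa using iterate_mem_sites hω h j)
  refine ⟨j - i, by omega, ((medialPerm (D.barrier ω)).injective.iterate i) ?_⟩
  rw [← iterate_add_apply, Nat.add_sub_cancel' hij.le]
  exact hj.symm

theorem startEdge_periodic (hω : ω ⊆ D.edges) :
    D.startEdge ∈ periodicPts (medialPerm (D.barrier ω)) :=
  mem_periodicPts_of_mem_sites hω (D.vertex_mem_sites D.len_pos)

end DobrushinDomain

end FKIsing

/-! ### Connected components after the addition of an edge -/

namespace SimpleGraph

variable {V : Type*} {G G' : SimpleGraph V} {x y : V}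

theorem Reachable.eq_of_forall_adj {α : Type*} {f : V → α} (hf : ∀ u v, G.Adj u v → f u = f v)
    {u v : V} (h : G.Reachable u v) : f u = f v := by
  obtain ⟨p⟩ := h
  induction p with
  | nil => rfl
  | cons h _ ih => exact (hf _ _ h).trans ih

theorem card_connectedComponent_of_reachable (hle : G ≤ G')
    (hadj : ∀ u v, G'.Adj u v → G.Adj u v ∨ s(u, v) = s(x, y)) (hxy : G.Reachable x y) :
    Nat.card G'.ConnectedComponent = Nat.card G.ConnectedComponent := by
  symm
  refine Nat.card_eq_of_bijective (ConnectedComponent.map (Hom.ofLE hle)) ⟨?_, ?_⟩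
  · intro c c'
    induction c, c' using ConnectedComponent.ind₂ with | _ u v
    intro h
    simp only [ConnectedComponent.map_mk, ConnectedComponent.eq] at h
    refine Reachable.eq_of_forall_adj (fun a b hab => ?_) h
    rcases hadj a b hab with hab | hab
    · exact ConnectedComponent.eq.2 hab.reachable
    · rcases Sym2.eq_iff.1 hab with ⟨rfl, rfl⟩ | ⟨rfl, rfl⟩
      · exact ConnectedComponent.eq.2 hxy
      · exact ConnectedComponent.eq.2 hxy.symm
  · exact ConnectedComponent.surjective_map_ofLE hle

/-- The components of `G` other than that of `y` correspond bijectively to the components of `G'`.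
-/
theorem card_connectedComponent_of_not_reachable [Finite V] (hle : G ≤ G')
    (hadj : ∀ u v, G'.Adj u v → G.Adj u v ∨ s(u, v) = s(x, y)) (hG' : G'.Reachable x y)
    (hxy : ¬G.Reachable x y) :
    Nat.card G.ConnectedComponent = Nat.card G'.ConnectedComponent + 1 := by
  classical
  let f : {c : G.ConnectedComponent // c ≠ G.connectedComponentMk y} → G'.ConnectedComponent :=
    fun c => ConnectedComponent.map (Hom.ofLE hle) c.1
  have hne : G.connectedComponentMk x ≠ G.connectedComponentMk y :=
    fun h => hxy (ConnectedComponent.eq.1 h)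
  have hf : Function.Bijective f := by
    constructor
    · rintro ⟨c, hc⟩ ⟨c', hc'⟩ h
      induction c, c' using ConnectedComponent.ind₂ with | _ u v
      simp only [f, ConnectedComponent.map_mk, ConnectedComponent.eq] at h
      -- Relabelling the component of `y` as that of `x` gives a function constant along all edges
      -- of `G'`, which still separates the components that were kept.
      let g : V → G.ConnectedComponent := fun w =>
        if G.connectedComponentMk w = G.connectedComponentMk y then G.connectedComponentMk x
        else G.connectedComponentMk w
      have hg : g u = g v := by
        refine Reachable.eq_of_forall_adj (fun a b hab => ?_) h
        rcases hadj a b hab with hab | hab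
        · have : G.connectedComponentMk a = G.connectedComponentMk b :=
            ConnectedComponent.eq.2 hab.reachable
          simp only [g, this]
        · rcases Sym2.eq_iff.1 hab with ⟨rfl, rfl⟩ | ⟨rfl, rfl⟩ <;> simp [g]
      simp only [g, if_neg hc, if_neg hc'] at hg
      exact Subtype.ext hg
    · intro c'
      obtain ⟨c, rfl⟩ := ConnectedComponent.surjective_map_ofLE hle c'
      by_cases hc : c = G.connectedComponentMk y
      · refine ⟨⟨G.connectedComponentMk x, hne⟩, ?_⟩
        simp only [f, hc, ConnectedComponent.map_mk, ConnectedComponent.eq]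
        exact hG'
      · exact ⟨⟨c, hc⟩, rfl⟩
  rw [← Nat.card_eq_of_bijective f hf]
  have := Fintype.ofFinite G.ConnectedComponent
  rw [Nat.card_eq_fintype_card, Nat.card_eq_fintype_card, Fintype.card_subtype_compl,
    Fintype.card_subtype_eq]
  have : 0 < Fintype.card G.ConnectedComponent := Fintype.card_pos_iff.2 ⟨G.connectedComponentMk x⟩
  omega

end SimpleGraph

namespace FKIsing

open Equiv Equiv.Perm Function

/-! ### The weights -/

namespace DobrushinDomain

/-- The ratio p / (1 - p) is √2 = √q. Opening an edge therefore multiplies the weight by √2, or by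
√2 / 2 = 1 / √2 when two clusters merge; this symmetry makes the phase relation close. -/
theorem pCritical_eq : pCritical = √2 * (1 - pCritical) := by
  rw [pCritical]
  have : 0 < 1 + √2 := by positivity
  field_simp
  ring

theorem pCritical_pos : 0 < pCritical := by
  rw [pCritical]
  positivity

theorem one_sub_pCritical_pos : 0 < 1 - pCritical := by
  have h := pCritical_eq
  have h' := pCritical_pos
  by_contra! h''
  have := mul_nonpos_of_nonneg_of_nonpos (Real.sqrt_nonneg 2) h''
  linarith

variable (D : DobrushinDomain)

theorem weight_pos (ω : Finset (Sym2 Site)) : 0 < D.weight ω := by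
  have := pCritical_pos
  have := one_sub_pCritical_pos
  rw [weight]
  positivity

theorem partitionFunction_pos : 0 < D.partitionFunction :=
  Finset.sum_pos (fun ω _ => D.weight_pos ω) ⟨∅, by simp⟩

theorem sum_prob : ∑ ω ∈ D.edges.powerset, D.prob ω = 1 := by
  simp only [prob, ← Finset.sum_div]
  exact div_self D.partitionFunction_pos.ne'

variable {D} {ω : Finset (Sym2 Site)}

theorem clusterGraph_adj {x y : {x : Site // x ∈ D.sites}} :
    (D.clusterGraph ω).Adj x y ↔
      x ≠ y ∧ (s(x.1, y.1) ∈ ω ∨ (x.1 ∈ D.wiredSites ∧ y.1 ∈ D.wiredSites)) := by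
  rw [clusterGraph, SimpleGraph.fromRel_adj, Sym2.eq_swap (a := y.1)]
  tauto

section Insert

variable {x : Site} {d : Fin 4} (hx : x ∈ D.sites) (hy : x + dir d ∈ D.sites)

theorem weight_insert_aux (hv : edgeAt x d ∈ D.edges) (hvω : edgeAt x d ∉ ω) (k : ℕ) :
    pCritical ^ (insert (edgeAt x d) ω).card *
      (1 - pCritical) ^ (D.edges \ insert (edgeAt x d) ω).card * 2 ^ k =
        √2 * (pCritical ^ ω.card * (1 - pCritical) ^ (D.edges \ ω).card * 2 ^ k) := by
  have h1 : (insert (edgeAt x d) ω).card = ω.card + 1 := Finset.card_insert_of_notMem hvω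
  have h2 : (D.edges \ ω).card = (D.edges \ insert (edgeAt x d) ω).card + 1 := by
    rw [← Finset.card_insert_of_notMem (a := edgeAt x d) (s := D.edges \ insert (edgeAt x d) ω)
      (by simp)]
    congr 1
    ext u
    simp only [Finset.mem_sdiff, Finset.mem_insert]
    by_cases hu : u = edgeAt x d
    · simp [hu, hv, hvω]
    · simp [hu]
  rw [h1, h2, pow_succ, pow_succ (1 - pCritical)]
  nth_rw 2 [pCritical_eq]
  ring

theorem clusterGraph_mono {ω' : Finset (Sym2 Site)} (h : ω ⊆ ω') :
    D.clusterGraph ω ≤ D.clusterGraph ω' := by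
  intro u v huv
  rw [clusterGraph_adj] at huv ⊢
  exact ⟨huv.1, huv.2.imp_left (@h _)⟩

theorem clusterGraph_insert_adj (u v : {x : Site // x ∈ D.sites})
    (h : (D.clusterGraph (insert (edgeAt x d) ω)).Adj u v) :
    (D.clusterGraph ω).Adj u v ∨
      s(u, v) = s((⟨x, hx⟩ : {x : Site // x ∈ D.sites}), ⟨x + dir d, hy⟩) := by
  rw [clusterGraph_adj, Finset.mem_insert, edgeAt] at h
  rw [clusterGraph_adj]
  rcases h with ⟨hne, (h | h) | h⟩
  · right
    rw [Sym2.eq_iff] at h ⊢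
    simpa [Subtype.ext_iff] using h
  · exact .inl ⟨hne, .inl h⟩
  · exact .inl ⟨hne, .inr h⟩

theorem weight_insert_of_reachable (hv : edgeAt x d ∈ D.edges) (hvω : edgeAt x d ∉ ω)
    (h : (D.clusterGraph ω).Reachable ⟨x, hx⟩ ⟨x + dir d, hy⟩) :
    D.weight (insert (edgeAt x d) ω) = √2 * D.weight ω := by
  rw [weight, clusterCount, SimpleGraph.card_connectedComponent_of_reachable
    (clusterGraph_mono (Finset.subset_insert _ _)) (clusterGraph_insert_adj hx hy) h,
    weight_insert_aux hv hvω]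
  rfl

theorem weight_of_not_reachable (hv : edgeAt x d ∈ D.edges) (hvω : edgeAt x d ∉ ω)
    (h : ¬(D.clusterGraph ω).Reachable ⟨x, hx⟩ ⟨x + dir d, hy⟩) :
    D.weight ω = √2 * D.weight (insert (edgeAt x d) ω) := by
  have hadj : (D.clusterGraph (insert (edgeAt x d) ω)).Adj ⟨x, hx⟩ ⟨x + dir d, hy⟩ := by
    rw [clusterGraph_adj]
    refine ⟨fun h => dir_ne_zero d ?_, .inl (Finset.mem_insert_self _ _)⟩
    simpa [Subtype.ext_iff] using h
  have h2 : √2 * √2 = 2 := Real.mul_self_sqrt (by norm_num)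
  rw [weight, weight, clusterCount, SimpleGraph.card_connectedComponent_of_not_reachable
    (clusterGraph_mono (Finset.subset_insert _ _)) (clusterGraph_insert_adj hx hy) hadj.reachable h,
    weight_insert_aux hv hvω, pow_succ]
  rw [clusterCount]
  linear_combination (-(pCritical ^ ω.card * (1 - pCritical) ^ (D.edges \ ω).card *
    2 ^ Nat.card (D.clusterGraph (insert (edgeAt x d) ω)).ConnectedComponent)) * h2

end Insert

/-- The black faces along the interface through `e_a` are connected to `a`. -/
theorem reachable_of_mem_orbit (hω : ω ⊆ D.edges) {e : MedialEdge}
    (he : e ∈ orbit (D.barrier ω) D.startEdge) (hx : e.1 ∈ D.sites) :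
    (D.clusterGraph ω).Reachable ⟨D.vertex 0, D.vertex_mem_sites D.len_pos⟩ ⟨e.1, hx⟩ := by
  obtain ⟨j, rfl⟩ := he
  induction j with
  | zero => exact SimpleGraph.Reachable.refl _
  | succ j ih =>
    have hs : D.startEdge.1 ∈ D.sites := D.vertex_mem_sites D.len_pos
    have h1 := iterate_mem_sites hω hs j
    refine (ih h1).trans ?_
    clear ih
    revert hx h1
    rw [iterate_succ_apply']
    generalize (medialPerm (D.barrier ω))^[j] D.startEdge = e
    intro h2 h1
    obtain ⟨x, d⟩ := e
    have hd : d = d + 1 - 1 := by simp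
    by_cases hv : edgeAt x (d + 1) ∈ D.barrier ω
    · apply SimpleGraph.Adj.reachable
      rw [clusterGraph_adj]
      have e1 : (medialPerm (D.barrier ω) (x, d)).1 = x + dir (d + 1) := by
        rw [hd, medialPerm_of_mem hv]
        simp
      constructor
      · intro h
        rw [Subtype.ext_iff] at h
        simp only [e1] at h
        exact dir_ne_zero (d + 1) (by simpa using h)
      · simp only [e1]
        rcases Finset.mem_union.1 (Finset.mem_coe.1 hv) with h | h
        · exact .inl h
        · exact .inr (D.wiredEdge_ends h)
    · have e1 : (medialPerm (D.barrier ω) (x, d)).1 = x := by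
        rw [hd, medialPerm_of_notMem hv]
      have : (⟨x, h1⟩ : {x // x ∈ D.sites}) = ⟨_, h2⟩ := Subtype.ext e1.symm
      rw [← this]

/-- If only one of the two strands along a closed edge belongs to the interface through `e_a`, then
the ends of this edge are not connected. -/
theorem not_reachable_of_orbit (hω : ω ⊆ D.edges) {x : Site} {d : Fin 4} (hx : x ∈ D.sites)
    (hy : x + dir d ∈ D.sites) (hv : edgeAt x d ∉ D.barrier ω)
    (h : ¬(((x, d - 1) : MedialEdge) ∈ orbit (D.barrier ω) D.startEdge ↔
      ((x + dir d, d + 1) : MedialEdge) ∈ orbit (D.barrier ω) D.startEdge)) :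
    ¬(D.clusterGraph ω).Reachable ⟨x, hx⟩ ⟨x + dir d, hy⟩ := by
  classical
  set T := orbit (D.barrier ω) D.startEdge
  have hinv : ∀ e, medialPerm (D.barrier ω) e ∈ T ↔ e ∈ T :=
    medialPerm_mem_orbit_iff (startEdge_periodic hω)
  obtain ⟨Jb, Jw, hJ⟩ := exists_height hinv
  have hopen : ∀ {x d}, edgeAt x d ∈ D.barrier ω → Jb x = Jb (x + dir d) :=
    fun h => height_eq_of_open hinv hJ h
  have hwired : ∀ k, D.mid ≤ k → k ≤ D.len → Jb (D.vertex k) = Jb (D.vertex D.mid) := by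
    intro k hk hk'
    induction k, hk using Nat.le_induction with
    | base => rfl
    | succ k hk ih =>
      rw [← ih (by omega), D.vertex_succ k hk']
      exact (hopen (Finset.mem_coe.2 (Finset.mem_union_right _
        (D.step_edge_mem_wiredEdges hk hk')))).symm
  intro hr
  have key : Jb x = Jb (x + dir d) := by
    refine hr.eq_of_forall_adj (f := fun z : {x // x ∈ D.sites} => Jb z.1) fun u v huv => ?_
    rw [clusterGraph_adj] at huv
    rcases huv.2 with huv | ⟨hu, hv⟩
    · obtain ⟨z, c, hz⟩ := D.exists_edgeAt (hω huv)
      have hzc : Jb z = Jb (z + dir c) :=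
        hopen (Finset.mem_coe.2 (Finset.mem_union_left _ (hz ▸ huv)))
      rw [edgeAt, Sym2.eq_iff] at hz
      rcases hz with ⟨h1, h2⟩ | ⟨h1, h2⟩
      · rw [h1, h2, hzc]
      · rw [h1, h2, hzc]
    · obtain ⟨k, h1, h2, h3⟩ := D.mem_wiredSites.1 hu
      obtain ⟨l, h4, h5, h6⟩ := D.mem_wiredSites.1 hv
      rw [← h3, ← h6, hwired k h1 h2, hwired l h4 h5]
  refine h ?_
  have h1 := hJ x d
  have h2 := hJ (x + dir d) (d + 1)
  rw [faceAt_left] at h2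
  have h3 := hinv (x, d - 1)
  rw [medialPerm_of_notMem hv] at h3
  rw [← h3]
  simp only [Set.indicator_apply, Pi.one_apply] at h1 h2
  split_ifs at h1 h2 with a b
  · exact iff_of_true a b
  · omega
  · omega
  · rename_i b
    exact iff_of_false a b

end DobrushinDomain

end FKIsing

namespace FKIsing

open Equiv Equiv.Perm Function

namespace DobrushinDomain

variable {D : DobrushinDomain}

/-! ### Relations between the values of the observable -/

theorem F_eq {e : MedialEdge} (he : D.Regular e) :
    D.F e = ∑ ω ∈ D.edges.powerset,
      (D.prob ω : ℂ) * firstPhase (D.barrier ω) D.startEdge e := by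
  refine Finset.sum_congr rfl fun ω hω => ?_
  rw [windingPhase_eq (Finset.mem_powerset.1 hω) he]

theorem F_startEdge : D.F D.startEdge = 1 := by
  rw [F_eq (.inr (.inl rfl))]
  simp only [firstPhase_self, mul_one]
  rw [← Complex.ofReal_sum, D.sum_prob, Complex.ofReal_one]

theorem F_eq_zero {e : MedialEdge} (he : e.1 ∉ D.sites) : D.F e = 0 := by
  refine Finset.sum_eq_zero fun ω hω => ?_
  rw [windingPhase, dif_neg, mul_zero]
  rintro ⟨k, hk, -⟩
  rw [interface_eq] at hk
  exact he (hk ▸ iterate_mem_sites (Finset.mem_powerset.1 hω) (D.vertex_mem_sites D.len_pos) k)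

/-- A turn that all interfaces make. -/
theorem F_step {e e' : MedialEdge} {t : ℂ} (he : D.Regular e) (he' : D.Regular e')
    (hne : e' ≠ D.startEdge)
    (h : ∀ ω ⊆ D.edges, medialPerm (D.barrier ω) e = e' ∧ turn (D.barrier ω) e = t) :
    D.F e' = t * D.F e := by
  rw [F_eq he, F_eq he', Finset.mul_sum]
  refine Finset.sum_congr rfl fun ω hω => ?_
  rw [Finset.mem_powerset] at hω
  obtain ⟨h1, h2⟩ := h ω hω
  rw [← h1, firstPhase_step (startEdge_periodic hω) (h1 ▸ hne), h2]
  ring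

/-- An edge outside the domain is never open, so every interface turns left there and the phase
factor can be taken out of the expectation. -/
theorem F_of_notMem_edges {x : Site} {d : Fin 4} (hv : edgeAt x d ∉ D.edges)
    (hx : x ∉ D.wiredSites) : D.F (x, d) = leftPhase * D.F (x, d - 1) := by
  refine F_step (D.regular_of_notMem_wiredSites hx) (D.regular_of_notMem_wiredSites hx) ?_
    fun ω hω => ⟨medialPerm_of_notMem ?_, turn_of_notMem ?_⟩
  · rintro h
    have h' : x = D.vertex 0 := congrArg Prod.fst h
    exact hx (h' ▸ D.vertex_zero_mem_wiredSites)
  · exact fun h => hv (barrier_subset hω h)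
  · exact fun h => hv (barrier_subset hω h)

/-- On the inner side of a wired edge every interface is forced to turn right. -/
theorem F_of_wiredEdge {x : Site} {d : Fin 4} (hv : edgeAt x d ∈ D.wiredEdges)
    (hf : faceAt x d ∈ D.faces) : D.F (x, d) = leftPhase⁻¹ * D.F (x + dir d, d + 1) := by
  have hb : ∀ ω, edgeAt x d ∈ D.barrier ω := fun ω =>
    Finset.mem_coe.2 (Finset.mem_union_right _ hv)
  refine F_step (D.regular_of_mem_faces (by rwa [faceAt_left])) (D.regular_of_mem_faces hf) ?_
    fun ω hω => ⟨medialPerm_flip_of_mem (hb ω), turn_flip_of_mem (hb ω)⟩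
  intro h
  have := D.startEdge_mem_Outer.2
  rw [← h] at this
  exact this hf

/-- The sign by which the phase of the interface through `e_a` changes from the first visit of `e` to
the return to `e`, for `e = e_a`. -/
noncomputable def startSign (D : DobrushinDomain) (e : MedialEdge) : ℂ :=
  if e = D.startEdge then -1 else 1

theorem startSign_mul_firstPhase {ω : Finset (Sym2 Site)} (hω : ω ⊆ D.edges) {e e' : MedialEdge}
    (h : medialPerm (D.barrier ω) e = e') :
    D.startSign e' * firstPhase (D.barrier ω) D.startEdge e' =
      firstPhase (D.barrier ω) D.startEdge e * turn (D.barrier ω) e := by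
  subst h
  rw [startSign]
  split_ifs with hs
  · rw [firstPhase_step_start (startEdge_periodic hω) hs, hs, firstPhase_self, mul_one]
  · rw [firstPhase_step (startEdge_periodic hω) hs, one_mul]

/-- The strong form of discrete holomorphicity: the values of the observable at the two medial edges
that arrive at a medial vertex determine its values at the two that leave it. -/
theorem F_relation {x : Site} {d : Fin 4} (hv : edgeAt x d ∈ D.edges)
    (hw : edgeAt x d ∉ D.wiredEdges) :
    √2 * (D.startSign (x, d) * D.F (x, d)) =
      leftPhase * (D.F (x, d - 1) + Complex.I * D.F (x + dir d, d + 1)) := by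
  obtain ⟨rA, rB, rC, -⟩ := D.regular_of_edge hv hw
  rw [F_eq rA, F_eq rB, F_eq rC]
  -- The sum is split into pairs of configurations that differ only at this edge; the relation holds
  -- for each pair separately.
  rw [← Finset.insert_erase hv]
  have hnot : edgeAt x d ∉ D.edges.erase (edgeAt x d) := Finset.notMem_erase _ _
  simp only [Finset.sum_powerset_insert hnot, ← Finset.sum_add_distrib, Finset.mul_sum]
  refine Finset.sum_congr rfl fun ω hω => ?_
  have hω := Finset.mem_powerset.1 hω
  have hvω : edgeAt x d ∉ ω := fun h => hnot (hω h)
  have hωe : ω ⊆ D.edges := hω.trans (Finset.erase_subset _ _)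
  have hωe' : insert (edgeAt x d) ω ⊆ D.edges := Finset.insert_subset hv hωe
  have hb : edgeAt x d ∉ D.barrier ω := fun h => by
    rcases Finset.mem_union.1 (Finset.mem_coe.1 h) with h | h
    · exact hvω h
    · exact hw h
  have hins : D.barrier (insert (edgeAt x d) ω) = insert (edgeAt x d) (D.barrier ω) := by
    rw [barrier, barrier, Finset.insert_union, Finset.coe_insert]
  have hb' : edgeAt x d ∈ D.barrier (insert (edgeAt x d) ω) := hins ▸ Set.mem_insert _ _
  have hx := D.mem_sites_of_edge hv
  have hy := D.mem_sites_of_edge' hv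
  have e1 := startSign_mul_firstPhase hωe (medialPerm_of_notMem hb)
  have e2 := startSign_mul_firstPhase hωe' (medialPerm_flip_of_mem hb')
  rw [turn_of_notMem hb] at e1
  rw [turn_flip_of_mem hb'] at e2
  have hrel := (opening_insert hb).phase_relation (startEdge_periodic hωe)
    (mem_periodicPts_of_mem_sites hωe hx) (mem_periodicPts_of_mem_sites hωe hy)
    (w := D.prob ω) (w' := D.prob (insert (edgeAt x d) ω))
    (fun hA hC => by
      rw [prob, prob, weight_insert_of_reachable hx hy hv hvω, mul_div_assoc]
      -- Both ends are connected to `a`, so opening the edge does not change the number of clusters;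
      -- when only one strand is on the interface, two clusters merge.
      exact (reachable_of_mem_orbit hωe hA hx).symm.trans (reachable_of_mem_orbit hωe hC hy))
    (fun hA hC => by
      rw [prob, prob, weight_of_not_reachable hx hy hv hvω, mul_div_assoc]
      exact not_reachable_of_orbit hωe hx hy hb fun h => hC (h.1 hA))
    (fun hA hC => by
      rw [prob, prob, weight_of_not_reachable hx hy hv hvω, mul_div_assoc]
      exact not_reachable_of_orbit hωe hx hy hb fun h => hA (h.2 hC))
  rw [← hins, ← e1, ← e2] at hrel
  linear_combination hrel

theorem norm_leftPhase : ‖leftPhase‖ = 1 := by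
  rw [leftPhase, show (-(Real.pi / 4) * Complex.I : ℂ) = ((-(Real.pi / 4) : ℝ) : ℂ) * Complex.I by
    push_cast; ring, Complex.norm_exp_ofReal_mul_I]

theorem normSq_leftPhase : Complex.normSq leftPhase = 1 := by
  rw [Complex.normSq_eq_norm_sq, norm_leftPhase, one_pow]

theorem normSq_startSign (e : MedialEdge) : Complex.normSq (D.startSign e) = 1 := by
  rw [startSign]
  split_ifs <;> simp

theorem normSq_F_relation {x : Site} {d : Fin 4} (hv : edgeAt x d ∈ D.edges)
    (hw : edgeAt x d ∉ D.wiredEdges) :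
    2 * Complex.normSq (D.F (x, d)) =
      Complex.normSq (D.F (x, d - 1) + Complex.I * D.F (x + dir d, d + 1)) := by
  have := congrArg Complex.normSq (F_relation hv hw)
  rw [Complex.normSq_mul, Complex.normSq_mul, Complex.normSq_mul, normSq_leftPhase,
    normSq_startSign, Complex.normSq_ofReal, Real.mul_self_sqrt (by norm_num)] at this
  linarith

/-- The squared modulus of the observable is a closed form. -/
theorem normSq_F_closed {x : Site} {d : Fin 4} (hv : edgeAt x d ∈ D.edges)
    (hw : edgeAt x d ∉ D.wiredEdges) :
    Complex.normSq (D.F (x, d - 1)) - Complex.normSq (D.F (x, d)) =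
      Complex.normSq (D.F (x + dir d, d + 2)) - Complex.normSq (D.F (x + dir d, d + 1)) := by
  have h1 := normSq_F_relation hv hw
  rw [← edgeAt_flip] at hv hw
  have h2 := normSq_F_relation hv hw
  rw [add_dir_add_dir, show d + 2 - 1 = d + 1 by grind, show d + 2 + 1 = d - 1 by grind] at h2
  generalize D.F (x, d - 1) = a at *
  generalize D.F (x + dir d, d + 1) = c at *
  -- The parallelogram identity, applied to the two relations obtained from the two ends of the
  -- edge.
  have : Complex.normSq (a + Complex.I * c) + Complex.normSq (c + Complex.I * a) =
      2 * Complex.normSq a + 2 * Complex.normSq c := by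
    simp [Complex.normSq_apply]
    ring
  linarith

/-- A turn changes the power of the left phase along with the direction; the two wrap-arounds modulo
four cost only a sign, since the fourth power is -1. -/
theorem turn_mul_leftPhase_pow (O : Set (Sym2 Site)) (e : MedialEdge) :
    ∃ r : ℝ, turn O e * leftPhase ^ e.2.val = r * leftPhase ^ (medialPerm O e).2.val := by
  have h0 := leftPhase_ne_zero
  have h4 := leftPhase_pow_four
  obtain ⟨x, d⟩ := e
  by_cases h : edgeAt x (d + 1) ∈ O
  · simp only [turn, h, if_true, medialPerm, coe_fn_mk]
    rcases eq_or_ne d 0 with rfl | hd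
    · refine ⟨-1, ?_⟩
      rw [show ((0 : Fin 4) - 1).val = 3 from rfl, show (0 : Fin 4).val = 0 from rfl]
      field_simp
      rw [h4]
      norm_num
    · refine ⟨1, ?_⟩
      have : d.val = (d - 1).val + 1 := by fin_cases d <;> simp at hd ⊢
      rw [this, pow_succ]
      field_simp
      norm_num
  · simp only [turn, h, if_false, medialPerm, coe_fn_mk]
    rcases eq_or_ne d 3 with rfl | hd
    · refine ⟨-1, ?_⟩
      rw [show ((3 : Fin 4) + 1).val = 0 from rfl, show (3 : Fin 4).val = 3 from rfl, ← pow_succ', h4]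
      norm_num
    · refine ⟨1, ?_⟩
      have : (d + 1).val = d.val + 1 := by fin_cases d <;> simp at hd ⊢
      rw [this, pow_succ]
      push_cast
      ring

/-- The direction of a medial edge determines the observable up to a real factor. -/
theorem exists_F_eq_real_mul (D : DobrushinDomain) : ∃ t : MedialEdge → ℝ, ∀ e,
    D.F e * leftPhase ^ D.startEdge.2.val = t e * leftPhase ^ e.2.val := by
  have key : ∀ ω k, ∃ r : ℝ, (∏ j ∈ Finset.range k, turn (D.barrier ω)
      ((medialPerm (D.barrier ω))^[j] D.startEdge)) * leftPhase ^ D.startEdge.2.val =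
        r * leftPhase ^ ((medialPerm (D.barrier ω))^[k] D.startEdge).2.val := by
    intro ω k
    induction k with
    | zero => exact ⟨1, by simp⟩
    | succ k ih =>
      obtain ⟨r, hr⟩ := ih
      obtain ⟨r', hr'⟩ := turn_mul_leftPhase_pow (D.barrier ω)
        ((medialPerm (D.barrier ω))^[k] D.startEdge)
      refine ⟨r * r', ?_⟩
      rw [Finset.prod_range_succ, mul_right_comm, hr, iterate_succ_apply', mul_right_comm, mul_assoc,
        hr']
      push_cast
      ring
  have key' : ∀ ω e, ∃ r : ℝ, D.windingPhase ω e * leftPhase ^ D.startEdge.2.val =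
      r * leftPhase ^ e.2.val := by
    classical
    intro ω e
    rw [windingPhase]
    split_ifs with h
    · obtain ⟨r, hr⟩ := key ω (Nat.find h)
      refine ⟨r, ?_⟩
      rw [exp_winding, hr, ← interface_eq, (Nat.find_spec h).1]
    · exact ⟨0, by simp⟩
  choose r hr using key'
  refine ⟨fun e => ∑ ω ∈ D.edges.powerset, D.prob ω * r ω e, fun e => ?_⟩
  rw [F, Finset.sum_mul, Complex.ofReal_sum, Finset.sum_mul]
  refine Finset.sum_congr rfl fun ω _ => ?_
  rw [mul_assoc, hr]
  push_cast
  ring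

end DobrushinDomain

end FKIsing

namespace FKIsing

open Equiv Equiv.Perm Function

namespace DobrushinDomain

variable {D : DobrushinDomain}

/-! ### The increments of the potential -/

open Classical in
/-- The squared modulus of the observable, with the value `1` on the outer side of the wired arc. -/
noncomputable def increment (D : DobrushinDomain) (e : MedialEdge) : ℝ :=
  if e ∈ D.Outer then 1 else Complex.normSq (D.F e)

theorem increment_of_mem {e : MedialEdge} (h : e ∈ D.Outer) : D.increment e = 1 := if_pos h

theorem increment_of_notMem {e : MedialEdge} (h : e ∉ D.Outer) :
    D.increment e = Complex.normSq (D.F e) := if_neg h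

theorem increment_of_mem_faces {x : Site} {d : Fin 4} (h : faceAt x d ∈ D.faces) :
    D.increment (x, d) = Complex.normSq (D.F (x, d)) := increment_of_notMem fun h' => h'.2 h

theorem increment_of_notMem_wiredSites {x : Site} {d : Fin 4} (h : x ∉ D.wiredSites) :
    D.increment (x, d) = Complex.normSq (D.F (x, d)) := increment_of_notMem fun h' => h h'.1

theorem increment_eq_zero {e : MedialEdge} (h : e.1 ∉ D.sites) : D.increment e = 0 := by
  rw [increment_of_notMem fun h' => h (D.wiredSites_subset h'.1), F_eq_zero h, map_zero]

theorem normSq_F_startEdge : Complex.normSq (D.F D.startEdge) = 1 := by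
  rw [F_startEdge, map_one]

theorem increment_of_regular {e : MedialEdge} (h : D.Regular e) (hne : e ≠ D.endEdge) :
    D.increment e = Complex.normSq (D.F e) := by
  rcases h with h | rfl | h
  · exact increment_of_notMem h
  · rw [increment_of_mem D.startEdge_mem_Outer, normSq_F_startEdge]
  · exact absurd h hne

/-- The other endpoint of an oriented edge, with the opposite direction. -/
def reversal : Perm (Site × Fin 4) :=
  Function.Involutive.toPerm (fun e => (e.1 + dir e.2, e.2 + 2)) fun e => by
    refine Prod.ext (add_dir_add_dir _ _) ?_
    simp only
    grind

/-- At a wired site both medial edges are outer and carry the value 1; at any other site the forced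
left turn changes only the phase. -/
theorem increment_of_notMem_edges {x : Site} {d : Fin 4} (h : edgeAt x d ∉ D.edges) :
    D.increment (x, d - 1) = D.increment (x, d) := by
  by_cases hx : x ∈ D.wiredSites
  · rw [D.mem_edges_iff, not_or] at h
    rw [increment_of_mem ⟨hx, h.2⟩, increment_of_mem ⟨hx, h.1⟩]
  · rw [increment_of_notMem_wiredSites hx, increment_of_notMem_wiredSites hx,
      F_of_notMem_edges h hx, Complex.normSq_mul, normSq_leftPhase, one_mul]

theorem normSq_F_of_wiredEdge {x : Site} {d : Fin 4} (hv : edgeAt x d ∈ D.wiredEdges)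
    (hf : faceAt x d ∈ D.faces) :
    Complex.normSq (D.F (x, d)) = Complex.normSq (D.F (x + dir d, d + 1)) := by
  rw [F_of_wiredEdge hv hf, Complex.normSq_mul, Complex.normSq_inv, normSq_leftPhase, inv_one,
    one_mul]

/-- The function `increment` is closed at the midpoint of every edge outside the free arc and the
interior of the domain. -/
theorem increment_closed_of_wired_or_outside {x : Site} {d : Fin 4}
    (h : edgeAt x d ∈ D.wiredEdges ∨ edgeAt x d ∉ D.edges) :
    D.increment (x, d - 1) - D.increment (x, d) =
      D.increment (x + dir d, d + 2) - D.increment (x + dir d, d + 1) := by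
  rcases h with h | h
  · have main : ∀ {x d}, edgeAt x d ∈ D.wiredEdges → faceAt x d ∈ D.faces →
        D.increment (x, d - 1) = 1 ∧ D.increment (x + dir d, d + 2) = 1 ∧
          D.increment (x, d) = D.increment (x + dir d, d + 1) := by
      intro x d h hf
      have hr := D.wiredEdge_right_notMem h hf
      obtain ⟨hx, hy⟩ := D.wiredEdge_ends h
      refine ⟨increment_of_mem ⟨hx, hr⟩, increment_of_mem ⟨hy, by rwa [faceAt_right]⟩, ?_⟩
      rw [increment_of_mem_faces hf, increment_of_mem_faces (by rwa [faceAt_left]),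
        normSq_F_of_wiredEdge h hf]
    rcases D.mem_edges_iff.1 (D.wiredEdges_subset h) with hf | hf
    · obtain ⟨h1, h2, h3⟩ := main h hf
      rw [h1, h2, h3]
    · rw [← edgeAt_flip] at h
      rw [← faceAt_right] at hf
      obtain ⟨h1, h2, h3⟩ := main h hf
      rw [add_dir_add_dir, show d + 2 - 1 = d + 1 by grind, show d + 2 + 1 = d - 1 by grind,
        show d + 2 + 2 = d by grind] at *
      rw [h1, h2, h3]
  · rw [increment_of_notMem_edges h]
    rw [← edgeAt_flip] at h
    have := increment_of_notMem_edges h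
    rw [show d + 2 - 1 = d + 1 by grind] at this
    rw [this, sub_self, sub_self]

theorem freeStep_notMem_wiredEdges {k : ℕ} (hk : k < D.mid) :
    edgeAt (D.vertex k) (D.step k) ∉ D.wiredEdges := by
  intro h
  have hlen := hk.trans_le D.mid_le
  obtain ⟨j, h1, h2, h3, -⟩ := D.vertex_index_of_wiredEdge h (D.left_mem k hlen)
  have := D.selfAvoiding j h2 k hlen h3
  omega

theorem edgeAt_endEdge : edgeAt D.endEdge.1 D.endEdge.2 =
    edgeAt (D.vertex (D.mid - 1)) (D.step (D.mid - 1)) := by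
  rw [endEdge, D.vertex_mid, edgeAt_flip]

/-- The differences telescope cyclically around each site. -/
theorem sum_finsum_sub_eq_zero (w : MedialEdge → ℝ) (S : Finset Site)
    (hw : ∀ e, e.1 ∉ S → w e = 0) : ∑ᶠ e : MedialEdge, (w (e.1, e.2 - 1) - w e) = 0 := by
  rw [finsum_eq_sum_of_support_subset (s := S ×ˢ (Finset.univ : Finset (Fin 4)))]
  · rw [Finset.sum_product]
    refine Finset.sum_eq_zero fun x _ => ?_
    rw [Finset.sum_sub_distrib, sub_eq_zero]
    exact Equiv.sum_comp (Equiv.subRight (1 : Fin 4)) fun d => w (x, d)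
  · intro e he
    by_contra h
    have h' : e.1 ∉ S := by simpa using h
    refine he ?_
    simp only
    rw [hw e h', hw (e.1, e.2 - 1) h', sub_zero]

/-- A conservation law replaces a topological argument about the arrival at `e_b`. The form
`increment` is closed at every edge except possibly the last free one, where its defect is governed
by 1 - |F(e_b)|^2; the total defect is zero. -/
theorem normSq_F_endEdge : Complex.normSq (D.F D.endEdge) = 1 := by
  classical
  by_cases hse : D.endEdge = D.startEdge
  · rw [hse, normSq_F_startEdge]
  set κ := Complex.normSq (D.F D.endEdge) with hκ
  set g : MedialEdge → ℝ := fun e => if e = D.endEdge then 1 - κ else 0 with hg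
  have hreg : ∀ {e}, D.Regular e → D.increment e = Complex.normSq (D.F e) + g e := by
    intro e he
    by_cases h : e = D.endEdge
    · rw [h, increment_of_mem D.endEdge_mem_Outer, hg]
      simp [hκ]
    · simp [hg, h, increment_of_regular he h]
  have hlast : D.mid - 1 < D.mid := Nat.sub_lt D.mid_pos one_pos
  have hlast' := hlast.trans_le D.mid_le
  have hwired := freeStep_notMem_wiredEdges hlast
  rw [← edgeAt_endEdge] at hwired
  have hedge : edgeAt D.endEdge.1 D.endEdge.2 ∈ D.edges := by
    rw [edgeAt_endEdge]
    exact D.mem_edges_iff.2 (.inl (D.left_mem _ hlast'))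
  -- At an edge of the domain off the wired arc, `e_b` can occur only among the outgoing medial
  -- edges: as an incoming one it would have to be `e_a`.
  have hA : ∀ {x d}, edgeAt x d ∈ D.edges → edgeAt x d ∉ D.wiredEdges → g (x, d - 1) = 0 := by
    intro x d hv hw
    refine if_neg fun h => ?_
    have hout : faceAt x (d - 1) ∉ D.faces := by
      have := D.endEdge_mem_Outer.2
      rwa [← h] at this
    obtain ⟨k, hk, hkx, hkd⟩ := D.exists_step ((D.mem_edges_iff.1 hv).resolve_right hout) hout
    have hkm : k < D.mid := by
      by_contra! h'
      exact hw (hkx ▸ hkd ▸ D.step_edge_mem_wiredEdges h' hk)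
    rcases Nat.eq_zero_or_pos k with rfl | h0
    · refine hse ?_
      rw [← h, startEdge, hkx, hkd]
    · refine D.vertex_notMem_wiredSites h0 hkm ?_
      have : x = D.endEdge.1 := congrArg Prod.fst h
      rw [hkx, this]
      exact D.endEdge_mem_Outer.1
  have hdef : ∀ e : MedialEdge, (D.increment (e.1, e.2 - 1) - D.increment e) +
      (D.increment ((reversal e).1, (reversal e).2 - 1) - D.increment (reversal e)) =
        -(g e + g (reversal e)) := by
    rintro ⟨x, d⟩
    have hr : reversal (x, d) = (x + dir d, d + 2) := rfl
    rw [hr]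
    simp only
    rw [show d + 2 - 1 = d + 1 by grind]
    by_cases h : edgeAt x d ∈ D.wiredEdges ∨ edgeAt x d ∉ D.edges
    · have h1 : ∀ {y c}, edgeAt y c = edgeAt x d → g (y, c) = 0 := by
        intro y c hyc
        refine if_neg fun h' => ?_
        rw [← hyc] at h
        have : edgeAt D.endEdge.1 D.endEdge.2 = edgeAt y c := by rw [← h']
        rw [← this] at h
        exact h.elim hwired fun h => h hedge
      rw [h1 rfl, h1 (edgeAt_flip x d)]
      linear_combination increment_closed_of_wired_or_outside h
    · push Not at h
      obtain ⟨rA, rB, rC, rD⟩ := D.regular_of_edge h.2 h.1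
      rw [hreg rA, hreg rB, hreg rC, hreg rD, hA h.2 h.1]
      have hC : g (x + dir d, d + 1) = 0 := by
        rw [← edgeAt_flip] at h
        have := hA h.2 h.1
        rwa [show d + 2 - 1 = d + 1 by grind] at this
      rw [hC]
      linear_combination normSq_F_closed h.2 h.1
  set δ : MedialEdge → ℝ := fun e => D.increment (e.1, e.2 - 1) - D.increment e with hδ
  have hδ0 : ∑ᶠ e, δ e = 0 := sum_finsum_sub_eq_zero D.increment D.sites
    fun e he => increment_eq_zero he
  have hδfin : (support δ).Finite := by
    refine (D.sites ×ˢ (Finset.univ : Finset (Fin 4))).finite_toSet.subset ?_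
    intro e he
    by_contra h
    have h' : e.1 ∉ D.sites := by simpa using h
    refine he ?_
    simp only [hδ]
    rw [increment_eq_zero (e := e) h', increment_eq_zero (e := (e.1, e.2 - 1)) h', sub_zero]
  have hgsum : ∑ᶠ e, g e = 1 - κ := by
    rw [finsum_eq_single _ D.endEdge fun e he => if_neg he]
    exact if_pos rfl
  have hgfin : (support g).Finite :=
    (Set.finite_singleton D.endEdge).subset fun e he => by
      by_contra h
      exact he (if_neg h)
  have comp_fin : ∀ f : MedialEdge → ℝ, (support f).Finite →
      (support fun e => f (reversal e)).Finite := fun f hf =>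
    (hf.preimage reversal.injective.injOn)
  -- Summation over oriented edges counts every defect twice, while both sums of `δ` vanish.
  have hsum : ∑ᶠ e, (δ e + δ (reversal e)) = -∑ᶠ e, (g e + g (reversal e)) := by
    rw [← finsum_neg_distrib]
    exact finsum_congr hdef
  rw [finsum_add_distrib hδfin (comp_fin δ hδfin), finsum_add_distrib hgfin (comp_fin g hgfin),
    finsum_comp_equiv reversal, finsum_comp_equiv reversal, hδ0, hgsum] at hsum
  linarith

theorem increment_of_regular' {e : MedialEdge} (h : D.Regular e) :
    D.increment e = Complex.normSq (D.F e) := by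
  by_cases h' : e = D.endEdge
  · rw [h', increment_of_mem D.endEdge_mem_Outer, normSq_F_endEdge]
  · exact increment_of_regular h h'

theorem increment_closed (D : DobrushinDomain) (x : Site) (d : Fin 4) :
    D.increment (x, d - 1) - D.increment (x, d) =
      D.increment (x + dir d, d + 2) - D.increment (x + dir d, d + 1) := by
  by_cases h : edgeAt x d ∈ D.wiredEdges ∨ edgeAt x d ∉ D.edges
  · exact increment_closed_of_wired_or_outside h
  · push Not at h
    obtain ⟨rA, rB, rC, rD⟩ := D.regular_of_edge h.2 h.1
    rw [increment_of_regular' rA, increment_of_regular' rB, increment_of_regular' rC,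
      increment_of_regular' rD, normSq_F_closed h.2 h.1]

/-! ### The potential -/

theorem val_nsmul_one : ∀ c : Fin 4, c.val • (1 : Fin 4) = c := by decide

/-- The faces outside the domain around a site of the polygon are consecutive. -/
theorem eq_of_outside {α : Type*} {k : ℕ} (hk : k < D.len) (g : Fin 4 → α)
    (hg : ∀ c, faceAt (D.vertex k) c ∉ D.faces → faceAt (D.vertex k) (c + 1) ∉ D.faces →
      g c = g (c + 1)) {c : Fin 4} (hc : faceAt (D.vertex k) c ∉ D.faces) :
    g c = g (D.step k - 1) := by
  have key : ∀ j : ℕ, ∀ c : Fin 4, c = D.step k - 1 - j • (1 : Fin 4) →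
      faceAt (D.vertex k) c ∉ D.faces → g c = g (D.step k - 1) := by
    intro j
    induction j with
    | zero => intro c hc _; simp [hc]
    | succ j ih =>
      intro c hcj hc
      have hcj' : c + 1 = D.step k - 1 - j • (1 : Fin 4) := by
        rw [hcj, succ_nsmul]; abel
      by_cases hf : faceAt (D.vertex k) (c + 1) ∈ D.faces
      · obtain ⟨l, hl, hlx, hld⟩ := D.exists_step hf (by simpa using hc)
        obtain rfl := D.selfAvoiding l hl k hk hlx
        rw [hld, add_sub_cancel_right]
      · rw [hg c hc hf, ih _ hcj' hf]
  refine key (D.step k - 1 - c).val c ?_ hc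
  rw [val_nsmul_one]
  abel

theorem increment_outside {k : ℕ} (hk : k < D.len) {c : Fin 4}
    (hc : faceAt (D.vertex k) c ∉ D.faces) :
    D.increment (D.vertex k, c) = D.increment (D.vertex k, D.step k - 1) := by
  refine eq_of_outside hk (fun c => D.increment (D.vertex k, c)) (fun c h h' => ?_) hc
  have : edgeAt (D.vertex k) (c + 1) ∉ D.edges := by
    rw [D.mem_edges_iff, not_or, add_sub_cancel_right]
    exact ⟨h', h⟩
  simpa using increment_of_notMem_edges this

/-- The potential `H` on the black faces and `H'` on the white faces. -/
structure IsPotential (D : DobrushinDomain) (H : Site → ℝ) (H' : Face → ℝ) : Prop where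
  sub_eq : ∀ x d, H x - H' (faceAt x d) = D.increment (x, d)
  wired : ∀ x ∈ D.wiredSites, H x = 1
  free : ∀ f ∈ D.freeWhiteFaces, H' f = 0

theorem exists_isPotential (D : DobrushinDomain) : ∃ H H', D.IsPotential H H' := by
  obtain ⟨H, H', h⟩ := exists_potential D.increment D.increment_closed
  -- The two ends of a wired edge share its inner face and have equal increments towards it, so the
  -- potential is constant on the wired arc. Along the free arc, consecutive white faces share a
  -- site with equal outer increments.
  have hwired : ∀ k, D.mid ≤ k → k ≤ D.len → H (D.vertex k) = H (D.vertex D.mid) := by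
    intro k hk hk'
    induction k, hk using Nat.le_induction with
    | base => rfl
    | succ k hk ih =>
      rw [← ih (by omega), D.vertex_succ k hk']
      have h1 := h (D.vertex k) (D.step k)
      have h2 := h (D.vertex k + dir (D.step k)) (D.step k + 1)
      have hf := D.left_mem k hk'
      rw [increment_of_mem_faces hf] at h1
      rw [faceAt_left, increment_of_mem_faces (by rwa [faceAt_left])] at h2
      have := normSq_F_of_wiredEdge (D.step_edge_mem_wiredEdges hk hk') hf
      linarith
  have hfree : ∀ k < D.mid, H' (faceAt (D.vertex k) (D.step k - 1)) = H (D.vertex 0) - 1 := by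
    intro k hk
    induction k with
    | zero =>
      have := h (D.vertex 0) (D.step 0 - 1)
      rw [increment_of_mem (e := (D.vertex 0, D.step 0 - 1)) D.startEdge_mem_Outer] at this
      linarith
    | succ k ih =>
      have hlen := hk.trans_le D.mid_le
      have hr := faceAt_right (D.vertex k) (D.step k)
      rw [← D.vertex_succ k (by omega)] at hr
      rw [← ih (by omega), ← hr]
      have h1 := h (D.vertex (k + 1)) (D.step (k + 1) - 1)
      have h2 := h (D.vertex (k + 1)) (D.step k + 2)
      have h3 := increment_outside hlen (c := D.step k + 2)
        (hr ▸ D.right_notMem k (by omega))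
      linarith
  -- The two constants differ by the increment 1 at `e_a`, so a single additive shift achieves both
  -- normalisations.
  refine ⟨fun x => H x - H (D.vertex 0) + 1, fun f => H' f - H (D.vertex 0) + 1, ?_, ?_, ?_⟩
  · intro x d
    rw [← h]
    ring
  · intro x hx
    obtain ⟨k, h1, h2, rfl⟩ := D.mem_wiredSites.1 hx
    rw [hwired k h1 h2, ← D.closed, hwired D.len D.mid_le le_rfl]
    ring
  · intro f hf
    obtain ⟨k, hk, rfl⟩ := Finset.mem_image.1 hf
    rw [hfree k (Finset.mem_range.1 hk)]
    ring

/-- Turning around a site that has both an inside and an outside face, one must cross the boundary,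
which is the polygon. -/
theorem exists_index_of_outside {x : Site} (hx : x ∈ D.sites) {c : Fin 4}
    (hc : faceAt x c ∉ D.faces) : ∃ k < D.len, D.vertex k = x := by
  obtain ⟨d, hd⟩ := D.mem_sites_iff.1 hx
  by_contra hno
  have key : ∀ j : ℕ, faceAt x (c + j • (1 : Fin 4)) ∉ D.faces := by
    intro j
    induction j with
    | zero => simpa using hc
    | succ j ih =>
      intro hj
      rw [succ_nsmul, ← add_assoc] at hj
      obtain ⟨k, hk, hkx, -⟩ := D.exists_step hj (by simpa using ih)
      exact hno ⟨k, hk, hkx⟩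
  refine key (d - c).val ?_
  rwa [val_nsmul_one, add_sub_cancel]

namespace IsPotential

variable {H : Site → ℝ} {H' : Face → ℝ}

/-- Across an outer medial edge of the free arc the white value is 0, and all outer medial edges at
the site have the same modulus. -/
theorem eq_normSq_of_outside (hH : D.IsPotential H H') {x : Site} (hx : x ∈ D.sites)
    (hxw : x ∉ D.wiredSites) {c : Fin 4} (hc : faceAt x c ∉ D.faces) :
    H x = Complex.normSq (D.F (x, c)) := by
  obtain ⟨k, hk, rfl⟩ := exists_index_of_outside hx hc
  have hkm : k < D.mid := by
    by_contra! h
    exact hxw (D.vertex_mem_wiredSites h hk.le)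
  have h1 := hH.sub_eq (D.vertex k) (D.step k - 1)
  rw [hH.free _ (Finset.mem_image.2 ⟨k, Finset.mem_range.2 hkm, rfl⟩), ← increment_outside hk hc,
    increment_of_notMem_wiredSites hxw] at h1
  linarith

theorem eq_normSq_of_isFreeArcMedialEdge (hH : D.IsPotential H H') {e : MedialEdge}
    (he : D.IsFreeArcMedialEdge e) : H e.1 = Complex.normSq (D.F e) := by
  rcases he with rfl | rfl | ⟨⟨k, h0, hk, hkx⟩, hf⟩
  · rw [normSq_F_startEdge, hH.wired _ D.startEdge_mem_Outer.1]
  · rw [normSq_F_endEdge, hH.wired _ D.endEdge_mem_Outer.1]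
  · exact hH.eq_normSq_of_outside (hkx ▸ D.vertex_mem_sites (hk.trans_le D.mid_le))
      (hkx ▸ D.vertex_notMem_wiredSites h0 hk) hf

end IsPotential

end DobrushinDomain

end FKIsing

namespace FKIsing

open Equiv Equiv.Perm Function ComplexConjugate

/-! ### Sub- and superharmonicity of the potential -/

theorem conj_leftPhase : conj leftPhase = leftPhase * Complex.I := by
  have h1 : leftPhase * conj leftPhase = 1 := by
    rw [Complex.mul_conj, DobrushinDomain.normSq_leftPhase, Complex.ofReal_one]
  have h2 : leftPhase * (leftPhase * Complex.I) = 1 := by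
    rw [← mul_assoc, ← sq, leftPhase_sq, neg_mul, Complex.I_mul_I, neg_neg]
  exact mul_left_cancel₀ leftPhase_ne_zero (h1.trans h2.symm)

/-- The contribution of one direction to the Laplacian of the potential. -/
noncomputable def turnForm (z : Fin 4 → ℂ) (d : Fin 4) : ℝ :=
  Complex.normSq (z (d - 1)) + Complex.normSq (z d) -
    2 * √2 * (conj (leftPhase * z (d - 1)) * z d).re

/-- After removal of the phases the form is quadratic in the real `t d`. The cross term between the
directions 3 and 0 has the opposite sign, because the fourth power of the left phase is -1; this
makes the form a sum of two squares. -/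
theorem sum_turnForm_nonneg {z : Fin 4 → ℂ} {K : ℂ} {t : Fin 4 → ℝ} (hK : Complex.normSq K = 1)
    (h : ∀ d, z d * K = t d * leftPhase ^ d.val) : 0 ≤ ∑ d, turnForm z d := by
  have hsq : ∀ d, Complex.normSq (z d) = t d ^ 2 := by
    intro d
    have := congrArg Complex.normSq (h d)
    rw [Complex.normSq_mul, Complex.normSq_mul, hK, map_pow, DobrushinDomain.normSq_leftPhase,
      one_pow, Complex.normSq_ofReal] at this
    linarith
  have hmul : ∀ a b : ℂ, conj a * b = conj (a * K) * (b * K) := by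
    intro a b
    have : K * conj K = 1 := by rw [Complex.mul_conj, hK, Complex.ofReal_one]
    rw [map_mul]
    linear_combination (-(conj a * b)) * this
  have hconj : conj leftPhase * leftPhase = 1 := by
    rw [mul_comm, Complex.mul_conj, DobrushinDomain.normSq_leftPhase, Complex.ofReal_one]
  have hcross : ∀ c d, (conj (leftPhase * z c) * z d) =
      t c * t d * (conj leftPhase * conj leftPhase ^ c.val * leftPhase ^ d.val) := by
    intro c d
    rw [hmul, mul_assoc, h, h, map_mul, map_mul, map_pow, Complex.conj_ofReal]
    ring
  have hnext : ∀ n : ℕ, conj leftPhase * conj leftPhase ^ n * leftPhase ^ (n + 1) = 1 := by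
    intro n
    rw [← pow_succ', ← mul_pow, hconj, one_pow]
  have hwrap : conj leftPhase * conj leftPhase ^ 3 = -1 := by
    rw [← pow_succ', ← map_pow, leftPhase_pow_four, map_neg, map_one]
  have h0 : (conj (leftPhase * z 3) * z 0).re = -(t 3 * t 0) := by
    rw [hcross, show (3 : Fin 4).val = 3 from rfl, show (0 : Fin 4).val = 0 from rfl, hwrap]
    simp
  have h1 : (conj (leftPhase * z 0) * z 1).re = t 0 * t 1 := by
    rw [hcross, show (1 : Fin 4).val = 0 + 1 from rfl, show (0 : Fin 4).val = 0 from rfl, hnext]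
    simp
  have h2 : (conj (leftPhase * z 1) * z 2).re = t 1 * t 2 := by
    rw [hcross, show (2 : Fin 4).val = 1 + 1 from rfl, show (1 : Fin 4).val = 1 from rfl, hnext]
    simp
  have h3 : (conj (leftPhase * z 2) * z 3).re = t 2 * t 3 := by
    rw [hcross, show (3 : Fin 4).val = 2 + 1 from rfl, show (2 : Fin 4).val = 2 from rfl, hnext]
    simp
  have hs : √2 ^ 2 = 2 := Real.sq_sqrt (by norm_num)
  simp only [turnForm, Fin.sum_univ_four, hsq, show (0 : Fin 4) - 1 = 3 from rfl,
    show (1 : Fin 4) - 1 = 0 from rfl, show (2 : Fin 4) - 1 = 1 from rfl,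
    show (3 : Fin 4) - 1 = 2 from rfl, h0, h1, h2, h3]
  have key : 0 ≤ (t 0 + t 2 - √2 * t 1) ^ 2 + (t 2 - t 0 - √2 * t 3) ^ 2 := by positivity
  linear_combination key + (t 1 ^ 2 + t 3 ^ 2) * hs

theorem normSq_sqrt_two_mul_sub (a b : ℂ) : Complex.normSq (√2 * b - a) =
    2 * Complex.normSq b + Complex.normSq a - 2 * √2 * (conj a * b).re := by
  have hs : √2 * √2 = 2 := Real.mul_self_sqrt (by norm_num)
  simp only [Complex.normSq_apply, Complex.sub_re, Complex.sub_im, Complex.mul_re, Complex.mul_im,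
    Complex.ofReal_re, Complex.ofReal_im, Complex.conj_re, Complex.conj_im]
  linear_combination (b.re ^ 2 + b.im ^ 2) * hs

namespace DobrushinDomain

variable {D : DobrushinDomain}

/-- In this form the rate is the coefficient produced by `turnForm` at a forced left turn, where the
form equals (2 - 2√2) times the squared modulus. -/
theorem rho_eq : (rho : ℝ) = 2 * √2 - 2 := by
  have hs : √2 * √2 = 2 := Real.mul_self_sqrt (by norm_num)
  have h0 : (√2 + 1 : ℝ) ≠ 0 := by positivity
  rw [rho]
  push_cast
  rw [div_eq_iff h0]
  linear_combination (-2 : ℝ) * hs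

theorem sum_turnForm_black (D : DobrushinDomain) (x : Site) :
    0 ≤ ∑ d, turnForm (fun d => D.F (x, d)) d := by
  obtain ⟨t, ht⟩ := D.exists_F_eq_real_mul
  exact sum_turnForm_nonneg (K := leftPhase ^ D.startEdge.2.val) (t := fun d => t (x, d))
    (by rw [map_pow, normSq_leftPhase, one_pow]) fun d => ht (x, d)

theorem sum_turnForm_white (D : DobrushinDomain) (f : Face) :
    0 ≤ ∑ d, turnForm (fun d => D.F (corner f d, d)) d := by
  obtain ⟨t, ht⟩ := D.exists_F_eq_real_mul
  exact sum_turnForm_nonneg (K := leftPhase ^ D.startEdge.2.val) (t := fun d => t (corner f d, d))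
    (by rw [map_pow, normSq_leftPhase, one_pow]) fun d => ht (corner f d, d)

theorem F_relation_of_ne {x : Site} {d : Fin 4} (hv : edgeAt x d ∈ D.edges)
    (hw : edgeAt x d ∉ D.wiredEdges) (hne : (x, d) ≠ D.startEdge) :
    √2 * D.F (x, d) = leftPhase * (D.F (x, d - 1) + Complex.I * D.F (x + dir d, d + 1)) := by
  rw [← F_relation hv hw, startSign, if_neg hne, one_mul]

namespace IsPotential

variable {H : Site → ℝ} {H' : Face → ℝ}

/-- Both black values are compared through the common left face; `F_relation` expresses the value of
F at the far end by two values at `x`, so only values around `x` remain. -/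
theorem black_of_mem_edges (hH : D.IsPotential H H') {x : Site} (hxw : x ∉ D.wiredSites)
    {d : Fin 4} (hv : edgeAt x d ∈ D.edges) :
    H (x + dir d) - H x = turnForm (fun d => D.F (x, d)) d := by
  have hw : edgeAt x d ∉ D.wiredEdges := fun h => hxw (D.wiredEdge_ends h).1
  have hne : (x, d) ≠ D.startEdge := fun h => hxw (by
    have := D.startEdge_mem_Outer.1
    rwa [← h] at this)
  have hrel := F_relation_of_ne hv hw hne
  obtain ⟨-, rB, rC, -⟩ := D.regular_of_edge hv hw
  have h1 := hH.sub_eq x d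
  have h2 := hH.sub_eq (x + dir d) (d + 1)
  rw [increment_of_regular' rB] at h1
  rw [increment_of_regular' rC, faceAt_left] at h2
  have h3 : Complex.normSq (D.F (x + dir d, d + 1)) =
      Complex.normSq (√2 * D.F (x, d) - leftPhase * D.F (x, d - 1)) := by
    rw [hrel, mul_add, add_sub_cancel_left, Complex.normSq_mul, Complex.normSq_mul,
      normSq_leftPhase, Complex.normSq_I, one_mul, one_mul]
  rw [normSq_sqrt_two_mul_sub, Complex.normSq_mul, normSq_leftPhase, one_mul] at h3
  rw [turnForm]
  linarith

theorem black_of_notMem_edges (hH : D.IsPotential H H') {x : Site} (hx : x ∈ D.sites)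
    (hxw : x ∉ D.wiredSites) {d : Fin 4} (hv : edgeAt x d ∉ D.edges) :
    rho * (0 - H x) = turnForm (fun d => D.F (x, d)) d := by
  have hout := hv
  rw [D.mem_edges_iff, not_or] at hout
  have h1 := hH.eq_normSq_of_outside hx hxw hout.1
  have h2 := hH.eq_normSq_of_outside hx hxw hout.2
  rw [turnForm, ← F_of_notMem_edges hv hxw, ← h1, ← h2, mul_comm (conj _), Complex.mul_conj,
    Complex.ofReal_re, ← h1, rho_eq]
  ring

/-- The potential on the black faces is subharmonic. -/
theorem black_laplacian_nonneg (hH : D.IsPotential H H') {x : Site} (hx : x ∈ D.sites)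
    (hxw : x ∉ D.wiredSites) : 0 ≤ ∑ d, (if edgeAt x d ∈ D.edges then H (x + dir d) - H x
      else rho * (0 - H x)) := by
  refine (D.sum_turnForm_black x).trans_eq (Finset.sum_congr rfl fun d _ => ?_)
  split_ifs with hv
  · exact (hH.black_of_mem_edges hxw hv).symm
  · exact (hH.black_of_notMem_edges hx hxw hv).symm

/-- The white neighbours are compared through a common black corner, and the relation is solved for
the value outside `f`. Since black minus white is the increment, the form enters with a minus sign.
-/
theorem white_of_notMem_wiredEdges (hH : D.IsPotential H H') {f : Face} (hf : f ∈ D.faces)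
    {c : Fin 4} (hw : edgeAt (corner f c) c ∉ D.wiredEdges) :
    H' (faceAt (corner f c) (c - 1)) - H' f =
      -turnForm (fun d => D.F (corner f d, d)) (c + 1) := by
  have hfc : faceAt (corner f c) c ∈ D.faces := by rwa [faceAt_corner]
  have hv : edgeAt (corner f c) c ∈ D.edges := D.mem_edges_iff.2 (.inl hfc)
  have hne : (corner f c, c) ≠ D.startEdge := fun h => by
    have := D.startEdge_mem_Outer.2
    rw [← h] at this
    exact this hfc
  have hrel := F_relation_of_ne hv hw hne
  obtain ⟨rA, rB, -, -⟩ := D.regular_of_edge hv hw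
  have h1 := hH.sub_eq (corner f c) c
  have h2 := hH.sub_eq (corner f c) (c - 1)
  rw [increment_of_regular' rB, faceAt_corner] at h1
  rw [increment_of_regular' rA] at h2
  rw [corner_add_dir] at hrel
  rw [turnForm, add_sub_cancel_right]
  generalize D.F (corner f c, c - 1) = a at *
  generalize D.F (corner f c, c) = b at *
  generalize D.F (corner f (c + 1), c + 1) = u at *
  have h3 : Complex.normSq a = Complex.normSq (√2 * b - leftPhase * Complex.I * u) := by
    rw [hrel, show leftPhase * (a + Complex.I * u) - leftPhase * Complex.I * u = leftPhase * a by
      ring, Complex.normSq_mul, normSq_leftPhase, one_mul]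
  rw [normSq_sqrt_two_mul_sub, Complex.normSq_mul, Complex.normSq_mul, normSq_leftPhase,
    Complex.normSq_I, one_mul, one_mul] at h3
  have h4 : (conj (leftPhase * Complex.I * u) * b).re = (conj (leftPhase * b) * u).re := by
    rw [← Complex.conj_re, map_mul, Complex.conj_conj, map_mul, conj_leftPhase]
    ring_nf
  rw [h4] at h3
  linarith

/-- The forced turn along the wired edge makes the two values of F differ by the left phase, and
their squared modulus is 1 - H'(f) because H = 1 on the wired arc. -/
theorem white_of_mem_wiredEdges (hH : D.IsPotential H H') {f : Face} (hf : f ∈ D.faces)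
    {c : Fin 4} (hw : edgeAt (corner f c) c ∈ D.wiredEdges) :
    rho * (1 - H' f) = -turnForm (fun d => D.F (corner f d, d)) (c + 1) := by
  have hfc : faceAt (corner f c) c ∈ D.faces := by rwa [faceAt_corner]
  have h1 := hH.sub_eq (corner f c) c
  rw [increment_of_mem_faces hfc, faceAt_corner, hH.wired _ (D.wiredEdge_ends hw).1] at h1
  have h2 := F_of_wiredEdge hw hfc
  rw [corner_add_dir] at h2
  have h3 : leftPhase * D.F (corner f c, c) = D.F (corner f (c + 1), c + 1) := by
    rw [h2, mul_inv_cancel_left₀ leftPhase_ne_zero]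
  have h4 : Complex.normSq (D.F (corner f c, c)) =
      Complex.normSq (D.F (corner f (c + 1), c + 1)) := by
    rw [← h3, Complex.normSq_mul, normSq_leftPhase, one_mul]
  rw [turnForm, add_sub_cancel_right, h3, mul_comm (conj _), Complex.mul_conj, Complex.ofReal_re,
    ← h4, h1, rho_eq]
  ring

/-- The potential on the white faces is superharmonic. -/
theorem white_laplacian_nonpos (hH : D.IsPotential H H') {f : Face} (hf : f ∈ D.faces) :
    ∑ c, (if edgeAt (corner f c) c ∈ D.wiredEdges then rho * (1 - H' f)
      else H' (faceAt (corner f c) (c - 1)) - H' f) ≤ 0 := by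
  have : ∑ c, (if edgeAt (corner f c) c ∈ D.wiredEdges then rho * (1 - H' f)
      else H' (faceAt (corner f c) (c - 1)) - H' f) =
        -∑ c, turnForm (fun d => D.F (corner f d, d)) (c + 1) := by
    rw [← Finset.sum_neg_distrib]
    refine Finset.sum_congr rfl fun c _ => ?_
    split_ifs with hw
    · exact hH.white_of_mem_wiredEdges hf hw
    · exact hH.white_of_notMem_wiredEdges hf hw
  have h := Equiv.sum_comp (Equiv.addRight (1 : Fin 4))
    fun d => turnForm (fun d => D.F (corner f d, d)) d
  simp only [Equiv.coe_addRight] at h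
  rw [this, h]
  exact neg_nonpos.2 (D.sum_turnForm_white f)

end IsPotential

end DobrushinDomain

end FKIsing

/-! ### Hitting probabilities through the jump chain -/

namespace FKIsing

open MeasureTheory ProbabilityTheory

instance : IsProbabilityMeasure (expMeasure 1) := isProbabilityMeasure_expMeasure one_pos

theorem ae_pos_expMeasure : ∀ᵐ x ∂expMeasure 1, 0 < x := by
  have h := cdf_expMeasure_eq one_pos 0
  rw [cdf_eq_real, if_pos le_rfl] at h
  simp only [mul_zero, neg_zero, Real.exp_zero, sub_self] at h
  rw [ae_iff]
  have h' := (measureReal_eq_zero_iff).1 h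
  simpa only [not_lt] using! h'

namespace FourWayWalk

variable {S : Type} (w : FourWayWalk S)

theorem holdingRate_pos (s : S) : 0 < w.holdingRate s := by
  unfold holdingRate
  split_ifs with h
  · exact one_pos
  · exact pos_iff_ne_zero.2 h

theorem rate_eq_zero {s : S} (h : w.totalRate s = 0) (d : Fin 4) : w.rate s d = 0 :=
  (Finset.sum_eq_zero_iff.1 h) d (Finset.mem_univ d)

theorem jumpTime_strictMono {ω : (ℕ → S) × (ℕ → ℝ)} (h : ∀ k, 0 < ω.2 k) :
    StrictMono (w.jumpTime ω) := by
  refine strictMono_nat_of_lt_succ fun n => ?_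
  rw [jumpTime, jumpTime, Finset.sum_range_succ]
  have := div_pos (h n) (NNReal.coe_pos.2 (w.holdingRate_pos (ω.1 n)))
  linarith

/-- When all holding times are positive and absorbing states are never left, the walk hits `A`
before the set `B` of absorbing states as soon as its jump chain hits `A`. -/
theorem mem_hitsBefore_iff {A B : Set S} (hB : ∀ s ∈ B, w.totalRate s = 0) (hAB : Disjoint A B)
    {ω : (ℕ → S) × (ℕ → ℝ)} (h : ∀ k, 0 < ω.2 k)
    (habs : ∀ k, w.totalRate (ω.1 k) = 0 → ω.1 (k + 1) = ω.1 k) :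
    ω ∈ w.hitsBefore A B ↔ ∃ n, ω.1 n ∈ A := by
  have hmono := w.jumpTime_strictMono h
  constructor
  · rintro ⟨t, -, ⟨s, hs, n, -, -, rfl⟩, -⟩
    exact ⟨n, hs⟩
  · rintro ⟨n, hn⟩
    refine ⟨w.jumpTime ω n, ?_, ⟨_, hn, n, le_rfl, hmono n.lt_succ_self, rfl⟩, ?_⟩
    · have := hmono.monotone (Nat.zero_le n)
      rwa [jumpTime, Finset.sum_range_zero] at this
    · rintro r - hr s hs ⟨m, hm, -, rfl⟩
      have hmn : m < n := hmono.lt_iff_lt.1 (hm.trans_lt hr)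
      have : ∀ k, m ≤ k → ω.1 k = ω.1 m := fun k hk => by
        induction k, hk using Nat.le_induction with
        | base => rfl
        | succ k _ ih => rw [habs k (by rw [ih]; exact hB _ hs), ih]
      rw [this n hmn.le] at hn
      exact Set.disjoint_left.1 hAB hn hs

variable [MeasurableSpace S] [DiscreteMeasurableSpace S]

instance (s : S) : IsProbabilityMeasure (w.chainLaw s) := by
  unfold chainLaw; infer_instance

/-- The mean of `g` after one jump. -/
noncomputable def stepMean (g : S → ℝ≥0∞) (s : S) : ℝ≥0∞ := ∫⁻ y, g y ∂w.jumpLaw s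

theorem lintegral_chainLaw_zero (g : S → ℝ≥0∞) (s : S) :
    ∫⁻ ω, g (ω 0) ∂w.chainLaw s = g s := by
  have hg : Measurable g := .of_discrete
  -- The initial law in `trajMeasure` is transported to histories indexed by `Iic 0`; a Dirac mass
  -- remains one.
  have h0 : Measure.map (MeasurableEquiv.piUnique fun _ : Finset.Iic 0 => S).symm
      (Measure.dirac s) = Measure.dirac ((MeasurableEquiv.piUnique fun _ => S).symm s) :=
    Measure.map_dirac' (MeasurableEquiv.measurable _) s
  rw [chainLaw, Kernel.trajMeasure]
  erw [h0]
  rw [Measure.dirac_bind (Kernel.measurable _)]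
  have h := Kernel.traj_map_frestrictLe_apply (X := fun _ => S)
    (κ := fun n => w.jumpKernel.comap (fun h : (i : Finset.Iic n) → S =>
      h ⟨n, Finset.mem_Iic.2 le_rfl⟩) (measurable_pi_apply _)) 0 0
    ((MeasurableEquiv.piUnique fun _ : Finset.Iic 0 => S).symm s)
  rw [Kernel.partialTraj_self, Kernel.id_apply] at h
  have h' := congrArg (fun μ => ∫⁻ p, g (p ⟨0, Finset.mem_Iic.2 le_rfl⟩) ∂μ) h
  beta_reduce at h'
  rw [lintegral_map (by fun_prop) (by fun_prop), lintegral_dirac' _ (by fun_prop)] at h'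
  exact h'

/-- The Markov property at time `n`, obtained from the joint law of the history and the next state.
-/
theorem lintegral_chainLaw_pair [Countable S] (g : S × S → ℝ≥0∞) (s : S) (n : ℕ) :
    ∫⁻ ω, g (ω n, ω (n + 1)) ∂w.chainLaw s =
      ∫⁻ ω, ∫⁻ y, g (ω n, y) ∂w.jumpLaw (ω n) ∂w.chainLaw s := by
  have hg : Measurable g := .of_discrete
  have hG : Measurable fun s => ∫⁻ y, g (s, y) ∂w.jumpLaw s := .of_discrete
  have h := Kernel.map_frestrictLe_trajMeasure_compProd_eq_map_trajMeasure
    (X := fun _ => S) (μ₀ := Measure.dirac s) (a := n)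
    (κ := fun n => w.jumpKernel.comap (fun h : (i : Finset.Iic n) → S =>
      h ⟨n, Finset.mem_Iic.2 le_rfl⟩) (measurable_pi_apply _))
  have h' := congrArg (fun μ => ∫⁻ p, g (p.1 ⟨n, Finset.mem_Iic.2 le_rfl⟩, p.2) ∂μ) h
  beta_reduce at h'
  rw [Measure.lintegral_compProd (by fun_prop), lintegral_map (by fun_prop) (by fun_prop),
    lintegral_map (by fun_prop) (by fun_prop)] at h'
  · exact h'.symm

theorem lintegral_chainLaw [Countable S] (g : S → ℝ≥0∞) (s : S) (n : ℕ) :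
    ∫⁻ ω, g (ω n) ∂w.chainLaw s = (w.stepMean^[n] g) s := by
  induction n generalizing g with
  | zero => exact w.lintegral_chainLaw_zero g s
  | succ n ih =>
    rw [w.lintegral_chainLaw_pair (fun p => g p.2) s n, Function.iterate_succ_apply, ← ih]
    rfl

/-- The law of two successive states gives no mass to pairs that leave an absorbing state. -/
theorem ae_eq_of_totalRate_eq_zero [Countable S] (s : S) :
    ∀ᵐ ω ∂w.chainLaw s, ∀ n, w.totalRate (ω n) = 0 → ω (n + 1) = ω n := by
  refine ae_all_iff.2 fun n => ?_
  let E : Set (S × S) := {p | w.totalRate p.1 = 0 ∧ p.2 ≠ p.1}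
  have h := w.lintegral_chainLaw_pair (E.indicator 1) s n
  have h0 : ∀ x, ∫⁻ y, E.indicator 1 (x, y) ∂w.jumpLaw x = 0 := fun x => by
    by_cases hx : w.totalRate x = 0
    · rw [jumpLaw, if_pos hx, lintegral_dirac]
      exact Set.indicator_of_notMem (fun h => h.2 rfl) _
    · refine (lintegral_congr fun y => Set.indicator_of_notMem (fun h => hx h.1) _).trans ?_
      simp
  simp only [h0, lintegral_zero] at h
  have hE : Measurable (E.indicator (1 : S × S → ℝ≥0∞)) := .of_discrete
  rw [lintegral_eq_zero_iff (by fun_prop)] at h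
  filter_upwards [h] with ω hω h1
  by_contra h2
  have : (ω n, ω (n + 1)) ∈ E := ⟨h1, h2⟩
  simp [Set.indicator_of_mem this] at hω

theorem stepMean_of_totalRate_eq_zero {s : S} (h : w.totalRate s = 0) (g : S → ℝ≥0∞) :
    w.stepMean g s = g s := by
  rw [stepMean, jumpLaw, if_pos h, lintegral_dirac]

theorem stepMean_of_totalRate_ne_zero {s : S} (h : w.totalRate s ≠ 0) (g : S → ℝ≥0∞) :
    w.stepMean g s =
      ∑ d, ((w.rate s d / w.totalRate s : ℝ≥0) : ℝ≥0∞) * g (w.target s d) := by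
  rw [stepMean, jumpLaw, if_neg h, lintegral_finsetSum_measure]
  simp only [lintegral_smul_measure, lintegral_dirac, smul_eq_mul]

theorem iterate_stepMean_of_totalRate_eq_zero {s : S} (h : w.totalRate s = 0)
    (g : S → ℝ≥0∞) (n : ℕ) : (w.stepMean^[n] g) s = g s := by
  induction n with
  | zero => rfl
  | succ n ih => rw [Function.iterate_succ_apply', w.stepMean_of_totalRate_eq_zero h, ih]

theorem stepMean_mono : Monotone w.stepMean := fun _ _ h _ => lintegral_mono h

theorem monotone_iterate_stepMean {A : Set S} (hA : ∀ s ∈ A, w.totalRate s = 0) :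
    Monotone fun n => w.stepMean^[n] (A.indicator 1) := by
  refine w.stepMean_mono.monotone_iterate_of_le_map fun s => ?_
  by_cases hs : s ∈ A
  · rw [w.stepMean_of_totalRate_eq_zero (hA s hs)]
  · rw [Set.indicator_of_notMem hs]
    exact zero_le

/-- The hitting probability of a set of absorbing states, computed on the jump chain. -/
theorem law_hitsBefore [Countable S] {A B : Set S} (hA : ∀ s ∈ A, w.totalRate s = 0)
    (hB : ∀ s ∈ B, w.totalRate s = 0) (hAB : Disjoint A B) (s : S) :
    w.law s (w.hitsBefore A B) = ⨆ n, (w.stepMean^[n] (A.indicator 1)) s := by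
  have h1 : ∀ᵐ ω ∂w.law s, ∀ k, 0 < ω.2 k := by
    refine Measure.quasiMeasurePreserving_snd.ae (p := fun τ : ℕ → ℝ => ∀ k, 0 < τ k)
      (ae_all_iff.2 fun k => ?_)
    exact (measurePreserving_eval_infinitePi (fun _ : ℕ => expMeasure 1) k).quasiMeasurePreserving.ae ae_pos_expMeasure
  have h2 : ∀ᵐ ω ∂w.law s, ∀ k, w.totalRate (ω.1 k) = 0 → ω.1 (k + 1) = ω.1 k :=
    Measure.quasiMeasurePreserving_fst.ae
      (p := fun ω : ℕ → S => ∀ k, w.totalRate (ω k) = 0 → ω (k + 1) = ω k) (w.ae_eq_of_totalRate_eq_zero s)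
  have h3 : w.hitsBefore A B =ᵐ[w.law s] {ω : ℕ → S | ∃ n, ω n ∈ A} ×ˢ Set.univ := by
    filter_upwards [h1, h2] with ω h1 h2
    refine propext ((w.mem_hitsBefore_iff hB hAB h1 h2).trans ?_)
    exact ⟨fun h => ⟨h, trivial⟩, fun h => h.1⟩
  rw [measure_congr h3, law, Measure.prod_prod, measure_univ, mul_one, Set.ofPred_exists,
    measure_iUnion_eq_iSup_accumulate]
  refine iSup_congr fun n => ?_
  rw [← lintegral_chainLaw]
  -- Since `A` is absorbing, having visited `A` by time `n` is almost surely the same as being in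
  -- `A` at time `n`.
  have h4 : Set.accumulate (fun n => {ω : ℕ → S | ω n ∈ A}) n =ᵐ[w.chainLaw s]
      {ω | ω n ∈ A} := by
    filter_upwards [w.ae_eq_of_totalRate_eq_zero s] with ω hω
    refine propext ⟨fun h => ?_, fun h => Set.mem_accumulate.2 ⟨n, le_rfl, h⟩⟩
    obtain ⟨m, hm, hmA⟩ := Set.mem_accumulate.1 h
    have hmA : ω m ∈ A := hmA
    change ω n ∈ A
    induction n, hm using Nat.le_induction with
    | base => exact hmA
    | succ k _ ih =>
      have hk : ω k ∈ A := ih (Set.mem_accumulate.2 ⟨m, by assumption, hmA⟩)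
      rwa [hω k (hA _ hk)]
  have h5 : MeasurableSet {ω : ℕ → S | ω n ∈ A} :=
    measurable_pi_apply n (MeasurableSet.of_discrete (s := A))
  rw [measure_congr h4, ← lintegral_indicator_one h5]
  rfl

theorem hittingProb_nonneg (s : S) (A B : Set S) : 0 ≤ w.hittingProb s A B :=
  ENNReal.toReal_nonneg

theorem hittingProb_eq_one [Countable S] {A B : Set S} (hA : ∀ s ∈ A, w.totalRate s = 0)
    (hB : ∀ s ∈ B, w.totalRate s = 0) (hAB : Disjoint A B) {s : S} (hs : s ∈ A) : w.hittingProb s A B = 1 := by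
  rw [hittingProb, w.law_hitsBefore hA hB hAB]
  simp [w.iterate_stepMean_of_totalRate_eq_zero (hA s hs), hs]

theorem hittingProb_eq_zero [Countable S] {A B : Set S} (hA : ∀ s ∈ A, w.totalRate s = 0)
    (hB : ∀ s ∈ B, w.totalRate s = 0) (hAB : Disjoint A B) {s : S} (hs : s ∉ A) (h : w.totalRate s = 0) :
    w.hittingProb s A B = 0 := by
  rw [hittingProb, w.law_hitsBefore hA hB hAB]
  simp [w.iterate_stepMean_of_totalRate_eq_zero h, hs]

/-- The hitting probability is harmonic for the walk. -/
theorem sum_rate_mul_sub_hittingProb [Countable S] {A B : Set S} (hA : ∀ s ∈ A, w.totalRate s = 0)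
    (hB : ∀ s ∈ B, w.totalRate s = 0) (hAB : Disjoint A B) (s : S) :
    ∑ d, (w.rate s d : ℝ) * (w.hittingProb (w.target s d) A B - w.hittingProb s A B) = 0 := by
  by_cases h : w.totalRate s = 0
  · simp [w.rate_eq_zero h]
  have hfin : ∀ s, w.law s (w.hitsBefore A B) ≠ ⊤ := fun s => by
    have : IsProbabilityMeasure (w.law s) := by unfold law; infer_instance
    exact measure_ne_top _ _
  -- Monotone convergence passes the supremum through one step of the chain, and an increasing
  -- sequence shifted by one has the same supremum.
  have key : w.law s (w.hitsBefore A B) = w.stepMean (fun s => w.law s (w.hitsBefore A B)) s := by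
    simp only [w.law_hitsBefore hA hB hAB]
    have hm := w.monotone_iterate_stepMean hA
    rw [stepMean, lintegral_iSup (fun _ => .of_discrete) fun _ _ h s => hm h s,
      ← Monotone.iSup_nat_add (fun _ _ h => hm h s) 1]
    simp only [Function.iterate_succ_apply']
    rfl
  rw [w.stepMean_of_totalRate_ne_zero h] at key
  have key' := congrArg ENNReal.toReal key
  rw [ENNReal.toReal_sum fun d _ => ENNReal.mul_ne_top ENNReal.coe_ne_top (hfin _)] at key'
  simp only [ENNReal.toReal_mul, ENNReal.coe_toReal, NNReal.coe_div] at key'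
  change w.hittingProb s A B = ∑ d, _ * w.hittingProb (w.target s d) A B at key'
  have h' : (w.totalRate s : ℝ) ≠ 0 := NNReal.coe_ne_zero.2 h
  have hsum : (w.totalRate s : ℝ) = ∑ d, (w.rate s d : ℝ) := by
    rw [totalRate, NNReal.coe_sum]
  simp only [mul_sub, Finset.sum_sub_distrib]
  rw [← Finset.sum_mul, ← hsum, sub_eq_zero, key', Finset.mul_sum]
  refine Finset.sum_congr rfl fun d _ => ?_
  field_simp

end FourWayWalk

end FKIsing

/-! ### The maximum principle and the comparison with harmonic measures -/

namespace FKIsing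

/-- The maximum principle on a finite set of lattice points, with arbitrary nonpositive boundary
values. -/
theorem nonpos_of_subharmonic (U : Finset (ℤ × ℤ)) (v : ℤ × ℤ → ℝ) (r t : ℤ × ℤ → Fin 4 → ℝ)
    (hr : ∀ x ∈ U, ∀ d, 0 < r x d) (hsub : ∀ x ∈ U, 0 ≤ ∑ d, r x d * (t x d - v x))
    (ht : ∀ x ∈ U, ∀ d, (t x d = v (x + dir d) ∧ x + dir d ∈ U) ∨ t x d ≤ 0) :
    ∀ x ∈ U, v x ≤ 0 := by
  by_contra! hpos
  obtain ⟨x₀, hx₀, hv₀⟩ := hpos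
  obtain ⟨m, hm, hmax⟩ := U.exists_max_image v ⟨x₀, hx₀⟩
  have hM : 0 < v m := hv₀.trans_le (hmax x₀ hx₀)
  -- The easternmost maximum point is taken: equality in the mean value inequality would pass the
  -- maximum to its eastern neighbour. No connectedness of `U` is needed.
  obtain ⟨x, hx, hxmax⟩ := (U.filter fun x => v x = v m).exists_max_image Prod.fst
    ⟨m, Finset.mem_filter.2 ⟨hm, rfl⟩⟩
  obtain ⟨hxU, hxv⟩ := Finset.mem_filter.1 hx
  have hle : ∀ d, r x d * (t x d - v x) ≤ 0 := fun d => by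
    refine mul_nonpos_of_nonneg_of_nonpos (hr x hxU d).le ?_
    rcases ht x hxU d with ⟨h, hU⟩ | h
    · linarith [hmax _ hU]
    · linarith
  have h0 := (Finset.sum_eq_zero_iff_of_nonpos fun d _ => hle d).1
    (le_antisymm (Finset.sum_nonpos fun d _ => hle d) (hsub x hxU)) 0 (Finset.mem_univ _)
  have h1 : t x 0 = v m := by
    rcases mul_eq_zero.1 h0 with h | h
    · exact absurd h (hr x hxU 0).ne'
    · linarith
  rcases ht x hxU 0 with ⟨h, hU⟩ | h
  · have h2 := hxmax _ (Finset.mem_filter.2 ⟨hU, h ▸ h1⟩)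
    simp [dir] at h2
  · linarith

theorem rho_pos : 0 < DobrushinDomain.rho :=
  div_pos two_pos (add_pos_of_nonneg_of_pos zero_le one_pos)

namespace DobrushinDomain

variable (D : DobrushinDomain)

section black

theorem blackWalk_totalRate_wired {s : Site ⊕ Site}
    (h : s ∈ {s : Site ⊕ Site | ∃ x ∈ D.wiredSites, s = .inl x}) : D.blackWalk.totalRate s = 0 := by
  obtain ⟨x, hx, rfl⟩ := h
  simp [FourWayWalk.totalRate, blackWalk, hx]

theorem blackWalk_totalRate_inr {s : Site ⊕ Site}
    (h : s ∈ {s : Site ⊕ Site | ∃ x, s = .inr x}) : D.blackWalk.totalRate s = 0 := by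
  obtain ⟨x, rfl⟩ := h
  simp [FourWayWalk.totalRate, blackWalk]

theorem disjoint_wired_inr : Disjoint {s : Site ⊕ Site | ∃ x ∈ D.wiredSites, s = .inl x}
    {s | ∃ x, s = .inr x} :=
  Set.disjoint_left.2 fun _ ⟨_, _, h⟩ ⟨_, h'⟩ => by simp [h] at h'

theorem HMBlack_of_mem_wiredSites {x : Site} (hx : x ∈ D.wiredSites) : D.HMBlack x = 1 :=
  D.blackWalk.hittingProb_eq_one (fun _ => D.blackWalk_totalRate_wired)
    (fun _ => D.blackWalk_totalRate_inr) D.disjoint_wired_inr ⟨x, hx, rfl⟩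

/-- A potential is at most the harmonic measure of the wired arc. -/
theorem IsPotential.le_HMBlack {D : DobrushinDomain} {H : Site → ℝ} {H' : Face → ℝ}
    (hH : D.IsPotential H H') {x : Site} (hx : x ∈ D.sites) : H x ≤ D.HMBlack x := by
  by_cases hxw : x ∈ D.wiredSites
  · rw [D.HMBlack_of_mem_wiredSites hxw, hH.wired x hxw]
  let p : Site ⊕ Site → ℝ := fun s => D.blackWalk.hittingProb s
    {s | ∃ x ∈ D.wiredSites, s = .inl x} {s | ∃ x, s = .inr x}
  have hp : ∀ s, 0 ≤ p s := fun s => D.blackWalk.hittingProb_nonneg _ _ _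
  -- The principle is applied to the difference of the subharmonic potential and the harmonic
  -- hitting probability; targets in the extra layer enter with the potential 0.
  have key := nonpos_of_subharmonic (D.sites \ D.wiredSites) (fun x => H x - p (.inl x))
    (fun x d => if edgeAt x d ∈ D.edges then 1 else rho)
    (fun x d => if edgeAt x d ∈ D.edges then H (x + dir d) - p (.inl (x + dir d))
      else 0 - p (.inr (x + dir d))) ?_ ?_ ?_ x (Finset.mem_sdiff.2 ⟨hx, hxw⟩)
  · exact sub_nonpos.1 key
  · intro x _ d
    split_ifs
    exacts [one_pos, rho_pos]
  · intro x hx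
    obtain ⟨hx, hxw⟩ := Finset.mem_sdiff.1 hx
    have h1 := hH.black_laplacian_nonneg hx hxw
    have h2 := D.blackWalk.sum_rate_mul_sub_hittingProb
      (fun _ => D.blackWalk_totalRate_wired) (fun _ => D.blackWalk_totalRate_inr)
      D.disjoint_wired_inr (.inl x)
    change ∑ d, ((D.blackWalk.rate (.inl x) d : ℝ≥0) : ℝ) *
      (p (D.blackWalk.target (.inl x) d) - p (.inl x)) = 0 at h2
    refine (h1.trans_eq (sub_zero _).symm).trans_eq ?_
    rw [← h2, ← Finset.sum_sub_distrib]
    refine Finset.sum_congr rfl fun d _ => ?_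
    simp only [blackWalk, if_neg hxw]
    split_ifs
    · rw [NNReal.coe_one]; ring
    · ring
  · intro x hx d
    obtain ⟨hx, hxw⟩ := Finset.mem_sdiff.1 hx
    split_ifs with h
    · by_cases hw : x + dir d ∈ D.wiredSites
      · right
        rw [hH.wired _ hw, show p (.inl (x + dir d)) = 1 from D.HMBlack_of_mem_wiredSites hw,
          sub_self]
      · exact .inl ⟨rfl, Finset.mem_sdiff.2 ⟨D.mem_sites_of_edge' h, hw⟩⟩
    · right
      linarith [hp (.inr (x + dir d))]

end black

section white

/-- Sides are numbered by the direction of crossing, while the edge at `corner f c` runs in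
direction `c`; the two numberings differ by one. -/
theorem sideAt_eq (f : Face) (d : Fin 4) :
    sideAt f d = edgeAt (corner f (d + 1)) (d + 1) := by
  rw [edgeAt, corner_add_dir]
  fin_cases d <;> simp [sideAt, corner, Sym2.eq_swap]

theorem faceAt_corner_succ (f : Face) (d : Fin 4) :
    faceAt (corner f (d + 1)) d = f + dir d := by
  fin_cases d <;> simp [faceAt, corner, dir, add_assoc]

theorem freeWhiteFace_notMem {f : Face} (hf : f ∈ D.freeWhiteFaces) : f ∉ D.faces := by
  obtain ⟨k, hk, rfl⟩ := Finset.mem_image.1 hf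
  exact D.right_notMem k ((Finset.mem_range.1 hk).trans_le D.mid_le)

/-- A face outside that shares with a face inside a side not in the wired arc is on the free arc. -/
theorem add_dir_mem_freeWhiteFaces {f : Face} (hf : f ∈ D.faces) {d : Fin 4}
    (hw : sideAt f d ∉ D.wiredEdges) (hd : f + dir d ∉ D.faces) :
    f + dir d ∈ D.freeWhiteFaces := by
  rw [sideAt_eq] at hw
  rw [← faceAt_corner_succ] at hd ⊢
  obtain ⟨k, hk, hkx, hkd⟩ := D.exists_step (x := corner f (d + 1)) (d := d + 1)
    (by rwa [faceAt_corner]) (by rwa [add_sub_cancel_right])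
  have hkm : k < D.mid := by
    by_contra! h
    exact hw (by simpa only [hkx, hkd] using D.step_edge_mem_wiredEdges h hk)
  refine Finset.mem_image.2 ⟨k, Finset.mem_range.2 hkm, ?_⟩
  rw [hkx, hkd, add_sub_cancel_right]

theorem whiteWalk_totalRate_inr {s : Face ⊕ Face}
    (h : s ∈ {s : Face ⊕ Face | ∃ f, s = .inr f}) : D.whiteWalk.totalRate s = 0 := by
  obtain ⟨x, rfl⟩ := h
  simp [FourWayWalk.totalRate, whiteWalk]

theorem whiteWalk_totalRate_free {s : Face ⊕ Face}
    (h : s ∈ {s : Face ⊕ Face | ∃ f ∈ D.freeWhiteFaces, s = .inl f}) :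
    D.whiteWalk.totalRate s = 0 := by
  obtain ⟨f, hf, rfl⟩ := h
  simp [FourWayWalk.totalRate, whiteWalk, D.freeWhiteFace_notMem hf]

theorem disjoint_inr_free : Disjoint {s : Face ⊕ Face | ∃ f, s = .inr f}
    {s | ∃ f ∈ D.freeWhiteFaces, s = .inl f} :=
  Set.disjoint_left.2 fun _ ⟨_, h⟩ ⟨_, _, h'⟩ => by simp [h] at h'

/-- A potential is at least the harmonic measure of the wired arc. -/
theorem IsPotential.HMWhite_le {D : DobrushinDomain} {H : Site → ℝ} {H' : Face → ℝ}
    (hH : D.IsPotential H H') {f : Face} (hf : f ∈ D.faces) : D.HMWhite f ≤ H' f := by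
  let p : Face ⊕ Face → ℝ := fun s => D.whiteWalk.hittingProb s
    {s | ∃ f, s = .inr f} {s | ∃ f ∈ D.freeWhiteFaces, s = .inl f}
  -- Here the roles are reversed: hitting probability minus superharmonic potential is subharmonic,
  -- and the extra layer carries the potential 1.
  have key := nonpos_of_subharmonic D.faces (fun f => p (.inl f) - H' f)
    (fun f d => if sideAt f d ∈ D.wiredEdges then rho else 1)
    (fun f d => if sideAt f d ∈ D.wiredEdges then p (.inr (f + dir d)) - 1
      else p (.inl (f + dir d)) - H' (f + dir d)) ?_ ?_ ?_ f hf
  · exact sub_nonpos.1 key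
  · intro f _ d
    split_ifs
    exacts [rho_pos, one_pos]
  · intro f hf
    have h1 := hH.white_laplacian_nonpos hf
    have h2 := D.whiteWalk.sum_rate_mul_sub_hittingProb
      (fun _ => D.whiteWalk_totalRate_inr) (fun _ => D.whiteWalk_totalRate_free)
      D.disjoint_inr_free (.inl f)
    change ∑ d, ((D.whiteWalk.rate (.inl f) d : ℝ≥0) : ℝ) *
      (p (D.whiteWalk.target (.inl f) d) - p (.inl f)) = 0 at h2
    -- The sum over the corners of `f` is re-indexed as the sum over the crossing directions of the
    -- walk.
    rw [← Equiv.sum_comp (Equiv.addRight (1 : Fin 4))] at h1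
    simp only [Equiv.coe_addRight, add_sub_cancel_right, faceAt_corner_succ, ← sideAt_eq] at h1
    refine (sub_nonneg.2 h1).trans_eq ?_
    rw [← h2, ← Finset.sum_sub_distrib]
    refine Finset.sum_congr rfl fun d _ => ?_
    simp only [whiteWalk, if_pos hf]
    split_ifs
    · ring
    · rw [NNReal.coe_one]; ring
  · intro f hf d
    split_ifs with h
    · right
      rw [show p (.inr (f + dir d)) = 1 from D.whiteWalk.hittingProb_eq_one
        (fun _ => D.whiteWalk_totalRate_inr) (fun _ => D.whiteWalk_totalRate_free)
        D.disjoint_inr_free ⟨_, rfl⟩, sub_self]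
    · by_cases hd : f + dir d ∈ D.faces
      · exact .inl ⟨rfl, hd⟩
      · right
        have hfree := D.add_dir_mem_freeWhiteFaces hf h hd
        rw [hH.free _ hfree, show p (.inl (f + dir d)) = 0 from D.whiteWalk.hittingProb_eq_zero
          (fun _ => D.whiteWalk_totalRate_inr) (fun _ => D.whiteWalk_totalRate_free)
          D.disjoint_inr_free (by simp) (D.whiteWalk_totalRate_free ⟨_, hfree, rfl⟩), sub_self]

end white

end DobrushinDomain

end FKIsing

/-- Uniform comparability: for a medial edge `e` along the free arc of a Dobrushin domain, `B = e.1` is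
the black face that it borders, and `W` is any white face that is adjacent to `B` and not on the free
arc, that is, any face inside the domain with corner `B`. -/
theorem mainTheorem8 (D : FKIsing.DobrushinDomain) (e : FKIsing.MedialEdge)
    (he : D.IsFreeArcMedialEdge e) (W : FKIsing.Face) (hW : W ∈ D.faces)
    (hadj : ∃ d : Fin 4, FKIsing.faceAt e.1 d = W) :
    √(D.HMWhite W) ≤ ‖D.F e‖ ∧ ‖D.F e‖ ≤ √(D.HMBlack e.1) := by
  obtain ⟨H, H', hH⟩ := D.exists_isPotential
  obtain ⟨d, rfl⟩ := hadj
  have hF := hH.eq_normSq_of_isFreeArcMedialEdge he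
  rw [Complex.normSq_eq_norm_sq] at hF
  -- The medial edge between `B` and `W` has a nonnegative increment, which gives H'(W) ≤ H(B) =
  -- |F(e)|^2.
  have hsub := hH.sub_eq e.1 d
  rw [FKIsing.DobrushinDomain.increment_of_mem_faces hW] at hsub
  constructor
  · refine Real.sqrt_le_iff.2 ⟨norm_nonneg _, ?_⟩
    linarith [hH.HMWhite_le hW, Complex.normSq_nonneg (D.F (e.1, d))]
  · refine Real.le_sqrt_of_sq_le ?_
    rw [← hF]
    exact hH.le_HMBlack (D.mem_sites_iff.2 ⟨d, hW⟩)
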